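/- Let $I\subset\mathbb R$ be an interval which is open from the left (for every $t\in I$ there is $s\in I$ with $s<t$). Let $M$ be a finite-dimensional smooth Hausdorff manifold without boundary, $(g_t)_{t\in I}$ a family of Riemannian metric tensors on $M$ depending smoothly on $(t,x)\in I\times M$, and $V:I\times M\to\mathbb R$, $V_t=V(t,\cdot)$, a smooth function. Let $d_t$ be the Riemannian distance of $g_t$ (equal to $+\infty$ between points of different components of $M$). A $d_t$-geodesic is a curve $\gamma:[0,1]\to M$, $\tau\mapsto\gamma^\tau$, such that $d_t(\gamma^0,\gamma^1)<\infty$ and $d_t(\gamma^\sigma,\gamma^\tau)=|\sigma-\tau|\,d_t(\gamma^0,\gamma^1)$ for all $\sigma,\tau\in[0,1]$. The function $V$ is called (strongly) dynamically convex if for almost every $t\in I$ and every $d_t$-geodesic $\gamma$ the function $\tau\mapsto V_t(\gamma^\tau)$ is upper semicontinuous on $[0,1]$, (locally) absolutely continuous on $(0,1)$, and $$\limsup_{\tau\nearrow1}\frac{V_t(\gamma^1)-V_t(\gamma^\tau)}{1-\tau}-\liminf_{\tau\searrow0}\frac{V_t(\gamma^\tau)-V_t(\gamma^0)}{\tau}\;\ge\;-\frac12\,\liminf_{s\nearrow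 t}\frac{d_t^2(\gamma^0,\gamma^1)-d_s^2(\gamma^0,\gamma^1)}{t-s},$$ where $(+\infty)-(+\infty)=(-\infty)-(-\infty)=+\infty$ on the left-hand side. Then $V$ is dynamically convex if and only if for all $t\in I$ $$\mathrm{Hess}_{g_t}V_t\;\ge\;-\frac12\,\partial_t g_t$$ as quadratic forms on every tangent space of $M$, where $\mathrm{Hess}_{g_t}$ is the Riemannian Hessian of $g_t$ and $\partial_t g_t$ is the derivative in $t$ along $I$ (one-sided if $t$ is the right endpoint of $I$). -/

import Mathlib

open Set Filter Topology MeasureTheory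
open scoped Manifold ContDiff ENNReal

noncomputable section

/-! ### Strong dynamic convexity on a time-dependent metric space -/

/-- `γ`, restricted to `[0, 1]`, is a geodesic for the (extended) metric `d`: a curve of constant
speed which minimizes the length between its endpoints, these being at finite distance. -/
def IsMetricGeodesic {X : Type*} (d : X → X → ℝ≥0∞) (γ : ℝ → X) : Prop :=
  d (γ 0) (γ 1) ≠ ⊤ ∧ ∀ σ ∈ Icc (0 : ℝ) 1, ∀ τ ∈ Icc (0 : ℝ) 1,
    d (γ σ) (γ τ) = ENNReal.ofReal |σ - τ| * d (γ 0) (γ 1)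

/-- The upper left slope `∂⁺ u(1-) = limsup_{τ ↗ 1} (u(1) - u(τ)) / (1 - τ)`. -/
def upperSlopeAtOne (u : ℝ → ℝ) : EReal :=
  limsup (fun τ : ℝ => (((u 1 - u τ) / (1 - τ) : ℝ) : EReal)) (𝓝[<] (1 : ℝ))

/-- The lower right slope `∂⁻ u(0+) = liminf_{τ ↘ 0} (u(τ) - u(0)) / τ`. -/
def lowerSlopeAtZero (u : ℝ → ℝ) : EReal :=
  liminf (fun τ : ℝ => (((u τ - u 0) / τ : ℝ) : EReal)) (𝓝[>] (0 : ℝ))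

/-- The lower left time derivative of the squared distance,
`∂ₜ⁻ d²_{t-}(x, y) = liminf_{s ↗ t} (d_t²(x, y) - d_s²(x, y)) / (t - s)`. -/
def lowerLeftDerivSqDist {X : Type*} (d : ℝ → X → X → ℝ≥0∞) (t : ℝ) (x y : X) : EReal :=
  liminf (fun s : ℝ =>
    (((d t x y ^ 2 : ℝ≥0∞) : EReal) - ((d s x y ^ 2 : ℝ≥0∞) : EReal)) / ((t - s : ℝ) : EReal))
    (𝓝[<] t)

/-- Strong dynamic convexity of a real-valued function `V` on `J × X`, for a family `d` of
(extended) metrics on `X` indexed by a left-open time interval `J`: for almost every `t ∈ J` and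
every `d_t`-geodesic `γ`, the function `τ ↦ V_t(γ^τ)` is upper semicontinuous on `[0, 1]`, (locally)
absolutely continuous on `(0, 1)`, and
`∂⁺ V_t(γ^{1-}) - ∂⁻ V_t(γ^{0+}) ≥ -½ ∂ₜ⁻ d²_{t-}(γ⁰, γ¹)`.

The difference `a - b` on the left is written `-(b - a)`: in `EReal` this is `⊤` when `a = b = ⊤`
and when `a = b = ⊥`, which is the usual convention for this inequality. -/
def IsStronglyDynamicallyConvex {X : Type*} (J : Set ℝ) (d : ℝ → X → X → ℝ≥0∞)
    (V : ℝ → X → ℝ) : Prop :=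
  ∀ᵐ t ∂(volume.restrict J), ∀ γ : ℝ → X, IsMetricGeodesic (d t) γ →
    UpperSemicontinuousOn (fun τ => V t (γ τ)) (Icc 0 1) ∧
    (∀ a b : ℝ, 0 < a → a < b → b < 1 →
      AbsolutelyContinuousOnInterval (fun τ => V t (γ τ)) a b) ∧
    ((-(1 / 2) : ℝ) : EReal) * lowerLeftDerivSqDist d t (γ 0) (γ 1) ≤
      -(lowerSlopeAtZero (fun τ => V t (γ τ)) - upperSlopeAtOne (fun τ => V t (γ τ)))

/-! ### Riemannian geometry: distance and Hessian -/

section Riemannian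

variable {E : Type*} [NormedAddCommGroup E] [NormedSpace ℝ E]
  {M : Type*} [TopologicalSpace M] [ChartedSpace E M] [IsManifold 𝓘(ℝ, E) ∞ M]

open scoped Bundle in
/-- The Riemannian (extended) distance of the metric tensor `g`: the infimum of the `g`-lengths of
`C¹` paths between two points (infinite if the points lie in different components). -/
def riemDist (g : Bundle.RiemannianMetric (fun x : M => TangentSpace 𝓘(ℝ, E) x)) (x y : M) : ℝ≥0∞ :=
  letI : Bundle.RiemannianBundle (fun x : M => TangentSpace 𝓘(ℝ, E) x) := ⟨g⟩
  Manifold.riemannianEDist 𝓘(ℝ, E) x y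

/-- The metric tensor `g` read in the chart `φ` at `x`: at a point `u` of the chart domain this is
the bilinear form `(v, w) ↦ g_{φ⁻¹(u)}(D(φ⁻¹)(u) v, D(φ⁻¹)(u) w)` on `E`. -/
def metricInChart (g : Bundle.RiemannianMetric (fun x : M => TangentSpace 𝓘(ℝ, E) x)) (x : M) (u : E) :
    E →L[ℝ] E →L[ℝ] ℝ :=
  let A : E →L[ℝ] E := mfderiv 𝓘(ℝ, E) 𝓘(ℝ, E) (extChartAt 𝓘(ℝ, E) x).symm u
  let B : E →L[ℝ] E →L[ℝ] ℝ := g.inner ((extChartAt 𝓘(ℝ, E) x).symm u)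
  B.bilinearComp A A

/-- The Christoffel symbols of `g` in the chart at `x`, at the point `u` of the chart domain: with
`G = metricInChart g x`, the vector `Γ(v, w)` is the solution of
`G(Γ(v, w), z) = ½ (∂_v G(w, z) + ∂_w G(v, z) - ∂_z G(v, w))` for all `z`. -/
def christoffel (g : Bundle.RiemannianMetric (fun x : M => TangentSpace 𝓘(ℝ, E) x)) (x : M)
    (u v w : E) : E :=
  let DG : E →L[ℝ] E →L[ℝ] E →L[ℝ] ℝ := fderiv ℝ (metricInChart g x) u
  (metricInChart g x u).inverse ((1 / 2 : ℝ) • (DG v w + DG w v - (DG.flip v).flip w))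

/-- The Riemannian Hessian of `f` at `x` with respect to `g`, computed in the chart `φ` at `x`
(in which `T_xM` is identified with `E`): `∂²F(v, w) - ∂F(Γ(v, w))`, where `F = f ∘ φ⁻¹`. -/
def riemHessian (g : Bundle.RiemannianMetric (fun x : M => TangentSpace 𝓘(ℝ, E) x)) (f : M → ℝ) (x : M)
    (v w : TangentSpace 𝓘(ℝ, E) x) : ℝ :=
  let F : E → ℝ := f ∘ (extChartAt 𝓘(ℝ, E) x).symm
  let u : E := extChartAt 𝓘(ℝ, E) x x
  fderiv ℝ (fderiv ℝ F) u v w - fderiv ℝ F u (christoffel g x u v w)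

/-- `(g_t)_{t ∈ J}` is a smooth one-parameter family of Riemannian metric tensors: `g` is jointly
smooth in `(t, x) ∈ J × M`, as a map into the bundle of bilinear forms on the tangent spaces. -/
def IsSmoothMetricFamily (J : Set ℝ)
    (g : ℝ → Bundle.RiemannianMetric (fun x : M => TangentSpace 𝓘(ℝ, E) x)) : Prop :=
  ContMDiffOn (𝓘(ℝ, ℝ).prod 𝓘(ℝ, E)) (𝓘(ℝ, E).prod 𝓘(ℝ, E →L[ℝ] E →L[ℝ] ℝ)) ∞
    (fun p : ℝ × M => Bundle.TotalSpace.mk' (E →L[ℝ] E →L[ℝ] ℝ)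
      (E := fun x : M => TangentSpace 𝓘(ℝ, E) x →L[ℝ] TangentSpace 𝓘(ℝ, E) x →L[ℝ] ℝ)
      p.2 ((g p.1).inner p.2))
    (J ×ˢ univ)

end Riemannian

end

/-!
The proof avoids the exponential map and the geodesic equation. Geodesics are only known to be
minimizing curves of constant speed, and everything is read off from the comparison of energies of
Lipschitz curves in charts.

*Regularity of geodesics.* In a chart the distance is locally comparable with that of a constant
metric (`MetricNearOn.riemDist_le`, `MetricNearOn.le_riemDist`). Hence metric geodesics are Lipschitz
in charts with squared speed at most the squared distance `D²` of their endpoints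
(`IsMetricGeodesic.speedSq_le`), while the squared distance of the endpoints of any Lipschitz curve
is at most its energy (`IsChartLipschitzOn.sq_riemDist_le`). In particular geodesics minimize the
energy.

*The Hessian along geodesics.* Vary a geodesic in a chart by a multiple of the gradient of `f`,
cut off by the hat function `η - |τ - m|`. Minimality of the energy identifies the second difference
`f(γ(m + η)) + f(γ(m - η)) - 2 f(γ(m))` with the integral of `(η - |τ - m|) Hess f(γ', γ')`
(`secondDifference_eq_of_minimizing`, `IsMetricGeodesic.secondDifference_eq`). A maximum principle
turns bounds on second differences into bounds on the difference of the slopes at the two endpoints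
(`exists_slope_bounds`).

*The Hessian bound implies dynamic convexity.* Along a `d_t`-geodesic, the difference of slopes is
at least `-½ ∫ ∂ₜg(γ', γ')` by the preceding paragraph. Using the same curve as a competitor for
`d_s` with `s < t` gives `d_t² - d_s² ≥ ∫ (g_t - g_s)(γ', γ')`, so that the time derivative of `d²` is
at least `∫ ∂ₜg(γ', γ')` (`IsMetricGeodesic.le_lowerLeftDerivSqDist`).

*Dynamic convexity implies the Hessian bound.* Close points `x` and `φ⁻¹(φ(x) + z)` are joined by
geodesics, obtained by a compactness argument (`MetricNearOn.exists_isMetricGeodesic`). Comparing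
energies with the constant metric at `φ(x)` shows that the velocity of such a geodesic is close to `z`
in mean square, uniformly for `g_s` with `s` near `t` (`MetricNearOn.abs_integral_form_sub_le`). So the
difference of slopes is at most `Hess V_t(z, z) + o(|z|²)`. The time derivative of `d²` is at most
`∂ₜg(z, z) + o(|z|²)`, with `d_s`-geodesics as competitors for `d_t`
(`IsSmoothMetricFamily.lowerLeftDerivSqDist_le`). Letting `z = ηv` with `η → 0` gives the bound at
almost every `t`, and at all `t` by continuity.
-/

noncomputable section

/-! ### Functions whose second differences are controlled -/

/-- The strict maximum principle: a continuous function whose small symmetric second differences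
are positive at every interior point lies below its chord. -/
theorem le_chord_of_secondDifference_pos {z : ℝ → ℝ} (hz : ContinuousOn z (Icc 0 1))
    (h : ∀ m ∈ Ioo (0 : ℝ) 1, ∀ᶠ η in 𝓝[>] (0 : ℝ), 0 < z (m + η) + z (m - η) - 2 * z m)
    {τ : ℝ} (hτ : τ ∈ Icc (0 : ℝ) 1) : z τ ≤ (1 - τ) * z 0 + τ * z 1 := by
  set y : ℝ → ℝ := fun τ => z τ - ((1 - τ) * z 0 + τ * z 1) with hy
  have hyc : ContinuousOn y (Icc 0 1) := by
    apply hz.sub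
    fun_prop
  obtain ⟨m, hm, hmax⟩ := isCompact_Icc.exists_isMaxOn ⟨τ, hτ⟩ hyc
  by_contra! hlt
  have hτpos : 0 < y τ := by simp only [hy]; linarith
  have hmpos : 0 < y m := hτpos.trans_le (hmax hτ)
  have hm0 : m ≠ 0 := by rintro rfl; simp [hy] at hmpos
  have hm1 : m ≠ 1 := by rintro rfl; simp [hy] at hmpos
  have hmI : m ∈ Ioo (0 : ℝ) 1 := ⟨lt_of_le_of_ne hm.1 hm0.symm, lt_of_le_of_ne hm.2 hm1⟩
  have h1 : ∀ᶠ η in 𝓝[>] (0 : ℝ), η < min m (1 - m) :=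
    nhdsWithin_le_nhds (Iio_mem_nhds (lt_min hmI.1 (by linarith [hmI.2])))
  obtain ⟨η, ⟨hη, hη1⟩, hη0⟩ := ((h m hmI).and h1).and self_mem_nhdsWithin |>.exists
  have hη0 : 0 < η := hη0
  have ha := hmax (show m + η ∈ Icc (0 : ℝ) 1 from
    ⟨by linarith [hmI.1], by linarith [min_le_right m (1 - m)]⟩)
  have hb := hmax (show m - η ∈ Icc (0 : ℝ) 1 from
    ⟨by linarith [min_le_left m (1 - m)], by linarith [hmI.2]⟩)
  simp only [hy, mem_ofPred_eq] at ha hb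
  nlinarith

/-- Integrating an integrable function against the hat function of radius `η` around `m` yields the
second difference of its second primitive. -/
theorem integral_hat_mul {k : ℝ → ℝ} (hk : Integrable k) (m : ℝ) {η : ℝ} (hη : 0 < η) :
    ∫ τ in (m - η)..(m + η), (η - |τ - m|) * k τ =
      (∫ τ in (0 : ℝ)..(m + η), ∫ σ in (0 : ℝ)..τ, k σ) +
        (∫ τ in (0 : ℝ)..(m - η), ∫ σ in (0 : ℝ)..τ, k σ) -
        2 * ∫ τ in (0 : ℝ)..m, ∫ σ in (0 : ℝ)..τ, k σ := by
  set κ : ℝ → ℝ := fun τ => ∫ σ in (0 : ℝ)..τ, k σ with hκ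
  have hkI : ∀ a b, IntervalIntegrable k volume a b := fun a b => hk.intervalIntegrable
  have hκc : Continuous κ := intervalIntegral.continuous_primitive hkI 0
  have hκI : ∀ a b, IntervalIntegrable κ volume a b := fun a b => hκc.intervalIntegrable a b
  -- integration by parts of `k` against an affine function on one side
  have parts : ∀ a b α β : ℝ, ∫ τ in a..b, (α + β * τ) * k τ =
      (α + β * b) * κ b - (α + β * a) * κ a - β * ∫ τ in a..b, κ τ := by
    intro a b α β
    have hac : AbsolutelyContinuousOnInterval κ a b := by
      refine ((hkI (min a b ⊓ 0) (max a b ⊔ 0)).absolutelyContinuousOnInterval_intervalIntegral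
        (c := 0) ?_).mono ?_
      · rw [uIcc_of_le (by simp)]; constructor <;> simp
      · rw [uIcc_of_le (show min a b ⊓ 0 ≤ max a b ⊔ 0 by simp)]
        intro x hx
        rw [uIcc, mem_Icc] at hx
        exact ⟨inf_le_left.trans hx.1, hx.2.trans le_sup_left⟩
    have hlin : AbsolutelyContinuousOnInterval (fun τ => α + β * τ) a b := by
      apply ContDiffOn.absolutelyContinuousOnInterval
      fun_prop
    have hd : ∀ᵐ x, HasDerivAt κ (k x) x := by
      have := LocallyIntegrable.ae_hasDerivAt_integral (hk.locallyIntegrable)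
      filter_upwards [this] with x hx using hx 0
    have h := hlin.integral_mul_deriv_eq_deriv_mul hac
    have e1 : ∫ τ in a..b, (α + β * τ) * deriv κ τ = ∫ τ in a..b, (α + β * τ) * k τ := by
      apply intervalIntegral.integral_congr_ae
      filter_upwards [hd] with x hx _
      rw [hx.deriv]
    have e2 : ∫ τ in a..b, deriv (fun τ => α + β * τ) τ * κ τ = β * ∫ τ in a..b, κ τ := by
      rw [← intervalIntegral.integral_const_mul]
      congr 1
      ext τ
      have : HasDerivAt (fun τ : ℝ => α + β * τ) β τ := by
        simpa using ((hasDerivAt_id τ).const_mul β).const_add α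
      rw [this.deriv]
    rw [← e1, h, e2]
  have hatI : ∀ a b, IntervalIntegrable (fun τ => (η - |τ - m|) * k τ) volume a b := fun a b =>
    (hkI a b).continuousOn_mul (by fun_prop)
  rw [← intervalIntegral.integral_add_adjacent_intervals (hatI (m - η) m) (hatI m (m + η))]
  have e1 : ∫ τ in (m - η)..m, (η - |τ - m|) * k τ =
      ∫ τ in (m - η)..m, ((η - m) + 1 * τ) * k τ := by
    apply intervalIntegral.integral_congr
    intro τ hτ
    rw [uIcc_of_le (by linarith)] at hτ
    simp only
    rw [abs_of_nonpos (by linarith [hτ.2])]; ring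
  have e2 : ∫ τ in m..(m + η), (η - |τ - m|) * k τ =
      ∫ τ in m..(m + η), ((η + m) + (-1) * τ) * k τ := by
    apply intervalIntegral.integral_congr
    intro τ hτ
    rw [uIcc_of_le (by linarith)] at hτ
    simp only
    rw [abs_of_nonneg (by linarith [hτ.1])]; ring
  rw [e1, e2, parts, parts]
  have s1 := intervalIntegral.integral_add_adjacent_intervals (hκI 0 (m - η)) (hκI (m - η) m)
  have s2 := intervalIntegral.integral_add_adjacent_intervals (hκI 0 m) (hκI m (m + η))
  simp only [hκ] at s1 s2 ⊢
  linarith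

/-- If the second differences of `u` dominate those of a second primitive of `k`, up to an error
`o(η²)` at every interior point, then the slopes of `u` at `0` and `1` are controlled by numbers `p`
and `q` whose difference is `∫ k`. -/
theorem exists_slope_bounds {u k : ℝ → ℝ} (hu : ContinuousOn u (Icc 0 1))
    (hk : IntervalIntegrable k volume 0 1)
    (h : ∀ m ∈ Ioo (0 : ℝ) 1, ∀ ε > 0, ∀ᶠ η in 𝓝[>] (0 : ℝ),
      (∫ τ in (m - η)..(m + η), (η - |τ - m|) * k τ) - ε * η ^ 2 ≤
        u (m + η) + u (m - η) - 2 * u m) :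
    ∃ p q : ℝ, q - p = ∫ τ in (0 : ℝ)..1, k τ ∧ ∃ a b : ℝ → ℝ,
      Tendsto a (𝓝[>] 0) (𝓝 p) ∧ Tendsto b (𝓝[<] 1) (𝓝 q) ∧
      ∀ τ ∈ Ioo (0 : ℝ) 1, (u τ - u 0) / τ ≤ a τ ∧ b τ ≤ (u 1 - u τ) / (1 - τ) := by
  set k' : ℝ → ℝ := indicator (Ioc 0 1) k with hk'
  have hk'i : Integrable k' := by
    rw [hk', integrable_indicator_iff measurableSet_Ioc]
    rwa [intervalIntegrable_iff_integrableOn_Ioc_of_le zero_le_one] at hk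
  set κ : ℝ → ℝ := fun τ => ∫ σ in (0 : ℝ)..τ, k' σ with hκ
  have hkI : ∀ a b, IntervalIntegrable k' volume a b := fun a b => hk'i.intervalIntegrable
  have hκc : Continuous κ := intervalIntegral.continuous_primitive hkI 0
  set K : ℝ → ℝ := fun τ => ∫ σ in (0 : ℝ)..τ, κ σ with hK
  have hKd : ∀ τ, HasDerivAt K (κ τ) τ := fun τ => hκc.integral_hasStrictDerivAt 0 τ |>.hasDerivAt
  have hKc : Continuous K := continuous_iff_continuousAt.2 fun τ => (hKd τ).continuousAt
  have hκ1 : κ 1 = ∫ τ in (0 : ℝ)..1, k τ := by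
    apply intervalIntegral.integral_congr_ae
    filter_upwards with τ hτ
    rw [uIoc_of_le zero_le_one] at hτ
    simp [hk', hτ]
  have hK0 : K 0 = 0 := by simp [hK]
  have hκ0 : κ 0 = 0 := by simp [hκ]
  -- the function `u - K` lies below its chord
  have chord : ∀ τ ∈ Icc (0 : ℝ) 1, u τ - K τ ≤ (1 - τ) * u 0 + τ * (u 1 - K 1) := by
    intro τ hτ
    have key : ∀ ε > 0, u τ - K τ + ε * τ ^ 2 ≤ (1 - τ) * u 0 + τ * (u 1 - K 1 + ε) := by
      intro ε hε
      have := le_chord_of_secondDifference_pos (z := fun τ => u τ - K τ + ε * τ ^ 2)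
        ((hu.sub hKc.continuousOn).add (by fun_prop)) ?_ hτ
      · simpa [hK0] using this
      intro m hm
      have h1 : ∀ᶠ η in 𝓝[>] (0 : ℝ), η < min m (1 - m) :=
        nhdsWithin_le_nhds (Iio_mem_nhds (lt_min hm.1 (by linarith [hm.2])))
      filter_upwards [h m hm ε hε, h1, self_mem_nhdsWithin] with η hη hη1 hη0
      have hη0 : 0 < η := hη0
      have e : ∫ τ in (m - η)..(m + η), (η - |τ - m|) * k τ =
          ∫ τ in (m - η)..(m + η), (η - |τ - m|) * k' τ := by
        apply intervalIntegral.integral_congr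
        intro τ hτ
        rw [uIcc_of_le (by linarith)] at hτ
        have : τ ∈ Ioc (0 : ℝ) 1 :=
          ⟨by linarith [hτ.1, min_le_left m (1 - m)], by linarith [hτ.2, min_le_right m (1 - m)]⟩
        simp [hk', this]
      rw [e, integral_hat_mul hk'i m hη0] at hη
      have : 0 < ε * η ^ 2 := by positivity
      simp only [hK, hκ] at hη ⊢
      nlinarith
    have hlim : Tendsto (fun ε : ℝ => u τ - K τ + ε * τ ^ 2) (𝓝[>] 0) (𝓝 (u τ - K τ + 0 * τ ^ 2)) :=
      Tendsto.mono_left (Continuous.tendsto (by fun_prop) 0) nhdsWithin_le_nhds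
    have hlim2 : Tendsto (fun ε : ℝ => (1 - τ) * u 0 + τ * (u 1 - K 1 + ε)) (𝓝[>] 0)
        (𝓝 ((1 - τ) * u 0 + τ * (u 1 - K 1 + 0))) :=
      Tendsto.mono_left (Continuous.tendsto (by fun_prop) 0) nhdsWithin_le_nhds
    have := le_of_tendsto_of_tendsto hlim hlim2
      (eventually_nhdsWithin_of_forall fun ε hε => key ε hε)
    simpa using this
  set c := u 1 - K 1 - u 0 with hc
  refine ⟨c, c + κ 1, by rw [hκ1]; ring, fun τ => c + τ⁻¹ * (K τ - K 0),
    fun τ => c + (K τ - K 1) / (τ - 1), ?_, ?_, ?_⟩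
  · have := (hasDerivAt_iff_tendsto_slope.1 (hKd 0)).mono_left
      (nhdsWithin_mono (0 : ℝ) (s := Ioi 0) (fun x hx => ne_of_gt hx))
    rw [hκ0] at this
    simpa [slope_fun_def] using this.const_add c
  · have := (hasDerivAt_iff_tendsto_slope.1 (hKd 1)).mono_left
      (nhdsWithin_mono (1 : ℝ) (s := Iio 1) (fun x hx => ne_of_lt hx))
    simpa [slope_fun_def, div_eq_inv_mul] using this.const_add c
  · intro τ hτ
    have hch := chord τ ⟨hτ.1.le, hτ.2.le⟩
    have h0 := hτ.1
    have h1 : 0 < 1 - τ := by linarith [hτ.2]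
    constructor
    · rw [div_le_iff₀ h0, hK0]
      have : (c + τ⁻¹ * (K τ - 0)) * τ = c * τ + K τ := by field_simp; ring
      rw [this, hc]; linarith
    · rw [le_div_iff₀ h1]
      have : (c + (K τ - K 1) / (τ - 1)) * (1 - τ) = c * (1 - τ) + (K 1 - K τ) := by
        have : τ - 1 ≠ 0 := by linarith
        field_simp; ring
      rw [this, hc]; nlinarith

section Chart

set_option maxSynthPendingDepth 3

variable {E : Type*} [NormedAddCommGroup E] [NormedSpace ℝ E]

/-! ### Lipschitz curves in a normed space -/

theorem LocallyLipschitzOn.contDiffOn_comp {X F : Type*} [PseudoEMetricSpace X]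
    [NormedAddCommGroup F] [NormedSpace ℝ F] {c : X → E} {s : Set X} {Ω : Set E} {Φ : E → F}
    (hc : LocallyLipschitzOn s c) (hΩ : IsOpen Ω) (hΦ : ContDiffOn ℝ 1 Φ Ω) (hm : MapsTo c s Ω) :
    LocallyLipschitzOn s (Φ ∘ c) := by
  intro x hx
  obtain ⟨K, U, hU, hcU⟩ := hc hx
  obtain ⟨K', U', hU', hΦU⟩ :=
    (hΦ.contDiffAt (hΩ.mem_nhds (hm hx))).exists_lipschitzOnWith
  refine ⟨K' * K, U ∩ c ⁻¹' U', inter_mem hU (hc.continuousOn x hx hU'), ?_⟩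
  exact hΦU.comp (hcU.mono inter_subset_left) (fun y hy => hy.2)

variable [FiniteDimensional ℝ E]

theorem LipschitzOnWith.ae_hasDerivAt {c : ℝ → E} {K : NNReal} {a b : ℝ}
    (hc : LipschitzOnWith K c (Icc a b)) :
    ∀ᵐ τ, τ ∈ Ioo a b → HasDerivAt c (deriv c τ) τ := by
  filter_upwards [hc.ae_differentiableWithinAt_of_mem_real] with τ hτ hm
  exact ((hτ (Ioo_subset_Icc_self hm)).differentiableAt (Icc_mem_nhds hm.1 hm.2)).hasDerivAt

omit [FiniteDimensional ℝ E] in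
theorem ae_Ioo_of_mem_uIoc {a b : ℝ} (hab : a ≤ b) :
    ∀ᵐ τ : ℝ, τ ∈ uIoc a b → τ ∈ Ioo a b := by
  have : ∀ᵐ τ : ℝ, τ ≠ b := by simp [ae_iff, measure_singleton]
  filter_upwards [this] with τ hτ hm
  rw [uIoc_of_le hab] at hm
  exact ⟨hm.1, lt_of_le_of_ne hm.2 hτ⟩

/-- A quadratic expression with continuous coefficients in the velocity of a Lipschitz curve is
integrable. -/
theorem LipschitzOnWith.intervalIntegrable_quadratic {c : ℝ → E} {K : NNReal} {a b : ℝ}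
    (hab : a ≤ b) (hc : LipschitzOnWith K c (Icc a b)) {A : ℝ → E →L[ℝ] E →L[ℝ] ℝ}
    (hA : ContinuousOn A (Icc a b)) :
    IntervalIntegrable (fun τ => A τ (deriv c τ) (deriv c τ)) volume a b := by
  have := FiniteDimensional.complete ℝ E
  obtain ⟨C, hC⟩ := isCompact_Icc.exists_bound_of_continuousOn (E := E →L[ℝ] E →L[ℝ] ℝ) hA
  have hAm : AEStronglyMeasurable A (volume.restrict (Ioc a b)) :=
    (hA.mono Ioc_subset_Icc_self).aestronglyMeasurable measurableSet_Ioc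
  have hd : AEStronglyMeasurable (deriv c) (volume.restrict (Ioc a b)) :=
    (stronglyMeasurable_deriv c).aestronglyMeasurable
  rw [intervalIntegrable_iff_integrableOn_Ioc_of_le hab]
  refine IntegrableOn.of_bound (by simp) ?_ (C * K * K) ?_
  · have h1 : AEStronglyMeasurable (fun τ => A τ (deriv c τ)) (volume.restrict (Ioc a b)) :=
      (isBoundedBilinearMap_apply (𝕜 := ℝ) (E := E) (F := E →L[ℝ] ℝ)).continuous
        |>.comp_aestronglyMeasurable (hAm.prodMk hd)
    exact (isBoundedBilinearMap_apply (𝕜 := ℝ) (E := E) (F := ℝ)).continuous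
        |>.comp_aestronglyMeasurable (h1.prodMk hd)
  · rw [ae_restrict_iff' measurableSet_Ioc]
    filter_upwards [ae_Ioo_of_mem_uIoc hab] with τ hτ hm
    have hm' := hτ (by rwa [uIoc_of_le hab])
    have h1 : ‖deriv c τ‖ ≤ K := norm_deriv_le_of_lipschitzOn (Icc_mem_nhds hm'.1 hm'.2) hc
    have h2 := hC τ (Ioo_subset_Icc_self hm')
    have hC0 : 0 ≤ C := (norm_nonneg _).trans h2
    refine (ContinuousLinearMap.le_opNorm₂ _ _ _).trans ?_
    gcongr

/-- The fundamental theorem of calculus along a Lipschitz curve. -/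
theorem LipschitzOnWith.integral_fderiv_comp {c : ℝ → E} {K : NNReal} {a b : ℝ} (hab : a ≤ b)
    (hc : LipschitzOnWith K c (Icc a b)) {Ω : Set E} (hΩ : IsOpen Ω) (hm : MapsTo c (Icc a b) Ω)
    {F : E → ℝ} (hF : ContDiffOn ℝ 1 F Ω) :
    IntervalIntegrable (fun τ => fderiv ℝ F (c τ) (deriv c τ)) volume a b ∧
    ∫ τ in a..b, fderiv ℝ F (c τ) (deriv c τ) = F (c b) - F (c a) := by
  have hl : LocallyLipschitzOn (Icc a b) (F ∘ c) :=
    LocallyLipschitzOn.contDiffOn_comp (fun x _ => ⟨K, Icc a b, self_mem_nhdsWithin, hc⟩) hΩ hF hm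
  obtain ⟨K', hK'⟩ := LocallyLipschitzOn.exists_lipschitzOnWith_of_compact isCompact_Icc hl
  have hac : AbsolutelyContinuousOnInterval (F ∘ c) a b := by
    apply LipschitzOnWith.absolutelyContinuousOnInterval (K := K')
    rwa [uIcc_of_le hab]
  have hd : ∀ᵐ τ, τ ∈ uIoc a b → deriv (F ∘ c) τ = fderiv ℝ F (c τ) (deriv c τ) := by
    filter_upwards [hc.ae_hasDerivAt, ae_Ioo_of_mem_uIoc hab] with τ h1 h2 h3
    have hτ := h2 h3
    have hFd : DifferentiableAt ℝ F (c τ) :=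
      (hF.contDiffAt (hΩ.mem_nhds (hm (Ioo_subset_Icc_self hτ)))).differentiableAt one_ne_zero
    exact (hFd.hasFDerivAt.comp_hasDerivAt τ (h1 hτ)).deriv
  constructor
  · exact hac.intervalIntegrable_deriv.congr_ae ((ae_restrict_iff' measurableSet_uIoc).2 hd)
  · rw [← intervalIntegral.integral_congr_ae hd, hac.integral_deriv_eq_sub]; rfl

/-! ### The first variation of the energy along a gradient field -/

/-- The Hessian of `F` for the metric `G` in a chart, as a (not necessarily symmetric) bilinear form
inducing the right quadratic form. Here `W` stands for the gradient of `F` with respect to `G`, which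
makes it possible to avoid inverting `G`. -/
def chartHessian (G : E → E →L[ℝ] E →L[ℝ] ℝ) (W : E → E) (F : E → ℝ) (u : E) : E →L[ℝ] E →L[ℝ] ℝ :=
  fderiv ℝ (fderiv ℝ F) u - ((fderiv ℝ G u).flip (W u) - (1 / 2 : ℝ) • fderiv ℝ G u (W u))

omit [FiniteDimensional ℝ E] in
theorem continuousOn_chartHessian {Ω : Set E} (hΩ : IsOpen Ω) {G : E → E →L[ℝ] E →L[ℝ] ℝ}
    (hG : ContDiffOn ℝ 1 G Ω) {W : E → E} (hW : ContinuousOn W Ω) {F : E → ℝ}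
    (hF : ContDiffOn ℝ 2 F Ω) : ContinuousOn (chartHessian G W F) Ω := by
  have hDG : ContinuousOn (fderiv ℝ G) Ω := hG.continuousOn_fderiv_of_isOpen hΩ le_rfl
  have hDF2 : ContinuousOn (fderiv ℝ (fderiv ℝ F)) Ω :=
    (hF.fderiv_of_isOpen (m := 1) hΩ (by norm_num)).continuousOn_fderiv_of_isOpen hΩ le_rfl
  have h3 : ContinuousOn (fun u => (fderiv ℝ G u).flip) Ω :=
    (ContinuousLinearMap.flipₗᵢ ℝ E E (E →L[ℝ] ℝ)).continuous.comp_continuousOn hDG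
  exact hDF2.sub ((h3.clm_apply hW).sub ((hDG.clm_apply hW).const_smul (1 / 2 : ℝ)))

omit [FiniteDimensional ℝ E] in
/-- Differentiating `G(W, z) = dF(z)` expresses the derivative of the energy density
`G(v, v)` along the gradient field `W` through the Hessian. -/
theorem chartHessian_eq {Ω : Set E} (hΩ : IsOpen Ω) {G : E → E →L[ℝ] E →L[ℝ] ℝ}
    (hG : ContDiffOn ℝ 1 G Ω) {W : E → E} (hW : ContDiffOn ℝ 1 W Ω) {F : E → ℝ}
    (hWF : ∀ u ∈ Ω, ∀ z, G u (W u) z = fderiv ℝ F u z) (hF : ContDiffOn ℝ 2 F Ω)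
    {u : E} (hu : u ∈ Ω) (v : E) :
    fderiv ℝ G u (W u) v v + 2 * G u (fderiv ℝ W u v) v = 2 * chartHessian G W F u v v := by
  have hGd : DifferentiableAt ℝ G u :=
    (hG.contDiffAt (hΩ.mem_nhds hu)).differentiableAt one_ne_zero
  have hWd : DifferentiableAt ℝ W u :=
    (hW.contDiffAt (hΩ.mem_nhds hu)).differentiableAt one_ne_zero
  have hFd : DifferentiableAt ℝ (fderiv ℝ F) u :=
    ((hF.contDiffAt (hΩ.mem_nhds hu)).fderiv_right (m := 1) (by norm_num)).differentiableAt
      one_ne_zero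
  have h1 : HasFDerivAt (fun y => G y (W y)) _ u := hGd.hasFDerivAt.clm_apply hWd.hasFDerivAt
  have h2 : (fun y => G y (W y)) =ᶠ[𝓝 u] fderiv ℝ F := by
    filter_upwards [hΩ.mem_nhds hu] with y hy
    ext z
    exact hWF y hy z
  have h3 := h1.unique (hFd.hasFDerivAt.congr_of_eventuallyEq h2)
  have h4 := congr($h3 v v)
  simp at h4
  simp only [chartHessian, _root_.sub_apply, ContinuousLinearMap.flip_apply, _root_.smul_apply,
    smul_eq_mul]
  rw [← h4]
  ring

end Chart

section Chart

set_option maxSynthPendingDepth 3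

variable {E : Type*} [NormedAddCommGroup E] [NormedSpace ℝ E] [FiniteDimensional ℝ E]

set_option maxHeartbeats 1600000 in
/-- First variation formula for a curve `c` that minimizes the energy of the metric `G` among
Lipschitz curves with the same endpoints: testing with the variation `hat · W`, where `W` is the
gradient of `F`, computes the second differences of `F ∘ c`. -/
theorem secondDifference_eq_of_minimizing {Ω : Set E} (hΩ : IsOpen Ω) {G : E → E →L[ℝ] E →L[ℝ] ℝ}
    (hG : ContDiffOn ℝ 1 G Ω) (hsymm : ∀ u ∈ Ω, ∀ v w, G u v w = G u w v) {W : E → E}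
    (hW : ContDiffOn ℝ 1 W Ω) {F : E → ℝ}
    (hWF : ∀ u ∈ Ω, ∀ z, G u (W u) z = fderiv ℝ F u z) (hF : ContDiffOn ℝ 2 F Ω)
    {c : ℝ → E} {m η : ℝ} (hη : 0 < η) {K : NNReal}
    (hc : LipschitzOnWith K c (Icc (m - η) (m + η))) (hcΩ : MapsTo c (Icc (m - η) (m + η)) Ω)
    (hmin : ∀ (c' : ℝ → E) (K' : NNReal), LipschitzOnWith K' c' (Icc (m - η) (m + η)) →
      MapsTo c' (Icc (m - η) (m + η)) Ω → c' (m - η) = c (m - η) → c' (m + η) = c (m + η) →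
      ∫ τ in (m - η)..(m + η), G (c τ) (deriv c τ) (deriv c τ) ≤
        ∫ τ in (m - η)..(m + η), G (c' τ) (deriv c' τ) (deriv c' τ)) :
    F (c (m + η)) + F (c (m - η)) - 2 * F (c m) =
      ∫ τ in (m - η)..(m + η), (η - |τ - m|) * chartHessian G W F (c τ) (deriv c τ) (deriv c τ) := by
  have := FiniteDimensional.proper ℝ E
  have := FiniteDimensional.complete ℝ E
  set a := m - η with ha
  set b := m + η with hb
  have hab : a ≤ b := by linarith
  have ham : a ≤ m := by linarith
  have hmb : m ≤ b := by linarith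
  have hcc : ContinuousOn c (Icc a b) := hc.continuousOn
  set f : ℝ → ℝ := fun τ => η - |τ - m| with hf
  set s : ℝ → ℝ := fun τ => if τ < m then 1 else -1 with hs
  have hfd : ∀ τ, τ ≠ m → HasDerivAt f (s τ) τ := by
    intro τ hτ
    rcases lt_or_gt_of_ne hτ with h | h
    · have : HasDerivAt (fun τ => η - (m - τ)) 1 τ := by
        simpa using ((hasDerivAt_id τ).const_sub m).const_sub η
      simp only [hs, h, if_true]
      refine this.congr_of_eventuallyEq ?_
      filter_upwards [Iio_mem_nhds h] with y hy
      simp only [hf]; rw [abs_of_neg (by linarith [mem_Iio.1 hy])]; ring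
    · have : HasDerivAt (fun τ => η - (τ - m)) (-1) τ := by
        simpa using ((hasDerivAt_id τ).sub_const m).const_sub η
      simp only [hs, not_lt.2 h.le, if_false]
      refine this.congr_of_eventuallyEq ?_
      filter_upwards [Ioi_mem_nhds h] with y hy
      simp only [hf]; rw [abs_of_pos (by linarith [mem_Ioi.1 hy])]
  have hfη : ∀ τ ∈ Icc a b, |f τ| ≤ η := by
    intro τ hτ
    have : |τ - m| ≤ η := abs_le.2 ⟨by linarith [hτ.1], by linarith [hτ.2]⟩
    rw [abs_of_nonneg (by simp only [hf]; linarith)]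
    simp only [hf]; linarith [abs_nonneg (τ - m)]
  have hs1 : ∀ τ, |s τ| ≤ 1 := by intro τ; simp only [hs]; split_ifs <;> simp
  -- a compact neighbourhood of the curve on which everything is bounded
  have hcomp : IsCompact (c '' Icc a b) := isCompact_Icc.image_of_continuousOn hcc
  obtain ⟨δ, hδ, hδΩ⟩ := hcomp.exists_cthickening_subset_open hΩ hcΩ.image_subset
  set Q := Metric.cthickening δ (c '' Icc a b) with hQ
  have hQc : IsCompact Q := hcomp.cthickening
  have hDG : ContinuousOn (fderiv ℝ G) Ω := hG.continuousOn_fderiv_of_isOpen hΩ le_rfl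
  have hDW : ContinuousOn (fderiv ℝ W) Ω := hW.continuousOn_fderiv_of_isOpen hΩ le_rfl
  obtain ⟨C₁, hC₁⟩ := hQc.exists_bound_of_continuousOn (E := E →L[ℝ] E →L[ℝ] ℝ)
    (hG.continuousOn.mono hδΩ)
  obtain ⟨C₂, hC₂⟩ := hQc.exists_bound_of_continuousOn (E := E →L[ℝ] E →L[ℝ] E →L[ℝ] ℝ)
    (hDG.mono hδΩ)
  obtain ⟨C₃, hC₃⟩ := hQc.exists_bound_of_continuousOn (hW.continuousOn.mono hδΩ)
  obtain ⟨C₄, hC₄⟩ := hQc.exists_bound_of_continuousOn (E := E →L[ℝ] E) (hDW.mono hδΩ)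
  have hcQ : ∀ τ ∈ Icc a b, c τ ∈ Q := fun τ hτ =>
    Metric.self_subset_cthickening _ (mem_image_of_mem _ hτ)
  have hmI : m ∈ Icc a b := ⟨ham, hmb⟩
  have hC₁0 : 0 ≤ C₁ := (norm_nonneg _).trans (hC₁ _ (hcQ m hmI))
  have hC₂0 : 0 ≤ C₂ := (norm_nonneg _).trans (hC₂ _ (hcQ m hmI))
  have hC₃0 : 0 ≤ C₃ := (norm_nonneg _).trans (hC₃ _ (hcQ m hmI))
  have hC₄0 : 0 ≤ C₄ := (norm_nonneg _).trans (hC₄ _ (hcQ m hmI))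
  set ε₀ := min 1 (δ / (η * C₃ + 1)) with hε₀
  have hε₀pos : 0 < ε₀ := by positivity
  set e : ℝ → ℝ → E := fun ε τ => c τ + ε • f τ • W (c τ) with he
  have heQ : ∀ ε, |ε| < ε₀ → ∀ τ ∈ Icc a b, e ε τ ∈ Q := by
    intro ε hε τ hτ
    refine Metric.mem_cthickening_of_dist_le _ (c τ) _ _ (mem_image_of_mem _ hτ) ?_
    rw [dist_eq_norm]
    simp only [he, add_sub_cancel_left, norm_smul, Real.norm_eq_abs]
    calc |ε| * (|f τ| * ‖W (c τ)‖) ≤ (δ / (η * C₃ + 1)) * (η * C₃) := by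
          gcongr
          · exact hε.le.trans (min_le_right _ _)
          · exact hfη τ hτ
          · exact hC₃ _ (hcQ τ hτ)
      _ ≤ δ := by
          rw [div_mul_eq_mul_div, div_le_iff₀ (by positivity)]
          nlinarith [mul_nonneg hη.le hC₃0]
  set ζ : ℝ → E := fun τ => s τ • W (c τ) + f τ • fderiv ℝ W (c τ) (deriv c τ) with hζ
  -- the varied curve is Lipschitz, with the expected derivative
  have hed : ∀ᵐ τ, τ ∈ uIoc a b → ∀ ε, HasDerivAt (e ε) (deriv c τ + ε • ζ τ) τ := by
    have hne : ∀ᵐ τ : ℝ, τ ≠ m := by simp [ae_iff, measure_singleton]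
    filter_upwards [hc.ae_hasDerivAt, ae_Ioo_of_mem_uIoc hab, hne] with τ h1 h2 h3 h4 ε
    have hτ := h2 h4
    have hWd : HasFDerivAt W (fderiv ℝ W (c τ)) (c τ) :=
      ((hW.contDiffAt (hΩ.mem_nhds (hcΩ (Ioo_subset_Icc_self hτ)))).differentiableAt
        one_ne_zero).hasFDerivAt
    have := (h1 hτ).add ((((hfd τ h3).smul (hWd.comp_hasDerivAt τ (h1 hτ)))).const_smul ε)
    simp only [hζ]
    convert! this using 1
    rw [add_comm (s τ • _)]; rfl
  have heL : ∀ ε, ∃ K', LipschitzOnWith K' (e ε) (Icc a b) := by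
    intro ε
    apply LocallyLipschitzOn.exists_lipschitzOnWith_of_compact isCompact_Icc
    have h1 : LocallyLipschitzOn (Icc a b) (fun τ => (f τ, c τ)) := by
      intro τ hτ
      refine ⟨max 1 K, Icc a b, self_mem_nhdsWithin, ?_⟩
      refine LipschitzOnWith.prodMk (LipschitzWith.lipschitzOnWith ?_) hc
      apply LipschitzWith.of_dist_le_mul
      intro x y
      simp only [hf, Real.dist_eq, NNReal.coe_one, one_mul]
      rw [show η - |x - m| - (η - |y - m|) = |y - m| - |x - m| by ring]
      refine (abs_abs_sub_abs_le_abs_sub _ _).trans_eq ?_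
      rw [abs_sub_comm]; congr 1; ring
    refine LocallyLipschitzOn.contDiffOn_comp h1 (isOpen_univ.prod hΩ)
      (Φ := fun p : ℝ × E => p.2 + ε • p.1 • W p.2) ?_ (fun τ hτ => ⟨mem_univ _, hcΩ hτ⟩)
    have hW2 : ContDiffOn ℝ 1 (fun p : ℝ × E => W p.2) (univ ×ˢ Ω) :=
      hW.comp contDiffOn_snd (fun p hp => hp.2)
    exact contDiffOn_snd.add (contDiffOn_const.smul (contDiffOn_fst.smul hW2))
  set P : ℝ → ℝ → ℝ := fun ε τ => G (e ε τ) (deriv c τ + ε • ζ τ) (deriv c τ + ε • ζ τ) with hP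
  set P' : ℝ → ℝ → ℝ := fun ε τ =>
    fderiv ℝ G (e ε τ) (f τ • W (c τ)) (deriv c τ + ε • ζ τ) (deriv c τ + ε • ζ τ) +
      G (e ε τ) (ζ τ) (deriv c τ + ε • ζ τ) + G (e ε τ) (deriv c τ + ε • ζ τ) (ζ τ) with hP'
  have hPe : ∀ ε, ∀ᵐ τ, τ ∈ uIoc a b → G (e ε τ) (deriv (e ε) τ) (deriv (e ε) τ) = P ε τ := by
    intro ε
    filter_upwards [hed] with τ h1 h2
    simp only [hP, (h1 h2 ε).deriv]
  have hPint : ∀ ε, |ε| < ε₀ → IntervalIntegrable (P ε) volume a b := by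
    intro ε hε
    obtain ⟨K', hK'⟩ := heL ε
    have hcont : ContinuousOn (fun τ => G (e ε τ)) (Icc a b) :=
      hG.continuousOn.comp hK'.continuousOn fun τ hτ => hδΩ (heQ ε hε τ hτ)
    exact (hK'.intervalIntegrable_quadratic hab hcont).congr_ae
      ((ae_restrict_iff' measurableSet_uIoc).2 (hPe ε))
  have hζ_bound : ∀ τ ∈ Ioo a b, ‖ζ τ‖ ≤ C₃ + η * (C₄ * K) := by
    intro τ hτ
    have hτ' := Ioo_subset_Icc_self hτ
    have hd : ‖deriv c τ‖ ≤ K := norm_deriv_le_of_lipschitzOn (Icc_mem_nhds hτ.1 hτ.2) hc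
    refine (norm_add_le _ _).trans (add_le_add ?_ ?_)
    · rw [norm_smul, Real.norm_eq_abs]
      calc |s τ| * ‖W (c τ)‖ ≤ 1 * C₃ := by
            gcongr
            · exact hs1 τ
            · exact hC₃ _ (hcQ τ hτ')
        _ = C₃ := one_mul _
    · rw [norm_smul, Real.norm_eq_abs]
      gcongr
      · exact hfη τ hτ'
      · exact (ContinuousLinearMap.le_opNorm _ _).trans (by
          gcongr
          exact hC₄ _ (hcQ τ hτ'))
  set Z := C₃ + η * (C₄ * K) with hZ
  have hP'_bound : ∀ᵐ τ, τ ∈ uIoc a b → ∀ ε ∈ Ioo (-ε₀) ε₀,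
      ‖P' ε τ‖ ≤ C₂ * (η * C₃) * (K + Z) * (K + Z) + C₁ * Z * (K + Z) + C₁ * (K + Z) * Z := by
    filter_upwards [ae_Ioo_of_mem_uIoc hab] with τ h1 h2 ε hε
    have hτ := h1 h2
    have hτ' := Ioo_subset_Icc_self hτ
    have hε' : |ε| < ε₀ := abs_lt.2 hε
    have hε1 : |ε| ≤ 1 := hε'.le.trans (min_le_left _ _)
    have hd : ‖deriv c τ‖ ≤ K := norm_deriv_le_of_lipschitzOn (Icc_mem_nhds hτ.1 hτ.2) hc
    have hζb := hζ_bound τ hτ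
    have hz : ‖deriv c τ + ε • ζ τ‖ ≤ K + Z := by
      refine (norm_add_le _ _).trans (add_le_add hd ?_)
      rw [norm_smul, Real.norm_eq_abs]
      calc |ε| * ‖ζ τ‖ ≤ 1 * Z := by gcongr
        _ = Z := one_mul _
    have hfW : ‖f τ • W (c τ)‖ ≤ η * C₃ := by
      rw [norm_smul, Real.norm_eq_abs]
      gcongr
      · exact hfη τ hτ'
      · exact hC₃ _ (hcQ τ hτ')
    have hQe := heQ ε hε' τ hτ'
    have hZ0 : 0 ≤ Z := (norm_nonneg _).trans hζb
    refine (norm_add_le _ _).trans (add_le_add ((norm_add_le _ _).trans (add_le_add ?_ ?_)) ?_)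
    · refine (ContinuousLinearMap.le_opNorm₂ _ _ _).trans ?_
      gcongr
      exact (ContinuousLinearMap.le_opNorm _ _).trans (by gcongr; exact hC₂ _ hQe)
    · refine (ContinuousLinearMap.le_opNorm₂ _ _ _).trans ?_
      gcongr
      exact hC₁ _ hQe
    · refine (ContinuousLinearMap.le_opNorm₂ _ _ _).trans ?_
      gcongr
      exact hC₁ _ hQe
  have hP'_deriv : ∀ᵐ τ, τ ∈ uIoc a b → ∀ ε ∈ Ioo (-ε₀) ε₀,
      HasDerivAt (fun ε => P ε τ) (P' ε τ) ε := by
    filter_upwards [ae_Ioo_of_mem_uIoc hab] with τ h1 h2 ε hε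
    have hQe := heQ ε (abs_lt.2 hε) τ (Ioo_subset_Icc_self (h1 h2))
    have hGd : HasFDerivAt G (fderiv ℝ G (e ε τ)) (e ε τ) :=
      ((hG.contDiffAt (hΩ.mem_nhds (hδΩ hQe))).differentiableAt one_ne_zero).hasFDerivAt
    have d1 : HasDerivAt (fun ε => e ε τ) (f τ • W (c τ)) ε := by
      simpa [he] using ((hasDerivAt_id ε).smul_const (f τ • W (c τ))).const_add (c τ)
    have d2 : HasDerivAt (fun ε : ℝ => deriv c τ + ε • ζ τ) (ζ τ) ε := by
      simpa using ((hasDerivAt_id ε).smul_const (ζ τ)).const_add (deriv c τ)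
    have := ((hGd.comp_hasDerivAt ε d1).clm_apply d2).clm_apply d2
    convert! this using 1
  have hPe0 : ∀ τ, e 0 τ = c τ := by intro τ; simp [he]
  -- pointwise, the derivative of the energy density is expressed through the Hessian
  have hP'0 : ∀ τ ∈ Ioo a b, P' 0 τ =
      2 * (s τ * fderiv ℝ F (c τ) (deriv c τ)) +
        2 * (f τ * chartHessian G W F (c τ) (deriv c τ) (deriv c τ)) := by
    intro τ hτ
    have hcτ := hcΩ (Ioo_subset_Icc_self hτ)
    have h := chartHessian_eq hΩ hG hW hWF hF hcτ (deriv c τ)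
    simp only [hP', hPe0, zero_smul, add_zero]
    rw [hsymm _ hcτ (deriv c τ) (ζ τ)]
    simp only [hζ, map_add, map_smul, _root_.add_apply, _root_.smul_apply,
      smul_eq_mul, hWF _ hcτ]
    linear_combination f τ * h
  -- the two integrals
  have hcI : ∀ {x y}, Icc x y ⊆ Icc a b → LipschitzOnWith K c (Icc x y) := fun h => hc.mono h
  have hF1 : ContDiffOn ℝ 1 F Ω := hF.of_le (by norm_num)
  have hsub1 : Icc a m ⊆ Icc a b := Icc_subset_Icc le_rfl hmb
  have hsub2 : Icc m b ⊆ Icc a b := Icc_subset_Icc ham le_rfl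
  obtain ⟨i1, v1⟩ := (hcI hsub1).integral_fderiv_comp ham hΩ (hcΩ.mono_left hsub1) hF1
  obtain ⟨i2, v2⟩ := (hcI hsub2).integral_fderiv_comp hmb hΩ (hcΩ.mono_left hsub2) hF1
  have hne : ∀ᵐ τ : ℝ, τ ≠ m := by simp [ae_iff, measure_singleton]
  have q1 : ∀ᵐ τ, τ ∈ uIoc a m →
      fderiv ℝ F (c τ) (deriv c τ) = s τ * fderiv ℝ F (c τ) (deriv c τ) := by
    filter_upwards [hne] with τ h1 h2
    rw [uIoc_of_le ham] at h2
    simp [hs, lt_of_le_of_ne h2.2 h1]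
  have q2 : ∀ᵐ τ, τ ∈ uIoc m b →
      -(fderiv ℝ F (c τ) (deriv c τ)) = s τ * fderiv ℝ F (c τ) (deriv c τ) := by
    filter_upwards with τ h2
    rw [uIoc_of_le hmb] at h2
    simp [hs, not_lt.2 h2.1.le]
  have j1 : IntervalIntegrable (fun τ => s τ * fderiv ℝ F (c τ) (deriv c τ)) volume a m :=
    i1.congr_ae ((ae_restrict_iff' measurableSet_uIoc).2 q1)
  have j2 : IntervalIntegrable (fun τ => s τ * fderiv ℝ F (c τ) (deriv c τ)) volume m b :=
    i2.neg.congr_ae ((ae_restrict_iff' measurableSet_uIoc).2 q2)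
  have w1 : ∫ τ in a..b, s τ * fderiv ℝ F (c τ) (deriv c τ) =
      2 * F (c m) - F (c a) - F (c b) := by
    rw [← intervalIntegral.integral_add_adjacent_intervals j1 j2,
      ← intervalIntegral.integral_congr_ae q1, ← intervalIntegral.integral_congr_ae q2,
      intervalIntegral.integral_neg, v1, v2]
    ring
  have jH : IntervalIntegrable (fun τ => f τ * chartHessian G W F (c τ) (deriv c τ) (deriv c τ))
      volume a b := by
    have hH : ContinuousOn (fun τ => chartHessian G W F (c τ)) (Icc a b) :=
      (continuousOn_chartHessian hΩ hG hW.continuousOn hF).comp hcc hcΩ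
    exact (hc.intervalIntegrable_quadratic hab hH).continuousOn_mul (by fun_prop)
  have js : IntervalIntegrable (fun τ => s τ * fderiv ℝ F (c τ) (deriv c τ)) volume a b :=
    j1.trans j2
  have hP'i : IntervalIntegrable (P' 0) volume a b := by
    refine ((js.const_mul 2).add (jH.const_mul 2)).congr_ae ?_
    rw [EventuallyEq, ae_restrict_iff' measurableSet_uIoc]
    filter_upwards [ae_Ioo_of_mem_uIoc hab] with τ h1 h2
    exact (hP'0 τ (h1 h2)).symm
  have hder := (intervalIntegral.hasDerivAt_integral_of_dominated_loc_of_deriv_le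
    (Ioo_mem_nhds (neg_lt_zero.2 hε₀pos) hε₀pos)
    (F := P) (F' := P') (by
      filter_upwards [Ioo_mem_nhds (neg_lt_zero.2 hε₀pos) hε₀pos] with ε hε
      exact (intervalIntegrable_iff.1 (hPint ε (abs_lt.2 hε))).aestronglyMeasurable) (hPint 0 (by simpa using hε₀pos))
    (intervalIntegrable_iff.1 hP'i).aestronglyMeasurable hP'_bound intervalIntegrable_const hP'_deriv).2
  have hloc : IsLocalMin (fun ε => ∫ τ in a..b, P ε τ) 0 := by
    filter_upwards [Ioo_mem_nhds (neg_lt_zero.2 hε₀pos) hε₀pos] with ε hε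
    obtain ⟨K', hK'⟩ := heL ε
    have := hmin (e ε) K' hK' (fun τ hτ => hδΩ (heQ ε (abs_lt.2 hε) τ hτ))
      (by simp [he, hf, ha, abs_of_pos hη]) (by simp [he, hf, hb, abs_of_pos hη])
    rw [← intervalIntegral.integral_congr_ae (hPe 0), ← intervalIntegral.integral_congr_ae (hPe ε)]
    have h0 : e 0 = c := funext hPe0
    rwa [h0]
  have hzero := hloc.hasDerivAt_eq_zero hder
  have : ∫ τ in a..b, P' 0 τ = 2 * (∫ τ in a..b, s τ * fderiv ℝ F (c τ) (deriv c τ)) +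
      2 * ∫ τ in a..b, f τ * chartHessian G W F (c τ) (deriv c τ) (deriv c τ) := by
    rw [← intervalIntegral.integral_const_mul, ← intervalIntegral.integral_const_mul,
      ← intervalIntegral.integral_add (js.const_mul 2) (jH.const_mul 2)]
    apply intervalIntegral.integral_congr_ae
    filter_upwards [ae_Ioo_of_mem_uIoc hab] with τ h1 h2
    exact hP'0 τ (h1 h2)
  rw [hzero, w1] at this
  linarith

end Chart

section Manifold

set_option maxSynthPendingDepth 3

variable {E : Type*} [NormedAddCommGroup E] [NormedSpace ℝ E]
  {M : Type*} [TopologicalSpace M] [ChartedSpace E M] [IsManifold 𝓘(ℝ, E) ∞ M]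
  (g : Bundle.RiemannianMetric (fun x : M => TangentSpace 𝓘(ℝ, E) x))

/-! ### Reading a metric tensor in charts -/

/-- The squared speed `g(γ', γ')` of a curve at time `τ` (zero if `γ` is not differentiable). -/
def speedSq (γ : ℝ → M) (τ : ℝ) : ℝ :=
  g.inner (γ τ) (mfderiv 𝓘(ℝ, ℝ) 𝓘(ℝ, E) γ τ 1) (mfderiv 𝓘(ℝ, ℝ) 𝓘(ℝ, E) γ τ 1)

/-- The inner product of `g` at `y`, on the model space `E` of the tangent space at `y`. -/
def metricForm (y : M) : E →L[ℝ] E →L[ℝ] ℝ := g.inner y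

/-- The derivative at `u` of the inverse of the chart at `x`, as an endomorphism of `E`. -/
def chartFrame (x : M) (u : E) : E →L[ℝ] E :=
  mfderiv 𝓘(ℝ, E) 𝓘(ℝ, E) (extChartAt 𝓘(ℝ, E) x).symm u

omit [IsManifold 𝓘(ℝ, E) ∞ M] in
theorem metricInChart_apply (x : M) (u v w : E) : metricInChart g x u v w =
    metricForm g ((extChartAt 𝓘(ℝ, E) x).symm u) (chartFrame x u v) (chartFrame x u w) := rfl

omit [IsManifold 𝓘(ℝ, E) ∞ M] in
theorem metricForm_symm (y : M) (v w : E) : metricForm g y v w = metricForm g y w v :=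
  g.symm y v w

omit [IsManifold 𝓘(ℝ, E) ∞ M] in
theorem metricForm_pos (y : M) {v : E} (hv : v ≠ 0) : 0 < metricForm g y v v :=
  g.pos y v hv

omit [IsManifold 𝓘(ℝ, E) ∞ M] in
theorem metricInChart_symm (x : M) (u v w : E) :
    metricInChart g x u v w = metricInChart g x u w v := by
  rw [metricInChart_apply, metricForm_symm, ← metricInChart_apply]

theorem mdifferentiableAt_extChartAt_symm {x : M} {u : E}
    (hu : u ∈ (extChartAt 𝓘(ℝ, E) x).target) :
    MDifferentiableAt 𝓘(ℝ, E) 𝓘(ℝ, E) (extChartAt 𝓘(ℝ, E) x).symm u := by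
  have := mdifferentiableWithinAt_extChartAt_symm (I := 𝓘(ℝ, E)) hu
  rwa [ModelWithCorners.range_eq_univ, mdifferentiableWithinAt_univ] at this

theorem isInvertible_chartFrame {x : M} {u : E} (hu : u ∈ (extChartAt 𝓘(ℝ, E) x).target) :
    (chartFrame x u).IsInvertible := by
  have h := isInvertible_mfderivWithin_extChartAt_symm (I := 𝓘(ℝ, E)) hu
  rwa [ModelWithCorners.range_eq_univ, mfderivWithin_univ] at h

theorem metricInChart_pos {x : M} {u : E} (hu : u ∈ (extChartAt 𝓘(ℝ, E) x).target) {v : E}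
    (hv : v ≠ 0) : 0 < metricInChart g x u v v := by
  rw [metricInChart_apply]
  apply metricForm_pos
  intro h0
  exact hv ((isInvertible_chartFrame hu).injective (h0.trans (map_zero _).symm))

theorem metricInChart_nonneg {x : M} {u : E} (hu : u ∈ (extChartAt 𝓘(ℝ, E) x).target) (v : E) :
    0 ≤ metricInChart g x u v v := by
  by_cases hv : v = 0
  · simp [hv]
  · exact (metricInChart_pos g hu hv).le

theorem chartFrame_self (x : M) :
    chartFrame x (extChartAt 𝓘(ℝ, E) x x) = ContinuousLinearMap.id ℝ E := by
  have h1 := mfderivWithin_extChartAt_symm_comp_mfderiv_extChartAt' (I := 𝓘(ℝ, E))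
    (mem_extChartAt_source (I := 𝓘(ℝ, E)) x)
  rw [mfderiv_extChartAt_self, ModelWithCorners.range_eq_univ, mfderivWithin_univ] at h1
  exact h1

/-- At the centre of the chart, the metric read in the chart is the metric itself. -/
theorem metricInChart_self (x : M) (v w : TangentSpace 𝓘(ℝ, E) x) :
    metricInChart g x (extChartAt 𝓘(ℝ, E) x x) v w = g.inner x v w := by
  refine (metricInChart_apply g x _ v w).trans ?_
  rw [chartFrame_self, extChartAt_to_inv]
  rfl

/-- The velocity of a curve, as a vector of the model space `E`. -/
def velocity (γ : ℝ → M) (τ : ℝ) : E := mfderiv 𝓘(ℝ, ℝ) 𝓘(ℝ, E) γ τ 1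

omit [IsManifold 𝓘(ℝ, E) ∞ M] in
theorem speedSq_eq_metricForm (γ : ℝ → M) (τ : ℝ) :
    speedSq g γ τ = metricForm g (γ τ) (velocity γ τ) (velocity γ τ) := rfl

/-- Chain rule: the velocity of a curve is computed by its representative in a chart. -/
theorem velocity_eq_of_hasDerivAt {γ : ℝ → M} {x : M} {τ : ℝ} {c' : E}
    (hγ : ContinuousAt γ τ) (hx : γ τ ∈ (extChartAt 𝓘(ℝ, E) x).source)
    (hc : HasDerivAt (fun σ => extChartAt 𝓘(ℝ, E) x (γ σ)) c' τ) :
    velocity γ τ = chartFrame x (extChartAt 𝓘(ℝ, E) x (γ τ)) c' := by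
  set φ := extChartAt 𝓘(ℝ, E) x with hφ
  have hev : γ =ᶠ[𝓝 τ] φ.symm ∘ fun σ => φ (γ σ) := by
    have : ∀ᶠ σ in 𝓝 τ, γ σ ∈ φ.source :=
      hγ ((isOpen_extChartAt_source (I := 𝓘(ℝ, E)) x).mem_nhds hx)
    filter_upwards [this] with σ hσ
    exact (φ.left_inv hσ).symm
  have hm1 : HasMFDerivAt 𝓘(ℝ, ℝ) 𝓘(ℝ, E) (fun σ => φ (γ σ)) τ
      (ContinuousLinearMap.toSpanSingleton ℝ c') := hc.hasFDerivAt.hasMFDerivAt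
  have hm2 := (mdifferentiableAt_extChartAt_symm (φ.map_source hx)).hasMFDerivAt
  have hm := (HasMFDerivAt.comp τ hm2 hm1).congr_of_eventuallyEq hev
  have : (ContinuousLinearMap.toSpanSingleton ℝ c') (1 : ℝ) = c' := by simp
  rw [velocity, hm.mfderiv]
  exact congrArg (chartFrame x (φ (γ τ))) this

theorem speedSq_eq_of_hasDerivAt {γ : ℝ → M} {x : M} {τ : ℝ} {c' : E}
    (hγ : ContinuousAt γ τ) (hx : γ τ ∈ (extChartAt 𝓘(ℝ, E) x).source)
    (hc : HasDerivAt (fun σ => extChartAt 𝓘(ℝ, E) x (γ σ)) c' τ) :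
    speedSq g γ τ = metricInChart g x (extChartAt 𝓘(ℝ, E) x (γ τ)) c' c' := by
  rw [speedSq_eq_metricForm, metricInChart_apply, velocity_eq_of_hasDerivAt hγ hx hc,
    (extChartAt 𝓘(ℝ, E) x).left_inv hx]

/-! ### The Riemannian distance as an infimum of lengths -/

open scoped Bundle in
omit [IsManifold 𝓘(ℝ, E) ∞ M] in
theorem pathELength_eq_lintegral_speedSq (γ : ℝ → M) (a b : ℝ) :
    let : Bundle.RiemannianBundle (fun x : M => TangentSpace 𝓘(ℝ, E) x) := ⟨g⟩
    Manifold.pathELength 𝓘(ℝ, E) γ a b =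
      ∫⁻ τ in Ioo a b, ENNReal.ofReal (√(speedSq g γ τ)) := by
  intro _
  rw [Manifold.pathELength_eq_lintegral_mfderiv_Ioo]
  congr 1
  ext τ
  rw [← ofReal_norm, norm_eq_sqrt_real_inner]
  rfl

open scoped Bundle in
omit [IsManifold 𝓘(ℝ, E) ∞ M] in
theorem riemDist_le_lintegral {γ : ℝ → M} {a b : ℝ} (hab : a ≤ b)
    (hγ : ContMDiffOn 𝓘(ℝ, ℝ) 𝓘(ℝ, E) 1 γ (Icc a b)) :
    riemDist g (γ a) (γ b) ≤ ∫⁻ τ in Ioo a b, ENNReal.ofReal (√(speedSq g γ τ)) := by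
  let : Bundle.RiemannianBundle (fun x : M => TangentSpace 𝓘(ℝ, E) x) := ⟨g⟩
  rw [← pathELength_eq_lintegral_speedSq]
  exact Manifold.riemannianEDist_le_pathELength hγ rfl rfl hab

open scoped Bundle in
omit [IsManifold 𝓘(ℝ, E) ∞ M] in
theorem exists_path_of_riemDist_lt {x y : M} {r : ℝ≥0∞} (h : riemDist g x y < r) :
    ∃ γ : ℝ → M, γ 0 = x ∧ γ 1 = y ∧ ContMDiff 𝓘(ℝ, ℝ) 𝓘(ℝ, E) 1 γ ∧
      ∫⁻ τ in Ioo (0 : ℝ) 1, ENNReal.ofReal (√(speedSq g γ τ)) < r := by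
  let : Bundle.RiemannianBundle (fun x : M => TangentSpace 𝓘(ℝ, E) x) := ⟨g⟩
  obtain ⟨γ, h0, h1, hs, hl, -⟩ :=
    Manifold.exists_lt_locally_constant_of_riemannianEDist_lt (I := 𝓘(ℝ, E)) h zero_lt_one
  refine ⟨γ, h0, h1, hs, ?_⟩
  rwa [← pathELength_eq_lintegral_speedSq]

open scoped Bundle in
omit [IsManifold 𝓘(ℝ, E) ∞ M] in
theorem riemDist_self (x : M) : riemDist g x x = 0 := by
  let : Bundle.RiemannianBundle (fun x : M => TangentSpace 𝓘(ℝ, E) x) := ⟨g⟩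
  exact Manifold.riemannianEDist_self

open scoped Bundle in
omit [IsManifold 𝓘(ℝ, E) ∞ M] in
theorem riemDist_comm (x y : M) : riemDist g x y = riemDist g y x := by
  let : Bundle.RiemannianBundle (fun x : M => TangentSpace 𝓘(ℝ, E) x) := ⟨g⟩
  exact Manifold.riemannianEDist_comm

open scoped Bundle in
omit [IsManifold 𝓘(ℝ, E) ∞ M] in
theorem riemDist_triangle (x y z : M) : riemDist g x z ≤ riemDist g x y + riemDist g y z := by
  let : Bundle.RiemannianBundle (fun x : M => TangentSpace 𝓘(ℝ, E) x) := ⟨g⟩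
  exact Manifold.riemannianEDist_triangle

/-- Upper bound for the distance by the length of a segment in a chart. -/
theorem riemDist_le_of_segment {x : M} {u v : E}
    (hs : segment ℝ u v ⊆ (extChartAt 𝓘(ℝ, E) x).target) {C : ℝ} (hC : 0 ≤ C)
    (hG : ∀ w ∈ segment ℝ u v, metricInChart g x w (v - u) (v - u) ≤ C ^ 2) :
    riemDist g ((extChartAt 𝓘(ℝ, E) x).symm u) ((extChartAt 𝓘(ℝ, E) x).symm v) ≤
      ENNReal.ofReal C := by
  set φ := extChartAt 𝓘(ℝ, E) x with hφ
  set l : ℝ → E := fun τ => u + τ • (v - u) with hl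
  have hlm : ∀ τ ∈ Icc (0 : ℝ) 1, l τ ∈ segment ℝ u v := fun τ hτ => by
    rw [segment_eq_image']; exact ⟨τ, hτ, rfl⟩
  have hlc : ContDiff ℝ 1 l := by fun_prop
  have hsm : ContMDiffOn 𝓘(ℝ, ℝ) 𝓘(ℝ, E) 1 (φ.symm ∘ l) (Icc 0 1) :=
    ((contMDiffOn_extChartAt_symm x).of_le (by norm_cast)).comp hlc.contMDiff.contMDiffOn
      fun τ hτ => hs (hlm τ hτ)
  have h := riemDist_le_lintegral g zero_le_one hsm
  have e0 : (φ.symm ∘ l) 0 = φ.symm u := by simp [hl]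
  have e1 : (φ.symm ∘ l) 1 = φ.symm v := by simp [hl]
  rw [e0, e1] at h
  refine h.trans ?_
  calc ∫⁻ τ in Ioo (0 : ℝ) 1, ENNReal.ofReal (√(speedSq g (φ.symm ∘ l) τ))
      ≤ ∫⁻ τ in Ioo (0 : ℝ) 1, ENNReal.ofReal C := by
        refine setLIntegral_mono' measurableSet_Ioo fun τ hτ => ENNReal.ofReal_le_ofReal ?_
        have hτ' := hs (hlm τ (Ioo_subset_Icc_self hτ))
        have hd : HasDerivAt l (v - u) τ := by
          simpa [hl] using ((hasDerivAt_id τ).smul_const (v - u)).const_add u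
        have hc : HasDerivAt (fun σ => φ ((φ.symm ∘ l) σ)) (v - u) τ := by
          refine hd.congr_of_eventuallyEq ?_
          filter_upwards [Ioo_mem_nhds hτ.1 hτ.2] with σ hσ
          exact φ.right_inv (hs (hlm σ (Ioo_subset_Icc_self hσ)))
        have hcont : ContinuousAt (φ.symm ∘ l) τ :=
          (hsm.continuousOn).continuousAt (Icc_mem_nhds hτ.1 hτ.2)
        rw [(speedSq_eq_of_hasDerivAt g hcont (φ.map_target hτ') hc)]
        have : φ ((φ.symm ∘ l) τ) = l τ := φ.right_inv hτ'
        rw [← hφ, this]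
        exact Real.sqrt_le_iff.2 ⟨hC, hG _ (hlm τ (Ioo_subset_Icc_self hτ))⟩
    _ = ENNReal.ofReal C := by simp

/-- Lower bound for the length of a path inside a chart by the variation of a linear form of norm
at most one. -/
theorem ofReal_le_lintegral_of_chart {x : M} {γ : ℝ → M} {a b : ℝ} (hab : a ≤ b)
    (hγ : ContMDiff 𝓘(ℝ, ℝ) 𝓘(ℝ, E) 1 γ) {S : Set E}
    (hs : ∀ τ ∈ Icc a b, γ τ ∈ (extChartAt 𝓘(ℝ, E) x).source ∧ extChartAt 𝓘(ℝ, E) x (γ τ) ∈ S)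
    {ℓ : E →L[ℝ] ℝ} (hℓ : ∀ u ∈ S, ∀ w, ℓ w ^ 2 ≤ metricInChart g x u w w) :
    ENNReal.ofReal |ℓ (extChartAt 𝓘(ℝ, E) x (γ b)) - ℓ (extChartAt 𝓘(ℝ, E) x (γ a))| ≤
      ∫⁻ τ in Ioo a b, ENNReal.ofReal (√(speedSq g γ τ)) := by
  set φ := extChartAt 𝓘(ℝ, E) x with hφ
  have hcm : ContMDiffOn 𝓘(ℝ, ℝ) 𝓘(ℝ, E) 1 (φ ∘ γ) (Icc a b) := by
    refine ((contMDiffOn_extChartAt (n := 1)).comp hγ.contMDiffOn fun τ hτ => ?_)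
    have := (hs τ hτ).1
    rwa [hφ, extChartAt_source] at this
  have hc : ContDiffOn ℝ 1 (φ ∘ γ) (Icc a b) := contMDiffOn_iff_contDiffOn.1 hcm
  have hlc : ContDiffOn ℝ 1 (fun τ => ℓ (φ (γ τ))) (Icc a b) := ℓ.contDiff.comp_contDiffOn hc
  have h := enorm_sub_le_lintegral_derivWithin_Icc_of_contDiffOn_Icc hlc hab
  rw [← restrict_Ioo_eq_restrict_Icc] at h
  rw [← Real.norm_eq_abs, ofReal_norm]
  refine h.trans (setLIntegral_mono' measurableSet_Ioo fun τ hτ => ?_)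
  have hτ' := Ioo_subset_Icc_self hτ
  have hd : HasDerivAt (fun σ => φ (γ σ)) (deriv (φ ∘ γ) τ) τ :=
    ((hc.differentiableOn one_ne_zero τ hτ').differentiableAt
      (Icc_mem_nhds hτ.1 hτ.2)).hasDerivAt
  have hd' : HasDerivAt (fun σ => ℓ (φ (γ σ))) _ τ := ℓ.hasFDerivAt.comp_hasDerivAt τ hd
  rw [derivWithin_of_mem_nhds (Icc_mem_nhds hτ.1 hτ.2), hd'.deriv, ← ofReal_norm,
    (speedSq_eq_of_hasDerivAt g hγ.continuous.continuousAt (hs τ hτ').1 hd)]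
  refine ENNReal.ofReal_le_ofReal (Real.le_sqrt_of_sq_le ?_)
  rw [Real.norm_eq_abs, sq_abs]
  exact hℓ _ (hs τ hτ').2 _

end Manifold

section Bilinear

set_option maxSynthPendingDepth 3

variable {E : Type*} [NormedAddCommGroup E] [NormedSpace ℝ E]

/-! ### Positive definite forms -/

theorem exists_coercive [FiniteDimensional ℝ E] (B : E →L[ℝ] E →L[ℝ] ℝ)
    (hB : ∀ v, v ≠ 0 → 0 < B v v) : ∃ μ > 0, ∀ v, μ * ‖v‖ ^ 2 ≤ B v v := by
  have := FiniteDimensional.proper ℝ E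
  by_cases hne : (Metric.sphere (0 : E) 1).Nonempty
  · have hc : ContinuousOn (fun v => B v v) (Metric.sphere (0 : E) 1) := by fun_prop
    obtain ⟨v₀, hv₀, hmin⟩ := (isCompact_sphere (0 : E) 1).exists_isMinOn hne hc
    have hv₀0 : v₀ ≠ 0 := by rintro rfl; simp at hv₀
    refine ⟨B v₀ v₀, hB _ hv₀0, fun v => ?_⟩
    by_cases hv : v = 0
    · simp [hv]
    have hn : ‖v‖ ≠ 0 := norm_ne_zero_iff.2 hv
    have h1 : ‖v‖⁻¹ • v ∈ Metric.sphere (0 : E) 1 := by simp [norm_smul, hn]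
    have h2 : B v₀ v₀ ≤ B (‖v‖⁻¹ • v) (‖v‖⁻¹ • v) := hmin h1
    have h3 : B v v = ‖v‖ ^ 2 * B (‖v‖⁻¹ • v) (‖v‖⁻¹ • v) := by
      simp only [map_smul, smul_apply, smul_eq_mul]
      field_simp
    rw [h3, mul_comm]
    gcongr
  · refine ⟨1, one_pos, fun v => ?_⟩
    have hv : v = 0 := by
      by_contra hv
      refine hne ⟨‖v‖⁻¹ • v, ?_⟩
      simp [norm_smul, norm_ne_zero_iff.2 hv]
    simp [hv]

theorem sq_apply_le_mul (B : E →L[ℝ] E →L[ℝ] ℝ) (hs : ∀ v w, B v w = B w v)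
    (hB : ∀ v, 0 ≤ B v v) (v w : E) : B v w ^ 2 ≤ B v v * B w w := by
  have h : ∀ t : ℝ, 0 ≤ B w w * (t * t) + 2 * B v w * t + B v v := by
    intro t
    have := hB (v + t • w)
    simp only [map_add, map_smul, _root_.add_apply, smul_apply, smul_eq_mul] at this
    rw [hs w v] at this
    nlinarith
  have := discrim_le_zero h
  rw [discrim] at this
  nlinarith

theorem abs_apply_sub_apply_le {A B : E →L[ℝ] E →L[ℝ] ℝ} {δ : ℝ} (h : ‖A - B‖ ≤ δ) (w : E) :
    |A w w - B w w| ≤ δ * ‖w‖ ^ 2 := by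
  have := ContinuousLinearMap.le_opNorm₂ (A - B) w w
  simp only [_root_.sub_apply, Real.norm_eq_abs] at this
  refine this.trans ?_
  rw [pow_two, ← mul_assoc]
  gcongr

end Bilinear

section Manifold

set_option maxSynthPendingDepth 3

variable {E : Type*} [NormedAddCommGroup E] [NormedSpace ℝ E] [FiniteDimensional ℝ E]
  {M : Type*} [TopologicalSpace M] [T2Space M] [ChartedSpace E M] [IsManifold 𝓘(ℝ, E) ∞ M]
  (g : Bundle.RiemannianMetric (fun x : M => TangentSpace 𝓘(ℝ, E) x))

/-! ### Comparing the Riemannian distance with a constant metric -/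

variable {g} in
/-- A path issued from a chart ball that is shorter than the distance to the boundary of the ball
stays inside the ball. Hausdorffness enters here: the closed ball is closed in `M`. -/
theorem path_mem_ball_of_length_lt {x : M} {u₀ u₁ : E} {r l : ℝ} (hl : 0 < l)
    (hr : Metric.closedBall u₀ r ⊆ (extChartAt 𝓘(ℝ, E) x).target)
    (hG : ∀ u ∈ Metric.closedBall u₀ r, ∀ w, (l * ‖w‖) ^ 2 ≤ metricInChart g x u w w)
    (hu₁ : u₁ ∈ Metric.ball u₀ r) {γ : ℝ → M} (hγ : ContMDiff 𝓘(ℝ, ℝ) 𝓘(ℝ, E) 1 γ)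
    (hγ0 : γ 0 = (extChartAt 𝓘(ℝ, E) x).symm u₁)
    (hlen : ∫⁻ τ in Ioo (0 : ℝ) 1, ENNReal.ofReal (√(speedSq g γ τ)) <
      ENNReal.ofReal (l * (r - ‖u₁ - u₀‖))) :
    ∀ τ ∈ Icc (0 : ℝ) 1, γ τ ∈ (extChartAt 𝓘(ℝ, E) x).source ∧
      extChartAt 𝓘(ℝ, E) x (γ τ) ∈ Metric.ball u₀ r := by
  have := FiniteDimensional.proper ℝ E
  set φ := extChartAt 𝓘(ℝ, E) x with hφ
  set U := φ.source ∩ φ ⁻¹' Metric.ball u₀ r with hU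
  have hUo : IsOpen U :=
    (continuousOn_extChartAt x).isOpen_inter_preimage (isOpen_extChartAt_source x) Metric.isOpen_ball
  by_contra! hex
  obtain ⟨τ₁, hτ₁, hτ₁U⟩ := hex
  set S := Icc (0 : ℝ) 1 ∩ γ ⁻¹' Uᶜ with hS
  have hSc : IsCompact S :=
    isCompact_Icc.inter_right (hUo.isClosed_compl.preimage hγ.continuous)
  have hSn : S.Nonempty := ⟨τ₁, hτ₁, fun h => hτ₁U h.1 h.2⟩
  obtain ⟨hτI, hτU⟩ := hSc.sInf_mem hSn
  set τ := sInf S with hτ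
  have hbefore : ∀ σ ∈ Ico (0 : ℝ) τ, γ σ ∈ U := by
    intro σ hσ
    by_contra hn
    exact absurd (csInf_le hSc.bddBelow (⟨⟨hσ.1, hσ.2.le.trans hτI.2⟩, hn⟩ : σ ∈ S)) (not_le.2 hσ.2)
  have h0U : γ 0 ∈ U := by
    rw [hγ0]
    have ht := hr (Metric.ball_subset_closedBall hu₁)
    refine ⟨φ.map_target ht, ?_⟩
    rw [mem_preimage, φ.right_inv ht]
    exact hu₁
  have hτpos : 0 < τ := by
    rcases hτI.1.eq_or_lt with h | h
    · rw [← h] at hτU; exact absurd h0U hτU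
    · exact h
  have hK : IsClosed (φ.symm '' Metric.closedBall u₀ r) :=
    ((isCompact_closedBall u₀ r).image_of_continuousOn
      ((continuousOn_extChartAt_symm x).mono hr)).isClosed
  have hsub : Icc 0 τ ⊆ γ ⁻¹' (φ.symm '' Metric.closedBall u₀ r) := by
    rw [← closure_Ico hτpos.ne]
    refine closure_minimal (fun σ hσ => ?_) (hK.preimage hγ.continuous)
    obtain ⟨h1, h2⟩ := hbefore σ hσ
    exact ⟨φ (γ σ), Metric.ball_subset_closedBall h2, φ.left_inv h1⟩
  have hsub' : ∀ σ ∈ Icc 0 τ, γ σ ∈ φ.source ∧ φ (γ σ) ∈ Metric.closedBall u₀ r := by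
    intro σ hσ
    obtain ⟨u, hu, hu'⟩ := hsub hσ
    rw [← hu']
    exact ⟨φ.map_target (hr hu), by rwa [φ.right_inv (hr hu)]⟩
  have hlast := hsub' τ (right_mem_Icc.2 hτpos.le)
  have hrlast : r ≤ ‖φ (γ τ) - u₀‖ := by
    by_contra! h
    exact hτU ⟨hlast.1, by simpa [dist_eq_norm] using h⟩
  -- project on a norming linear form
  obtain ⟨f, hf1, hf2⟩ := exists_dual_vector'' ℝ (φ (γ τ) - u₁)
  have hb := ofReal_le_lintegral_of_chart g hτpos.le hγ hsub' (ℓ := l • f) (fun u hu w => by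
    refine le_trans ?_ (hG u hu w)
    have : |f w| ≤ ‖w‖ := by
      calc |f w| = ‖f w‖ := rfl
        _ ≤ ‖f‖ * ‖w‖ := f.le_opNorm w
        _ ≤ 1 * ‖w‖ := by gcongr
        _ = ‖w‖ := one_mul _
    simp only [smul_apply, smul_eq_mul]
    rw [mul_pow, mul_pow]
    exact mul_le_mul_of_nonneg_left (sq_le_sq.2 (by rwa [abs_norm])) (sq_nonneg l))
  have hu₁' : φ (γ 0) = u₁ := by
    rw [hγ0]; exact φ.right_inv (hr (Metric.ball_subset_closedBall hu₁))
  have hle : l * (r - ‖u₁ - u₀‖) ≤ |(l • f) (φ (γ τ)) - (l • f) (φ (γ 0))| := by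
    rw [hu₁', ← map_sub]
    simp only [smul_apply, smul_eq_mul]
    rw [hf2]
    refine le_trans ?_ (le_abs_self _)
    have : ‖φ (γ τ) - u₀‖ ≤ ‖φ (γ τ) - u₁‖ + ‖u₁ - u₀‖ := norm_sub_le_norm_sub_add_norm_sub _ _ _
    simp only [RCLike.ofReal_real_eq_id, id_eq]
    gcongr
    linarith
  have := (ENNReal.ofReal_le_ofReal hle).trans (hb.trans
    (lintegral_mono_set (Ioo_subset_Ioo_right hτI.2)))
  exact absurd hlen (not_lt.2 this)

variable {g} in
/-- In the situation of `path_mem_ball_of_length_lt`, points close to the ball for the Riemannian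
distance lie in the ball, and linear forms of norm at most one bound the distance from below. -/
theorem mem_ball_and_le_riemDist {x : M} {u₀ u₁ : E} {r l : ℝ} (hl : 0 < l)
    (hr : Metric.closedBall u₀ r ⊆ (extChartAt 𝓘(ℝ, E) x).target)
    (hG : ∀ u ∈ Metric.closedBall u₀ r, ∀ w, (l * ‖w‖) ^ 2 ≤ metricInChart g x u w w)
    (hu₁ : u₁ ∈ Metric.ball u₀ r) {y : M}
    (hy : riemDist g ((extChartAt 𝓘(ℝ, E) x).symm u₁) y < ENNReal.ofReal (l * (r - ‖u₁ - u₀‖))) :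
    y ∈ (extChartAt 𝓘(ℝ, E) x).source ∧ extChartAt 𝓘(ℝ, E) x y ∈ Metric.ball u₀ r ∧
    ∀ ℓ : E →L[ℝ] ℝ, (∀ u ∈ Metric.closedBall u₀ r, ∀ w, ℓ w ^ 2 ≤ metricInChart g x u w w) →
      ENNReal.ofReal |ℓ (extChartAt 𝓘(ℝ, E) x y) - ℓ u₁| ≤
        riemDist g ((extChartAt 𝓘(ℝ, E) x).symm u₁) y := by
  have hu₁' := hr (Metric.ball_subset_closedBall hu₁)
  obtain ⟨γ, h0, h1, hs, hlen⟩ := exists_path_of_riemDist_lt g hy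
  have hm := path_mem_ball_of_length_lt hl hr hG hu₁ hs h0 hlen 1 (right_mem_Icc.2 zero_le_one)
  rw [h1] at hm
  refine ⟨hm.1, hm.2, fun ℓ hℓ => le_of_forall_gt fun d hd => ?_⟩
  obtain ⟨γ', h0', h1', hs', hlen'⟩ := exists_path_of_riemDist_lt g (lt_min hd hy)
  have hm' := path_mem_ball_of_length_lt hl hr hG hu₁ hs' h0' (hlen'.trans_le (min_le_right _ _))
  have := ofReal_le_lintegral_of_chart g zero_le_one hs'
    (fun τ hτ => ⟨(hm' τ hτ).1, Metric.ball_subset_closedBall (hm' τ hτ).2⟩) hℓ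
  rw [h0', h1', (extChartAt 𝓘(ℝ, E) x).right_inv hu₁'] at this
  exact this.trans_lt (hlen'.trans_le (min_le_left _ _))

/-- The ball of radius `r` around `u₀` lies in the target of the chart at `x`, and the metric read in
this chart is `δ`-close to the constant metric `B` on that ball. -/
structure MetricNearOn (x : M) (u₀ : E) (r : ℝ) (B : E →L[ℝ] E →L[ℝ] ℝ) (δ : ℝ) : Prop where
  subset : Metric.closedBall u₀ r ⊆ (extChartAt 𝓘(ℝ, E) x).target
  norm_le : ∀ u ∈ Metric.closedBall u₀ r, ‖metricInChart g x u - B‖ ≤ δ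

variable {g}

omit [FiniteDimensional ℝ E] [T2Space M] in
theorem MetricNearOn.riemDist_le {x : M} {u₀ : E} {r δ : ℝ} {B : E →L[ℝ] E →L[ℝ] ℝ}
    (h : MetricNearOn g x u₀ r B δ) {u v : E} (hu : u ∈ Metric.closedBall u₀ r)
    (hv : v ∈ Metric.closedBall u₀ r) {C : ℝ} (hC : 0 ≤ C)
    (hBC : B (v - u) (v - u) + δ * ‖v - u‖ ^ 2 ≤ C ^ 2) :
    riemDist g ((extChartAt 𝓘(ℝ, E) x).symm u) ((extChartAt 𝓘(ℝ, E) x).symm v) ≤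
      ENNReal.ofReal C := by
  have hs := (convex_closedBall u₀ r).segment_subset hu hv
  refine riemDist_le_of_segment g (hs.trans h.subset) hC fun w hw => ?_
  have := abs_apply_sub_apply_le (h.norm_le w (hs hw)) (v - u)
  linarith [(abs_le.1 this).2]

/-- Near the centre of the ball, the Riemannian distance almost dominates that of the constant
metric. -/
theorem MetricNearOn.le_riemDist {x : M} {u₀ u₁ : E} {r δ μ : ℝ} {B : E →L[ℝ] E →L[ℝ] ℝ}
    (h : MetricNearOn g x u₀ r B δ) (hμ : 0 < μ) (hB : ∀ v, μ * ‖v‖ ^ 2 ≤ B v v)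
    (hBs : ∀ v w, B v w = B w v) (hδ0 : 0 ≤ δ) (hδ : δ ≤ μ / 2)
    (hu₁ : u₁ ∈ Metric.ball u₀ r) {y : M}
    (hy : riemDist g ((extChartAt 𝓘(ℝ, E) x).symm u₁) y <
      ENNReal.ofReal (√(μ / 2) * (r - ‖u₁ - u₀‖))) :
    y ∈ (extChartAt 𝓘(ℝ, E) x).source ∧ extChartAt 𝓘(ℝ, E) x y ∈ Metric.ball u₀ r ∧
    (1 - δ / μ) * B (extChartAt 𝓘(ℝ, E) x y - u₁) (extChartAt 𝓘(ℝ, E) x y - u₁) ≤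
        (riemDist g ((extChartAt 𝓘(ℝ, E) x).symm u₁) y).toReal ^ 2 := by
  have hB0 : ∀ v, 0 ≤ B v v := fun v => le_trans (by positivity) (hB v)
  have hlow : ∀ u ∈ Metric.closedBall u₀ r, ∀ w, B w w - δ * ‖w‖ ^ 2 ≤ metricInChart g x u w w := by
    intro u hu w
    have := abs_apply_sub_apply_le (h.norm_le u hu) w
    linarith [(abs_le.1 this).1]
  obtain ⟨h1, h2, h3⟩ := mem_ball_and_le_riemDist (l := √(μ / 2)) (by positivity) h.subset
    (fun u hu w => by
      rw [mul_pow, Real.sq_sqrt (by positivity)]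
      nlinarith [hlow u hu w, hB w, sq_nonneg ‖w‖]) hu₁ hy
  refine ⟨h1, h2, ?_⟩
  set z := extChartAt 𝓘(ℝ, E) x y - u₁ with hz
  by_cases hz0 : z = 0
  · simp [hz0]
  have hBz : 0 < B z z := lt_of_lt_of_le (by positivity) (hB z)
  have hκ : 0 ≤ 1 - δ / μ := by
    rw [sub_nonneg, div_le_one hμ]; linarith
  have h4 := h3 (√((1 - δ / μ) / B z z) • B z) (fun u hu w => by
    simp only [smul_apply, smul_eq_mul]
    rw [mul_pow, Real.sq_sqrt (by positivity)]
    have hcs := sq_apply_le_mul B hBs hB0 z w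
    calc (1 - δ / μ) / B z z * B z w ^ 2 ≤ (1 - δ / μ) / B z z * (B z z * B w w) := by gcongr
      _ = B w w - δ * (B w w / μ) := by field_simp
      _ ≤ B w w - δ * ‖w‖ ^ 2 := by
        have : ‖w‖ ^ 2 ≤ B w w / μ := by rw [le_div_iff₀ hμ]; linarith [hB w]
        gcongr
      _ ≤ _ := hlow u hu w)
  rw [← map_sub, ← hz] at h4
  have h5 := ENNReal.toReal_mono (ne_top_of_lt hy) h4
  rw [ENNReal.toReal_ofReal (abs_nonneg _)] at h5
  have h6 : (1 - δ / μ) * B z z = |(√((1 - δ / μ) / B z z) • B z) z| ^ 2 := by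
    rw [sq_abs]
    simp only [smul_apply, smul_eq_mul]
    rw [mul_pow, Real.sq_sqrt (by positivity)]
    field_simp
  rw [h6]
  gcongr

omit [FiniteDimensional ℝ E] [T2Space M] [IsManifold 𝓘(ℝ, E) ∞ M] in
/-- A continuous metric is nearly constant on small balls. -/
theorem exists_metricNearOn {x : M} {u₀ : E} (hu₀ : u₀ ∈ (extChartAt 𝓘(ℝ, E) x).target)
    (hg : ContinuousOn (metricInChart g x) (extChartAt 𝓘(ℝ, E) x).target) {δ : ℝ} (hδ : 0 < δ) :
    ∃ r > 0, MetricNearOn g x u₀ r (metricInChart g x u₀) δ := by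
  have ho : (extChartAt 𝓘(ℝ, E) x).target ∈ 𝓝 u₀ :=
    (isOpen_extChartAt_target (I := 𝓘(ℝ, E)) x).mem_nhds hu₀
  have h1 : ∀ᶠ u in 𝓝 u₀, dist (metricInChart g x u) (metricInChart g x u₀) < δ :=
    (hg.continuousAt ho).eventually (Metric.ball_mem_nhds _ hδ)
  obtain ⟨r, hr, hsub⟩ := Metric.nhds_basis_closedBall.mem_iff.1 (inter_mem ho h1)
  exact ⟨r, hr, fun u hu => (hsub hu).1, fun u hu => by
    rw [← dist_eq_norm]; exact (hsub hu).2.le⟩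

end Manifold

section Manifold

set_option maxSynthPendingDepth 3

variable {E : Type*} [NormedAddCommGroup E] [NormedSpace ℝ E] [FiniteDimensional ℝ E]
  {M : Type*} [TopologicalSpace M] [T2Space M] [ChartedSpace E M] [IsManifold 𝓘(ℝ, E) ∞ M]

/-! ### Lipschitz curves in the manifold and their energy -/

/-- `γ` is locally Lipschitz on `s` when read in charts: around each point of `s` it stays in the
source of some chart, in which it is Lipschitz. -/
def IsChartLipschitzOn (γ : ℝ → M) (s : Set ℝ) : Prop :=
  ∀ τ ∈ s, ∃ x : M, ∃ K : NNReal, ∃ U ∈ 𝓝[s] τ, MapsTo γ U (extChartAt 𝓘(ℝ, E) x).source ∧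
    LipschitzOnWith K (fun σ => extChartAt 𝓘(ℝ, E) x (γ σ)) U

/-- The field of bilinear forms `b` on the tangent spaces, read in the chart at `x`. -/
def formInChart (b : M → E →L[ℝ] E →L[ℝ] ℝ) (x : M) (u : E) : E →L[ℝ] E →L[ℝ] ℝ :=
  (b ((extChartAt 𝓘(ℝ, E) x).symm u)).bilinearComp (chartFrame x u) (chartFrame x u)

variable {γ : ℝ → M} {a b : ℝ}

omit [FiniteDimensional ℝ E] [T2Space M] [IsManifold 𝓘(ℝ, E) ∞ M] in
theorem IsChartLipschitzOn.mono {s t : Set ℝ} (h : IsChartLipschitzOn (E := E) γ t) (hst : s ⊆ t) :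
    IsChartLipschitzOn (E := E) γ s := by
  intro τ hτ
  obtain ⟨x, K, U, hU, h1, h2⟩ := h τ (hst hτ)
  exact ⟨x, K, U, nhdsWithin_mono τ hst hU, h1, h2⟩

omit [FiniteDimensional ℝ E] [T2Space M] [IsManifold 𝓘(ℝ, E) ∞ M] in
theorem continuousWithinAt_of_chart {s U : Set ℝ} {τ : ℝ} (hτ : τ ∈ s) (hU : U ∈ 𝓝[s] τ)
    {x : M} (hm : MapsTo γ U (extChartAt 𝓘(ℝ, E) x).source)
    (hc : ContinuousOn (fun σ => extChartAt 𝓘(ℝ, E) x (γ σ)) U) : ContinuousWithinAt γ s τ := by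
  have hτU : τ ∈ U := mem_of_mem_nhdsWithin hτ hU
  have h1 : ContinuousAt (extChartAt 𝓘(ℝ, E) x).symm (extChartAt 𝓘(ℝ, E) x (γ τ)) :=
    continuousAt_extChartAt_symm' (hm hτU)
  have h2 : ContinuousWithinAt
      ((extChartAt 𝓘(ℝ, E) x).symm ∘ fun σ => extChartAt 𝓘(ℝ, E) x (γ σ)) U τ :=
    ContinuousAt.comp_continuousWithinAt (f := fun σ => extChartAt 𝓘(ℝ, E) x (γ σ)) h1 (hc τ hτU)
  have h3 : ContinuousWithinAt γ U τ :=
    h2.congr (fun σ hσ => ((extChartAt 𝓘(ℝ, E) x).left_inv (hm hσ)).symm)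
      ((extChartAt 𝓘(ℝ, E) x).left_inv (hm hτU)).symm
  exact h3.mono_of_mem_nhdsWithin hU

omit [FiniteDimensional ℝ E] [T2Space M] [IsManifold 𝓘(ℝ, E) ∞ M] in
theorem IsChartLipschitzOn.continuousOn {s : Set ℝ} (h : IsChartLipschitzOn (E := E) γ s) :
    ContinuousOn γ s := by
  intro τ hτ
  obtain ⟨x, K, U, hU, h1, h2⟩ := h τ hτ
  exact continuousWithinAt_of_chart hτ hU h1 h2.continuousOn

omit [FiniteDimensional ℝ E] [T2Space M] [IsManifold 𝓘(ℝ, E) ∞ M] in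
/-- The chart neighbourhoods of a chart-Lipschitz curve on an interval may be taken to be
intervals. -/
theorem IsChartLipschitzOn.exists_Icc (h : IsChartLipschitzOn (E := E) γ (Icc a b)) {τ : ℝ}
    (hτ : τ ∈ Icc a b) : ∃ (x : M) (K : NNReal) (a' b' : ℝ), a' ≤ b' ∧
      Icc a' b' ∈ 𝓝[Icc a b] τ ∧ Icc a' b' ⊆ Icc a b ∧
      MapsTo γ (Icc a' b') (extChartAt 𝓘(ℝ, E) x).source ∧
      LipschitzOnWith K (fun σ => extChartAt 𝓘(ℝ, E) x (γ σ)) (Icc a' b') := by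
  obtain ⟨x, K, U, hU, h1, h2⟩ := h τ hτ
  obtain ⟨ε, hε, hsub⟩ := Metric.mem_nhdsWithin_iff.1 hU
  have he : Icc (max a (τ - ε / 2)) (min b (τ + ε / 2)) = Icc (τ - ε / 2) (τ + ε / 2) ∩ Icc a b := by
    rw [Icc_inter_Icc, sup_comm, inf_comm]
  have hsubU : Icc (max a (τ - ε / 2)) (min b (τ + ε / 2)) ⊆ U := by
    rw [he]
    refine fun σ hσ => hsub ⟨?_, hσ.2⟩
    rw [Metric.mem_ball, Real.dist_eq, abs_lt]
    constructor <;> linarith [hσ.1.1, hσ.1.2]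
  refine ⟨x, K, max a (τ - ε / 2), min b (τ + ε / 2), ?_, ?_, ?_, h1.mono_left hsubU,
    h2.mono hsubU⟩
  · rw [max_le_iff, le_min_iff, le_min_iff]
    refine ⟨⟨hτ.1.trans hτ.2, ?_⟩, ?_, ?_⟩ <;> linarith [hτ.1, hτ.2]
  · rw [he, inter_comm]
    exact inter_mem_nhdsWithin _ (Icc_mem_nhds (by linarith) (by linarith))
  · rw [he]; exact inter_subset_right

omit [T2Space M] [IsManifold 𝓘(ℝ, E) ∞ M] in
theorem ae_hasDerivAt_chart {x : M} {K : NNReal}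
    (hm : MapsTo γ (Icc a b) (extChartAt 𝓘(ℝ, E) x).source)
    (hc : LipschitzOnWith K (fun σ => extChartAt 𝓘(ℝ, E) x (γ σ)) (Icc a b)) :
    ∀ᵐ τ, τ ∈ Ioo a b → ContinuousAt γ τ ∧
      HasDerivAt (fun σ => extChartAt 𝓘(ℝ, E) x (γ σ))
        (deriv (fun σ => extChartAt 𝓘(ℝ, E) x (γ σ)) τ) τ := by
  filter_upwards [hc.ae_hasDerivAt] with τ h1 h2
  refine ⟨?_, h1 h2⟩
  have := continuousWithinAt_of_chart (Ioo_subset_Icc_self h2) self_mem_nhdsWithin hm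
    hc.continuousOn
  exact this.continuousAt (Icc_mem_nhds h2.1 h2.2)

omit [FiniteDimensional ℝ E] [T2Space M] in
theorem form_velocity_eq_of_hasDerivAt (β : M → E →L[ℝ] E →L[ℝ] ℝ) {x : M} {τ : ℝ} {c' : E}
    (hγ : ContinuousAt γ τ) (hx : γ τ ∈ (extChartAt 𝓘(ℝ, E) x).source)
    (hc : HasDerivAt (fun σ => extChartAt 𝓘(ℝ, E) x (γ σ)) c' τ) :
    β (γ τ) (velocity γ τ) (velocity γ τ) =
      formInChart β x (extChartAt 𝓘(ℝ, E) x (γ τ)) c' c' := by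
  rw [velocity_eq_of_hasDerivAt hγ hx hc, formInChart, ContinuousLinearMap.bilinearComp_apply,
    (extChartAt 𝓘(ℝ, E) x).left_inv hx]

omit [T2Space M] in
theorem intervalIntegrable_form_velocity_of_chart {β : M → E →L[ℝ] E →L[ℝ] ℝ} {x : M}
    (hβ : ContinuousOn (formInChart β x) (extChartAt 𝓘(ℝ, E) x).target) {K : NNReal} (hab : a ≤ b)
    (hm : MapsTo γ (Icc a b) (extChartAt 𝓘(ℝ, E) x).source)
    (hc : LipschitzOnWith K (fun σ => extChartAt 𝓘(ℝ, E) x (γ σ)) (Icc a b)) :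
    IntervalIntegrable (fun τ => β (γ τ) (velocity γ τ) (velocity γ τ)) volume a b := by
  have hA : ContinuousOn (fun τ => formInChart β x (extChartAt 𝓘(ℝ, E) x (γ τ))) (Icc a b) :=
    hβ.comp hc.continuousOn fun τ hτ => (extChartAt 𝓘(ℝ, E) x).map_source (hm hτ)
  refine (hc.intervalIntegrable_quadratic hab hA).congr_ae ?_
  rw [EventuallyEq, ae_restrict_iff' measurableSet_uIoc]
  filter_upwards [ae_hasDerivAt_chart hm hc, ae_Ioo_of_mem_uIoc hab] with τ h1 h2 h3
  have hτ := h2 h3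
  exact (form_velocity_eq_of_hasDerivAt β (h1 hτ).1 (hm (Ioo_subset_Icc_self hτ)) (h1 hτ).2).symm

omit [T2Space M] in
theorem IsChartLipschitzOn.intervalIntegrable_form_velocity
    (h : IsChartLipschitzOn (E := E) γ (Icc a b)) (hab : a ≤ b) {β : M → E →L[ℝ] E →L[ℝ] ℝ}
    (hβ : ∀ x, ContinuousOn (formInChart β x) (extChartAt 𝓘(ℝ, E) x).target) :
    IntervalIntegrable (fun τ => β (γ τ) (velocity γ τ) (velocity γ τ)) volume a b := by
  rw [intervalIntegrable_iff_integrableOn_Icc_of_le hab]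
  refine LocallyIntegrableOn.integrableOn_isCompact (fun τ hτ => ?_) isCompact_Icc
  obtain ⟨x, K, a', b', hab', hnhds, hsub, hm, hc⟩ := h.exists_Icc hτ
  refine ⟨Icc a' b', hnhds, ?_⟩
  rw [← intervalIntegrable_iff_integrableOn_Icc_of_le hab']
  exact intervalIntegrable_form_velocity_of_chart (hβ x) hab' hm hc

omit [T2Space M] [IsManifold 𝓘(ℝ, E) ∞ M] in
/-- At almost every time a chart-Lipschitz curve is differentiable in some chart. -/
theorem IsChartLipschitzOn.ae_hasDerivAt (h : IsChartLipschitzOn (E := E) γ (Icc a b)) :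
    ∀ᵐ τ, τ ∈ Ioo a b → ∃ x : M, γ τ ∈ (extChartAt 𝓘(ℝ, E) x).source ∧ ContinuousAt γ τ ∧
      HasDerivAt (fun σ => extChartAt 𝓘(ℝ, E) x (γ σ))
        (deriv (fun σ => extChartAt 𝓘(ℝ, E) x (γ σ)) τ) τ := by
  rw [ae_iff]
  refine measure_null_of_locally_null _ fun τ hτ => ?_
  simp only [mem_ofPred_eq, Classical.not_imp] at hτ
  obtain ⟨x, K, a', b', hab', hnhds, hsub, hm, hc⟩ := h.exists_Icc (Ioo_subset_Icc_self hτ.1)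
  have hae := ae_hasDerivAt_chart hm hc
  have hne : ∀ᵐ σ : ℝ, σ ≠ a' ∧ σ ≠ b' := by
    have h1 : ∀ᵐ σ : ℝ, σ ≠ a' := by simp [ae_iff, measure_singleton]
    have h2 : ∀ᵐ σ : ℝ, σ ≠ b' := by simp [ae_iff, measure_singleton]
    exact h1.and h2
  have hI : Icc a' b' ∈ 𝓝 τ := by
    rwa [nhdsWithin_eq_nhds.2 (Icc_mem_nhds hτ.1.1 hτ.1.2)] at hnhds
  refine ⟨_, inter_mem self_mem_nhdsWithin (mem_nhdsWithin_of_mem_nhds hI), ?_⟩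
  rw [← compl_mem_ae_iff]
  filter_upwards [hae, hne] with σ h1 h2 h3
  obtain ⟨h4, h5⟩ := h3
  simp only [mem_ofPred_eq, Classical.not_imp] at h4
  have hσ : σ ∈ Ioo a' b' :=
    ⟨lt_of_le_of_ne h5.1 h2.1.symm, lt_of_le_of_ne h5.2 h2.2⟩
  exact h4.2 ⟨x, hm h5, h1 hσ⟩

variable {g : Bundle.RiemannianMetric (fun x : M => TangentSpace 𝓘(ℝ, E) x)}

omit [FiniteDimensional ℝ E] [T2Space M] in
/-- In charts, the Riemannian distance is locally bounded by a multiple of the distance of `E`. -/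
theorem exists_riemDist_le_norm {x : M} {u₀ : E} (hu₀ : u₀ ∈ (extChartAt 𝓘(ℝ, E) x).target)
    (hg : ContinuousOn (metricInChart g x) (extChartAt 𝓘(ℝ, E) x).target) :
    ∃ r > 0, ∃ C : ℝ, 0 ≤ C ∧ ∀ u ∈ Metric.closedBall u₀ r, ∀ v ∈ Metric.closedBall u₀ r,
      riemDist g ((extChartAt 𝓘(ℝ, E) x).symm u) ((extChartAt 𝓘(ℝ, E) x).symm v) ≤
        ENNReal.ofReal (C * ‖v - u‖) := by
  obtain ⟨r, hr, hn⟩ := exists_metricNearOn hu₀ hg one_pos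
  refine ⟨r, hr, ‖metricInChart g x u₀‖ + 1, by positivity, fun u hu v hv => ?_⟩
  refine hn.riemDist_le hu hv (by positivity) ?_
  have h1 := (le_abs_self _).trans (ContinuousLinearMap.le_opNorm₂ (metricInChart g x u₀) (v - u) (v - u))
  have h2 := norm_nonneg (metricInChart g x u₀)
  rw [mul_pow]
  nlinarith [sq_nonneg ‖v - u‖, mul_nonneg h2 (sq_nonneg ‖v - u‖),
    mul_nonneg (mul_nonneg h2 h2) (sq_nonneg ‖v - u‖)]

omit [FiniteDimensional ℝ E] [T2Space M] in
/-- A chart-Lipschitz curve is locally Lipschitz for the Riemannian distance. -/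
theorem IsChartLipschitzOn.exists_riemDist_le {s : Set ℝ} (h : IsChartLipschitzOn (E := E) γ s)
    (hg : ∀ x, ContinuousOn (metricInChart g x) (extChartAt 𝓘(ℝ, E) x).target) {τ : ℝ}
    (hτ : τ ∈ s) : ∃ C : ℝ, 0 ≤ C ∧ ∃ U ∈ 𝓝[s] τ, ∀ σ ∈ U, ∀ σ' ∈ U,
      riemDist g (γ σ) (γ σ') ≤ ENNReal.ofReal (C * |σ' - σ|) := by
  obtain ⟨x, K, U, hU, hm, hc⟩ := h τ hτ
  have hτU : τ ∈ U := mem_of_mem_nhdsWithin hτ hU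
  set φ := extChartAt 𝓘(ℝ, E) x with hφ
  obtain ⟨r, hr, C, hC, hd⟩ := exists_riemDist_le_norm (φ.map_source (hm hτU)) (hg x)
  have hcont : ContinuousWithinAt (fun σ => φ (γ σ)) s τ :=
    (hc.continuousOn τ hτU).mono_of_mem_nhdsWithin hU
  have hball : ∀ᶠ σ in 𝓝[s] τ, φ (γ σ) ∈ Metric.closedBall (φ (γ τ)) r :=
    hcont (Metric.closedBall_mem_nhds _ hr)
  refine ⟨C * K, by positivity, _, inter_mem hU hball, fun σ hσ σ' hσ' => ?_⟩
  have h1 := hd _ hσ.2 _ hσ'.2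
  rw [φ.left_inv (hm hσ.1), φ.left_inv (hm hσ'.1)] at h1
  refine h1.trans (ENNReal.ofReal_le_ofReal ?_)
  have h2 := hc.norm_sub_le hσ'.1 hσ.1
  rw [mul_assoc]
  gcongr
  exact h2

omit [FiniteDimensional ℝ E] [T2Space M] in
theorem IsChartLipschitzOn.riemDist_ne_top (h : IsChartLipschitzOn (E := E) γ (Icc a b))
    (hg : ∀ x, ContinuousOn (metricInChart g x) (extChartAt 𝓘(ℝ, E) x).target) {σ τ : ℝ}
    (hσ : σ ∈ Icc a b) (hτ : τ ∈ Icc a b) : riemDist g (γ σ) (γ τ) ≠ ⊤ := by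
  refine (isPreconnected_Icc (a := a) (b := b)).induction₂
    (fun σ τ => riemDist g (γ σ) (γ τ) ≠ ⊤) (fun τ hτ => ?_) ?_ ?_ hσ hτ
  · obtain ⟨C, -, U, hU, hd⟩ := h.exists_riemDist_le hg hτ
    filter_upwards [hU] with σ hσ
    exact ne_top_of_le_ne_top ENNReal.ofReal_ne_top (hd τ (mem_of_mem_nhdsWithin hτ hU) σ hσ)
  · intro σ τ υ _ _ _ h1 h2
    exact ne_top_of_le_ne_top (ENNReal.add_ne_top.2 ⟨h1, h2⟩) (riemDist_triangle g _ _ _)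
  · intro σ τ _ _ h1
    rwa [riemDist_comm]

omit [FiniteDimensional ℝ E] [T2Space M] in
/-- The derivative of a distance function along a curve is at most its speed. -/
theorem sq_deriv_le_speedSq {x : M} {τ : ℝ} {c' : E} {ρ : ℝ → ℝ} {ρ' : ℝ}
    (hg : ContinuousOn (metricInChart g x) (extChartAt 𝓘(ℝ, E) x).target)
    (hγ : ContinuousAt γ τ) (hx : γ τ ∈ (extChartAt 𝓘(ℝ, E) x).source)
    (hc : HasDerivAt (fun σ => extChartAt 𝓘(ℝ, E) x (γ σ)) c' τ)
    (hρ : HasDerivAt ρ ρ' τ)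
    (hle : ∀ᶠ σ in 𝓝 τ, ENNReal.ofReal |ρ σ - ρ τ| ≤ riemDist g (γ τ) (γ σ)) :
    ρ' ^ 2 ≤ speedSq g γ τ := by
  rw [speedSq_eq_of_hasDerivAt g hγ hx hc]
  set φ := extChartAt 𝓘(ℝ, E) x with hφ
  set B := metricInChart g x (φ (γ τ)) with hB
  have hB0 : ∀ v, 0 ≤ B v v := metricInChart_nonneg g (φ.map_source hx)
  have key : ∀ δ > 0, ρ' ^ 2 ≤ B c' c' + δ * ‖c'‖ ^ 2 := by
    intro δ hδ
    obtain ⟨r, hr, hn⟩ := exists_metricNearOn (φ.map_source hx) hg hδ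
    have hball : ∀ᶠ σ in 𝓝 τ, φ (γ σ) ∈ Metric.closedBall (φ (γ τ)) r :=
      hc.continuousAt (Metric.closedBall_mem_nhds _ hr)
    have hsrc : ∀ᶠ σ in 𝓝 τ, γ σ ∈ φ.source :=
      hγ ((isOpen_extChartAt_source (I := 𝓘(ℝ, E)) x).mem_nhds hx)
    have hs1 : Tendsto (fun σ => slope ρ τ σ ^ 2) (𝓝[≠] τ) (𝓝 (ρ' ^ 2)) :=
      (hasDerivAt_iff_tendsto_slope.1 hρ).pow 2
    have hs2 := hasDerivAt_iff_tendsto_slope.1 hc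
    have hs3 : Tendsto (fun σ => B (slope (fun σ => φ (γ σ)) τ σ) (slope (fun σ => φ (γ σ)) τ σ) +
        δ * ‖slope (fun σ => φ (γ σ)) τ σ‖ ^ 2) (𝓝[≠] τ) (𝓝 (B c' c' + δ * ‖c'‖ ^ 2)) := by
      have hcont : Continuous (fun v => B v v + δ * ‖v‖ ^ 2) := by fun_prop
      exact (hcont.tendsto c').comp hs2
    refine le_of_tendsto_of_tendsto hs1 hs3 ?_
    filter_upwards [self_mem_nhdsWithin, nhdsWithin_le_nhds hball, nhdsWithin_le_nhds hsrc,
      nhdsWithin_le_nhds hle] with σ hne h1 h2 h3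
    have hne' : σ - τ ≠ 0 := sub_ne_zero.2 hne
    set z := φ (γ σ) - φ (γ τ) with hz
    have h4 := hn.riemDist_le (Metric.mem_closedBall_self hr.le) h1
      (C := √(B z z + δ * ‖z‖ ^ 2)) (by positivity) (by
        rw [Real.sq_sqrt (add_nonneg (hB0 _) (by positivity))])
    rw [φ.left_inv hx, φ.left_inv h2] at h4
    have h5 := (ENNReal.ofReal_le_ofReal_iff (by positivity)).1 (h3.trans h4)
    have h6 : (ρ σ - ρ τ) ^ 2 ≤ B z z + δ * ‖z‖ ^ 2 := by
      rw [← sq_abs, ← Real.sq_sqrt (show 0 ≤ B z z + δ * ‖z‖ ^ 2 from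
        add_nonneg (hB0 _) (by positivity))]
      gcongr
    simp only [slope_def_module, smul_eq_mul, ← hz, map_smul, smul_apply, norm_smul, mul_pow]
    rw [norm_inv, Real.norm_eq_abs, inv_pow |σ - τ|, sq_abs, ← inv_pow]
    calc (σ - τ)⁻¹ ^ 2 * (ρ σ - ρ τ) ^ 2 ≤ (σ - τ)⁻¹ ^ 2 * (B z z + δ * ‖z‖ ^ 2) := by gcongr
      _ = _ := by field_simp
  have hlim : Tendsto (fun δ : ℝ => B c' c' + δ * ‖c'‖ ^ 2) (𝓝[>] 0)
      (𝓝 (B c' c' + 0 * ‖c'‖ ^ 2)) :=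
    Tendsto.mono_left (Continuous.tendsto (by fun_prop) 0) nhdsWithin_le_nhds
  have := ge_of_tendsto hlim (eventually_nhdsWithin_of_forall fun δ hδ => key δ hδ)
  simpa using this

omit [FiniteDimensional ℝ E] [T2Space M] [IsManifold 𝓘(ℝ, E) ∞ M] in
theorem ofReal_abs_sub_riemDist_le (p : M) {y z : M} (hy : riemDist g p y ≠ ⊤)
    (hz : riemDist g p z ≠ ⊤) :
    ENNReal.ofReal |(riemDist g p z).toReal - (riemDist g p y).toReal| ≤ riemDist g y z := by
  by_cases h : riemDist g y z = ⊤
  · simp [h]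
  rw [← ENNReal.ofReal_toReal h]
  refine ENNReal.ofReal_le_ofReal (abs_le.2 ⟨?_, ?_⟩)
  · have := ENNReal.toReal_mono (ENNReal.add_ne_top.2 ⟨hz, h⟩)
      ((riemDist_triangle g p z y).trans_eq (by rw [riemDist_comm g z y]))
    rw [ENNReal.toReal_add hz h] at this
    linarith
  · have := ENNReal.toReal_mono (ENNReal.add_ne_top.2 ⟨hy, h⟩) (riemDist_triangle g p y z)
    rw [ENNReal.toReal_add hy h] at this
    linarith

omit [T2Space M] in
/-- The squared distance between the endpoints is bounded by the energy of the curve. -/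
theorem IsChartLipschitzOn.sq_riemDist_le (h : IsChartLipschitzOn (E := E) γ (Icc a b))
    (hab : a < b)
    (hg : ∀ x, ContinuousOn (metricInChart g x) (extChartAt 𝓘(ℝ, E) x).target) :
    (riemDist g (γ a) (γ b)).toReal ^ 2 ≤ (b - a) * ∫ τ in a..b, speedSq g γ τ := by
  have ha : a ∈ Icc a b := left_mem_Icc.2 hab.le
  set ρ : ℝ → ℝ := fun τ => (riemDist g (γ a) (γ τ)).toReal with hρ
  have hρle : ∀ σ ∈ Icc a b, ∀ τ ∈ Icc a b,
      ENNReal.ofReal |ρ σ - ρ τ| ≤ riemDist g (γ τ) (γ σ) := fun σ hσ τ hτ =>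
    ofReal_abs_sub_riemDist_le _ (h.riemDist_ne_top hg ha hτ) (h.riemDist_ne_top hg ha hσ)
  have hlip : LocallyLipschitzOn (Icc a b) ρ := by
    intro τ hτ
    obtain ⟨C, hC, U, hU, hd⟩ := h.exists_riemDist_le hg hτ
    refine ⟨C.toNNReal, U ∩ Icc a b, inter_mem hU self_mem_nhdsWithin, ?_⟩
    apply LipschitzOnWith.of_dist_le_mul
    intro σ hσ σ' hσ'
    rw [Real.dist_eq, Real.dist_eq, Real.coe_toNNReal _ hC]
    exact (ENNReal.ofReal_le_ofReal_iff (by positivity)).1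
      ((hρle σ hσ.2 σ' hσ'.2).trans (hd _ hσ'.1 _ hσ.1))
  obtain ⟨K, hK⟩ := hlip.exists_lipschitzOnWith_of_compact isCompact_Icc
  have hac : AbsolutelyContinuousOnInterval ρ a b :=
    LipschitzOnWith.absolutelyContinuousOnInterval (K := K) (by rwa [uIcc_of_le hab.le])
  have hFTC := hac.integral_deriv_eq_sub
  have hρa : ρ a = 0 := by simp [hρ, riemDist_self]
  have hq : IntervalIntegrable (speedSq g γ) volume a b :=
    h.intervalIntegrable_form_velocity hab.le (β := metricForm g) hg
  have hae : ∀ᵐ τ, τ ∈ Ioo a b → deriv ρ τ ^ 2 ≤ speedSq g γ τ := by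
    filter_upwards [h.ae_hasDerivAt, hK.ae_hasDerivAt] with τ h1 h2 h3
    obtain ⟨x, hx, hγ, hc⟩ := h1 h3
    refine sq_deriv_le_speedSq (hg x) hγ hx hc (h2 h3) ?_
    filter_upwards [Icc_mem_nhds h3.1 h3.2] with σ hσ
    exact hρle σ hσ τ (Ioo_subset_Icc_self h3)
  -- Cauchy-Schwarz in the form `2 θ ρ' ≤ θ² + ρ'²` with the optimal constant `θ = ρ(b) / (b - a)`
  set θ := ρ b / (b - a) with hθ
  have hmono : ∫ τ in a..b, 2 * θ * deriv ρ τ ≤ ∫ τ in a..b, (θ ^ 2 + speedSq g γ τ) := by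
    rw [intervalIntegral.integral_of_le hab.le, intervalIntegral.integral_of_le hab.le]
    refine setIntegral_mono_on_ae ((hac.intervalIntegrable_deriv.const_mul _).1)
      ((intervalIntegrable_const.add hq).1) measurableSet_Ioc ?_
    filter_upwards [hae, ae_Ioo_of_mem_uIoc hab.le] with τ h1 h2 h3
    have := h1 (h2 (by rwa [uIoc_of_le hab.le]))
    nlinarith [sq_nonneg (θ - deriv ρ τ)]
  rw [intervalIntegral.integral_const_mul, hFTC, hρa, sub_zero,
    intervalIntegral.integral_add intervalIntegrable_const hq, intervalIntegral.integral_const,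
    smul_eq_mul] at hmono
  have hba : 0 < b - a := sub_pos.2 hab
  have e1 : 2 * θ * ρ b = 2 * (ρ b ^ 2 / (b - a)) := by rw [hθ]; field_simp
  have e2 : (b - a) * θ ^ 2 = ρ b ^ 2 / (b - a) := by rw [hθ]; field_simp
  rw [e1, e2] at hmono
  have : ρ b ^ 2 / (b - a) ≤ ∫ τ in a..b, speedSq g γ τ := by linarith
  rwa [div_le_iff₀ hba, mul_comm] at this

/-! ### Metric geodesics -/

omit [FiniteDimensional ℝ E] [T2Space M] [IsManifold 𝓘(ℝ, E) ∞ M] in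
theorem IsMetricGeodesic.toReal_riemDist (h : IsMetricGeodesic (riemDist g) γ) {σ τ : ℝ}
    (hσ : σ ∈ Icc (0 : ℝ) 1) (hτ : τ ∈ Icc (0 : ℝ) 1) :
    (riemDist g (γ σ) (γ τ)).toReal = |σ - τ| * (riemDist g (γ 0) (γ 1)).toReal := by
  rw [h.2 σ hσ τ hτ, ENNReal.toReal_mul, ENNReal.toReal_ofReal (abs_nonneg _)]

omit [FiniteDimensional ℝ E] [T2Space M] [IsManifold 𝓘(ℝ, E) ∞ M] in
theorem IsMetricGeodesic.riemDist_eq_ofReal (h : IsMetricGeodesic (riemDist g) γ) {σ τ : ℝ}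
    (hσ : σ ∈ Icc (0 : ℝ) 1) (hτ : τ ∈ Icc (0 : ℝ) 1) : riemDist g (γ σ) (γ τ) =
      ENNReal.ofReal (|σ - τ| * (riemDist g (γ 0) (γ 1)).toReal) := by
  rw [h.2 σ hσ τ hτ, ENNReal.ofReal_mul (abs_nonneg _), ENNReal.ofReal_toReal h.1]

/-- A metric geodesic is locally Lipschitz in every chart. -/
theorem IsMetricGeodesic.exists_lipschitzOnWith (h : IsMetricGeodesic (riemDist g) γ) {x : M}
    (hg : ContinuousOn (metricInChart g x) (extChartAt 𝓘(ℝ, E) x).target) {τ : ℝ}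
    (hτ : τ ∈ Icc (0 : ℝ) 1) (hx : γ τ ∈ (extChartAt 𝓘(ℝ, E) x).source) :
    ∃ K : NNReal, ∃ U ∈ 𝓝[Icc 0 1] τ, MapsTo γ U (extChartAt 𝓘(ℝ, E) x).source ∧
      LipschitzOnWith K (fun σ => extChartAt 𝓘(ℝ, E) x (γ σ)) U := by
  set φ := extChartAt 𝓘(ℝ, E) x with hφ
  have hu₀ := φ.map_source hx
  set B := metricInChart g x (φ (γ τ)) with hB
  obtain ⟨μ, hμ, hBμ⟩ := exists_coercive B fun v hv => metricInChart_pos g hu₀ hv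
  obtain ⟨r, hr, hn⟩ := exists_metricNearOn hu₀ hg (half_pos hμ)
  set D := (riemDist g (γ 0) (γ 1)).toReal with hD
  have hD0 : 0 ≤ D := ENNReal.toReal_nonneg
  set l := √(μ / 2) with hl
  have hl0 : 0 < l := by positivity
  have hhalf : ∀ u : E, (l * ‖u‖) ^ 2 ≤ (1 - μ / 2 / μ) * B u u := by
    intro u
    have : (1 : ℝ) - μ / 2 / μ = 1 / 2 := by field_simp; norm_num
    rw [this, mul_pow, hl, Real.sq_sqrt (by positivity)]
    linarith [hBμ u]
  -- times close to `τ`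
  set η := l * r / (4 * (D + 1)) with hη
  have hη0 : 0 < η := by positivity
  have hηD : η * D < l * r / 4 := by
    rw [hη, div_mul_eq_mul_div, div_lt_iff₀ (by positivity)]
    nlinarith [mul_pos hl0 hr]
  have hfirst : ∀ σ ∈ Icc (0 : ℝ) 1, |σ - τ| < η → γ σ ∈ φ.source ∧ ‖φ (γ σ) - φ (γ τ)‖ ≤ r / 4 := by
    intro σ hσ hστ
    have hst : |τ - σ| * D ≤ η * D := by rw [abs_sub_comm]; gcongr
    have hd : riemDist g (φ.symm (φ (γ τ))) (γ σ) <
        ENNReal.ofReal (l * (r - ‖φ (γ τ) - φ (γ τ)‖)) := by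
      rw [φ.left_inv hx, h.riemDist_eq_ofReal hτ hσ, sub_self, norm_zero, sub_zero]
      refine (ENNReal.ofReal_lt_ofReal_iff (by positivity)).2 ?_
      linarith [mul_pos hl0 hr]
    obtain ⟨h1, h2, h3⟩ := hn.le_riemDist hμ hBμ (metricInChart_symm g x _) (half_pos hμ).le le_rfl
      (Metric.mem_ball_self hr) hd
    refine ⟨h1, ?_⟩
    have h4 := (hhalf _).trans h3
    rw [φ.left_inv hx, h.toReal_riemDist hτ hσ] at h4
    have h5 := abs_le_of_sq_le_sq h4 (by positivity)
    rw [abs_of_nonneg (by positivity)] at h5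
    have h6 : l * ‖φ (γ σ) - φ (γ τ)‖ ≤ l * (r / 4) := by linarith
    exact le_of_mul_le_mul_left h6 hl0
  refine ⟨(D / l).toNNReal, Icc 0 1 ∩ Metric.ball τ η,
    inter_mem_nhdsWithin _ (Metric.ball_mem_nhds _ hη0), fun σ hσ => (hfirst σ hσ.1 ?_).1, ?_⟩
  · simpa [Real.dist_eq] using hσ.2
  apply LipschitzOnWith.of_dist_le_mul
  intro σ hσ σ' hσ'
  have hs : |σ - τ| < η := by simpa [Real.dist_eq] using hσ.2
  have hs' : |σ' - τ| < η := by simpa [Real.dist_eq] using hσ'.2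
  obtain ⟨p1, p2⟩ := hfirst σ' hσ'.1 hs'
  have hss : |σ' - σ| < 2 * η := by
    have := abs_sub_le σ' τ σ
    rw [abs_sub_comm τ σ] at this
    linarith
  have hd : riemDist g (φ.symm (φ (γ σ'))) (γ σ) <
      ENNReal.ofReal (l * (r - ‖φ (γ σ') - φ (γ τ)‖)) := by
    rw [φ.left_inv p1, h.riemDist_eq_ofReal hσ'.1 hσ.1]
    have h7 : |σ' - σ| * D ≤ 2 * η * D := by gcongr
    have h8 : l * (r * (3 / 4)) ≤ l * (r - ‖φ (γ σ') - φ (γ τ)‖) := by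
      gcongr; linarith
    have h9 := mul_pos hl0 hr
    refine (ENNReal.ofReal_lt_ofReal_iff (by nlinarith)).2 ?_
    linarith
  obtain ⟨h1, h2, h3⟩ := hn.le_riemDist hμ hBμ (metricInChart_symm g x _) (half_pos hμ).le le_rfl
    (by rw [Metric.mem_ball, dist_eq_norm]; linarith) hd
  have h4 := (hhalf _).trans h3
  rw [φ.left_inv p1, h.toReal_riemDist hσ'.1 hσ.1] at h4
  have h5 := abs_le_of_sq_le_sq h4 (by positivity)
  rw [abs_of_nonneg (by positivity)] at h5
  rw [dist_eq_norm, Real.dist_eq, Real.coe_toNNReal _ (by positivity), div_mul_eq_mul_div,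
    le_div_iff₀ hl0, abs_sub_comm]
  linarith

theorem IsMetricGeodesic.isChartLipschitzOn (h : IsMetricGeodesic (riemDist g) γ)
    (hg : ∀ x, ContinuousOn (metricInChart g x) (extChartAt 𝓘(ℝ, E) x).target) :
    IsChartLipschitzOn (E := E) γ (Icc 0 1) := by
  intro τ hτ
  obtain ⟨K, U, hU, h1, h2⟩ := h.exists_lipschitzOnWith (hg (γ τ)) hτ
    (mem_extChartAt_source (I := 𝓘(ℝ, E)) (γ τ))
  exact ⟨γ τ, K, U, hU, h1, h2⟩

/-- A metric geodesic moves with speed at most the distance of its endpoints. -/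
theorem IsMetricGeodesic.speedSq_le (h : IsMetricGeodesic (riemDist g) γ)
    (hg : ∀ x, ContinuousOn (metricInChart g x) (extChartAt 𝓘(ℝ, E) x).target) :
    ∀ᵐ τ, τ ∈ Ioo (0 : ℝ) 1 → speedSq g γ τ ≤ (riemDist g (γ 0) (γ 1)).toReal ^ 2 := by
  filter_upwards [(h.isChartLipschitzOn hg).ae_hasDerivAt] with τ h1 hτ
  obtain ⟨x, hx, hγ, hc⟩ := h1 hτ
  rw [speedSq_eq_of_hasDerivAt g hγ hx hc]
  set φ := extChartAt 𝓘(ℝ, E) x with hφ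
  set c' := deriv (fun σ => φ (γ σ)) τ with hc'
  have hu₀ := φ.map_source hx
  set B := metricInChart g x (φ (γ τ)) with hB
  set D := (riemDist g (γ 0) (γ 1)).toReal with hD
  have hD0 : 0 ≤ D := ENNReal.toReal_nonneg
  obtain ⟨μ, hμ, hBμ⟩ := exists_coercive B fun v hv => metricInChart_pos g hu₀ hv
  have key : ∀ δ ∈ Ioo 0 (μ / 2), (1 - δ / μ) * B c' c' ≤ D ^ 2 := by
    intro δ hδ
    obtain ⟨r, hr, hn⟩ := exists_metricNearOn hu₀ (hg x) hδ.1
    have hlim : Tendsto (fun σ => (1 - δ / μ) * B (slope (fun σ => φ (γ σ)) τ σ)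
        (slope (fun σ => φ (γ σ)) τ σ)) (𝓝[≠] τ) (𝓝 ((1 - δ / μ) * B c' c')) := by
      have hcont : Continuous (fun v => (1 - δ / μ) * B v v) := by fun_prop
      exact (hcont.tendsto c').comp (hasDerivAt_iff_tendsto_slope.1 hc)
    have hsmall : ∀ᶠ σ in 𝓝 τ, |τ - σ| * D < √(μ / 2) * r := by
      have hcont : Continuous (fun σ => |τ - σ| * D) := by fun_prop
      have := hcont.tendsto τ
      simp only [sub_self, abs_zero, zero_mul] at this
      exact this (Iio_mem_nhds (by positivity))
    refine le_of_tendsto hlim ?_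
    filter_upwards [self_mem_nhdsWithin, nhdsWithin_le_nhds hsmall,
      nhdsWithin_le_nhds (Icc_mem_nhds hτ.1 hτ.2)] with σ hne hs hσ
    have hd : riemDist g (φ.symm (φ (γ τ))) (γ σ) <
        ENNReal.ofReal (√(μ / 2) * (r - ‖φ (γ τ) - φ (γ τ)‖)) := by
      rw [φ.left_inv hx, h.riemDist_eq_ofReal (Ioo_subset_Icc_self hτ) hσ, sub_self, norm_zero,
        sub_zero]
      exact (ENNReal.ofReal_lt_ofReal_iff (by positivity)).2 hs
    obtain ⟨h1, h2, h3⟩ := hn.le_riemDist hμ hBμ (metricInChart_symm g x _) hδ.1.le hδ.2.le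
      (Metric.mem_ball_self hr) hd
    rw [φ.left_inv hx, h.toReal_riemDist (Ioo_subset_Icc_self hτ) hσ] at h3
    have hne' : σ - τ ≠ 0 := sub_ne_zero.2 hne
    simp only [slope_def_module, map_smul, smul_apply, smul_eq_mul]
    rw [mul_pow, sq_abs] at h3
    calc (1 - δ / μ) * ((σ - τ)⁻¹ * ((σ - τ)⁻¹ * B (φ (γ σ) - φ (γ τ)) (φ (γ σ) - φ (γ τ))))
        = (σ - τ)⁻¹ ^ 2 * ((1 - δ / μ) * B (φ (γ σ) - φ (γ τ)) (φ (γ σ) - φ (γ τ))) := by ring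
      _ ≤ (σ - τ)⁻¹ ^ 2 * ((τ - σ) ^ 2 * D ^ 2) := by gcongr
      _ = D ^ 2 := by
        rw [show (τ - σ) ^ 2 = (σ - τ) ^ 2 by ring]
        field_simp
  have hlim : Tendsto (fun δ : ℝ => (1 - δ / μ) * B c' c') (𝓝[>] 0)
      (𝓝 ((1 - 0 / μ) * B c' c')) :=
    Tendsto.mono_left (Continuous.tendsto (by fun_prop) 0) nhdsWithin_le_nhds
  have hev : ∀ᶠ δ in 𝓝[>] (0 : ℝ), (1 - δ / μ) * B c' c' ≤ D ^ 2 := by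
    filter_upwards [Ioo_mem_nhdsGT (half_pos hμ)] with δ hδ using key δ hδ
  have := le_of_tendsto hlim hev
  simpa using this

end Manifold

section Manifold

set_option maxSynthPendingDepth 3

variable {E : Type*} [NormedAddCommGroup E] [NormedSpace ℝ E] [FiniteDimensional ℝ E]
  {M : Type*} [TopologicalSpace M] [T2Space M] [ChartedSpace E M] [IsManifold 𝓘(ℝ, E) ∞ M]

/-! ### Functions along metric geodesics -/

/-- The gradient of `f` for the metric `g`, read in the chart at `x`. -/
def gradientInChart (g : Bundle.RiemannianMetric (fun x : M => TangentSpace 𝓘(ℝ, E) x)) (f : M → ℝ)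
    (x : M) (u : E) : E :=
  (metricInChart g x u).inverse (fderiv ℝ (f ∘ (extChartAt 𝓘(ℝ, E) x).symm) u)

/-- The Hessian of `f` for the metric `g`, read in the chart at `x`. -/
def hessianInChart (g : Bundle.RiemannianMetric (fun x : M => TangentSpace 𝓘(ℝ, E) x)) (f : M → ℝ)
    (x : M) : E → E →L[ℝ] E →L[ℝ] ℝ :=
  chartHessian (metricInChart g x) (gradientInChart g f x) (f ∘ (extChartAt 𝓘(ℝ, E) x).symm)

variable {g : Bundle.RiemannianMetric (fun x : M => TangentSpace 𝓘(ℝ, E) x)} {f : M → ℝ} {x : M}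

theorem isInvertible_of_pos {B : E →L[ℝ] E →L[ℝ] ℝ} (hB : ∀ v, v ≠ 0 → 0 < B v v) :
    B.IsInvertible := by
  have hinj : Function.Injective (B : E →ₗ[ℝ] (E →L[ℝ] ℝ)) := by
    rw [injective_iff_map_eq_zero]
    intro v hv
    by_contra hne
    have h1 := hB v hne
    have h2 : B v = 0 := hv
    rw [h2] at h1
    simp at h1
  have hdim : Module.finrank ℝ E = Module.finrank ℝ (E →L[ℝ] ℝ) := by
    rw [← (LinearMap.toContinuousLinearMap (𝕜 := ℝ) (E := E) (F' := ℝ)).finrank_eq,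
      Module.finrank_linearMap, Module.finrank_self, mul_one]
  exact ⟨(LinearEquiv.ofInjectiveOfFinrankEq (B : E →ₗ[ℝ] (E →L[ℝ] ℝ)) hinj hdim).toContinuousLinearEquiv,
    by ext; rfl⟩

omit [T2Space M] in
theorem metricInChart_gradientInChart {u : E} (hu : u ∈ (extChartAt 𝓘(ℝ, E) x).target) :
    metricInChart g x u (gradientInChart g f x u) =
      fderiv ℝ (f ∘ (extChartAt 𝓘(ℝ, E) x).symm) u := by
  obtain ⟨e, he⟩ := isInvertible_of_pos fun v hv => metricInChart_pos g hu hv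
  rw [gradientInChart, ← he]
  simp

omit [T2Space M] in
theorem contDiffOn_gradientInChart
    (hg : ContDiffOn ℝ ∞ (metricInChart g x) (extChartAt 𝓘(ℝ, E) x).target)
    (hf : ContDiffOn ℝ ∞ (f ∘ (extChartAt 𝓘(ℝ, E) x).symm) (extChartAt 𝓘(ℝ, E) x).target) :
    ContDiffOn ℝ ∞ (gradientInChart g f x) (extChartAt 𝓘(ℝ, E) x).target := by
  have := FiniteDimensional.complete ℝ E
  have ho := isOpen_extChartAt_target (I := 𝓘(ℝ, E)) x
  have hdf := hf.fderiv_of_isOpen (m := ∞) ho (by norm_num)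
  intro u hu
  refine ContDiffWithinAt.clm_apply ?_ (hdf u hu)
  obtain ⟨e, he⟩ := isInvertible_of_pos fun v hv => metricInChart_pos g hu hv
  have h1 : ContDiffAt ℝ ∞ ContinuousLinearMap.inverse (metricInChart g x u) := by
    rw [← he]; exact contDiffAt_map_inverse e
  exact h1.comp_contDiffWithinAt u (hg u hu)

omit [T2Space M] in
theorem continuousOn_hessianInChart
    (hg : ContDiffOn ℝ ∞ (metricInChart g x) (extChartAt 𝓘(ℝ, E) x).target)
    (hf : ContDiffOn ℝ ∞ (f ∘ (extChartAt 𝓘(ℝ, E) x).symm) (extChartAt 𝓘(ℝ, E) x).target) :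
    ContinuousOn (hessianInChart g f x) (extChartAt 𝓘(ℝ, E) x).target :=
  continuousOn_chartHessian (isOpen_extChartAt_target x) (hg.of_le (by norm_cast))
    (contDiffOn_gradientInChart hg hf).continuousOn (hf.of_le (by norm_cast))

omit [T2Space M] in
/-- The defining equation of the Christoffel symbols, tested against the gradient, identifies the two
expressions of the Hessian. -/
theorem riemHessian_eq_hessianInChart
    (hg : ContDiffOn ℝ ∞ (metricInChart g x) (extChartAt 𝓘(ℝ, E) x).target)
    (v : TangentSpace 𝓘(ℝ, E) x) :
    riemHessian g f x v v = hessianInChart g f x (extChartAt 𝓘(ℝ, E) x x) v v := by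
  change E at v
  have ht := mem_extChartAt_target (I := 𝓘(ℝ, E)) x
  have ho := isOpen_extChartAt_target (I := 𝓘(ℝ, E)) x
  set u := extChartAt 𝓘(ℝ, E) x x with hu
  have hd : HasFDerivAt (metricInChart g x) (fderiv ℝ (metricInChart g x) u) u :=
    ((hg.contDiffAt (ho.mem_nhds ht)).differentiableAt (by norm_num)).hasFDerivAt
  -- the derivative of the metric is a symmetric form
  have hsymm : ∀ w y z : E, fderiv ℝ (metricInChart g x) u w y z =
      fderiv ℝ (metricInChart g x) u w z y := by
    intro w y z
    have h1 : HasFDerivAt (fun p => metricInChart g x p y z) _ u :=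
      (hd.clm_apply (hasFDerivAt_const y u)).clm_apply (hasFDerivAt_const z u)
    have h2 : HasFDerivAt (fun p => metricInChart g x p z y) _ u :=
      (hd.clm_apply (hasFDerivAt_const z u)).clm_apply (hasFDerivAt_const y u)
    have h3 : (fun p => metricInChart g x p y z) = fun p => metricInChart g x p z y :=
      funext fun p => metricInChart_symm g x p y z
    rw [h3] at h1
    have := congr($(h1.unique h2) w)
    simpa using this
  have hW := metricInChart_gradientInChart (g := g) (f := f) ht
  have hΓ : metricInChart g x u (christoffel g x u v v) = (1 / 2 : ℝ) •
      (fderiv ℝ (metricInChart g x) u v v + fderiv ℝ (metricInChart g x) u v v -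
        ((fderiv ℝ (metricInChart g x) u).flip v).flip v) := by
    obtain ⟨e, he⟩ := isInvertible_of_pos fun v hv => metricInChart_pos g ht hv
    rw [christoffel, ← he]
    simp
  have key : fderiv ℝ (f ∘ (extChartAt 𝓘(ℝ, E) x).symm) u (christoffel g x u v v) =
      fderiv ℝ (metricInChart g x) u v (gradientInChart g f x u) v -
        (1 / 2) * fderiv ℝ (metricInChart g x) u (gradientInChart g f x u) v v := by
    rw [← hW, metricInChart_symm, hΓ]
    simp only [_root_.add_apply, _root_.sub_apply, _root_.smul_apply, smul_eq_mul,
      ContinuousLinearMap.flip_apply]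
    rw [hsymm v (gradientInChart g f x u) v]
    ring
  rw [hessianInChart, chartHessian]
  simp only [_root_.sub_apply, _root_.smul_apply, smul_eq_mul, ContinuousLinearMap.flip_apply]
  rw [← key]
  rfl

variable {γ : ℝ → M} {a b : ℝ}

omit [T2Space M] in
theorem integral_speedSq_eq_of_chart {K : NNReal} (hab : a ≤ b)
    (hm : MapsTo γ (Icc a b) (extChartAt 𝓘(ℝ, E) x).source)
    (hc : LipschitzOnWith K (fun σ => extChartAt 𝓘(ℝ, E) x (γ σ)) (Icc a b)) :
    ∫ τ in a..b, speedSq g γ τ = ∫ τ in a..b, metricInChart g x (extChartAt 𝓘(ℝ, E) x (γ τ))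
      (deriv (fun σ => extChartAt 𝓘(ℝ, E) x (γ σ)) τ)
      (deriv (fun σ => extChartAt 𝓘(ℝ, E) x (γ σ)) τ) := by
  refine intervalIntegral.integral_congr_ae ?_
  filter_upwards [ae_hasDerivAt_chart hm hc, ae_Ioo_of_mem_uIoc hab] with τ h1 h2 h3
  have hτ := h2 h3
  exact speedSq_eq_of_hasDerivAt g (h1 hτ).1 (hm (Ioo_subset_Icc_self hτ)) (h1 hτ).2

omit [FiniteDimensional ℝ E] [T2Space M] [IsManifold 𝓘(ℝ, E) ∞ M] in
/-- A Lipschitz curve in the chart defines a chart-Lipschitz curve in the manifold. -/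
theorem isChartLipschitzOn_of_chart {c : ℝ → E} {K : NNReal} {s : Set ℝ}
    (hc : LipschitzOnWith K c s) (hm : MapsTo c s (extChartAt 𝓘(ℝ, E) x).target) :
    IsChartLipschitzOn (E := E) ((extChartAt 𝓘(ℝ, E) x).symm ∘ c) s := by
  refine fun τ hτ => ⟨x, K, s, self_mem_nhdsWithin, fun σ hσ =>
    (extChartAt 𝓘(ℝ, E) x).map_target (hm hσ), fun σ hσ σ' hσ' => ?_⟩
  simp only [Function.comp_apply, (extChartAt 𝓘(ℝ, E) x).right_inv (hm hσ),
    (extChartAt 𝓘(ℝ, E) x).right_inv (hm hσ')]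
  exact hc hσ hσ'

omit [T2Space M] in
/-- The squared distance of the endpoints is at most the energy of a Lipschitz curve in a chart. -/
theorem sq_riemDist_le_of_chart {c : ℝ → E} {K : NNReal} (hab : a < b)
    (hg : ∀ x, ContinuousOn (metricInChart g x) (extChartAt 𝓘(ℝ, E) x).target)
    (hc : LipschitzOnWith K c (Icc a b)) (hm : MapsTo c (Icc a b) (extChartAt 𝓘(ℝ, E) x).target) :
    (riemDist g ((extChartAt 𝓘(ℝ, E) x).symm (c a)) ((extChartAt 𝓘(ℝ, E) x).symm (c b))).toReal ^ 2 ≤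
      (b - a) * ∫ τ in a..b, metricInChart g x (c τ) (deriv c τ) (deriv c τ) := by
  have h := (isChartLipschitzOn_of_chart hc hm).sq_riemDist_le hab hg
  refine h.trans_eq ?_
  congr 1
  refine intervalIntegral.integral_congr_ae ?_
  filter_upwards [hc.ae_hasDerivAt, ae_Ioo_of_mem_uIoc hab.le] with τ h1 h2 h3
  have hτ := h2 h3
  have hI := Icc_mem_nhds hτ.1 hτ.2
  have hs := hm (Ioo_subset_Icc_self hτ)
  have hcont : ContinuousAt ((extChartAt 𝓘(ℝ, E) x).symm ∘ c) τ :=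
    (isChartLipschitzOn_of_chart hc hm).continuousOn.continuousAt hI
  have hd : HasDerivAt (fun σ => extChartAt 𝓘(ℝ, E) x (((extChartAt 𝓘(ℝ, E) x).symm ∘ c) σ))
      (deriv c τ) τ := by
    refine (h1 hτ).congr_of_eventuallyEq ?_
    filter_upwards [hI] with σ hσ using (extChartAt 𝓘(ℝ, E) x).right_inv (hm hσ)
  rw [speedSq_eq_of_hasDerivAt g hcont ((extChartAt 𝓘(ℝ, E) x).map_target hs) hd]
  simp only [Function.comp_apply, (extChartAt 𝓘(ℝ, E) x).right_inv hs]

theorem IsMetricGeodesic.integral_speedSq_le (h : IsMetricGeodesic (riemDist g) γ)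
    (hg : ∀ x, ContinuousOn (metricInChart g x) (extChartAt 𝓘(ℝ, E) x).target) (ha : 0 ≤ a)
    (hab : a ≤ b) (hb : b ≤ 1) :
    ∫ τ in a..b, speedSq g γ τ ≤ (b - a) * (riemDist g (γ 0) (γ 1)).toReal ^ 2 := by
  have hq : IntervalIntegrable (speedSq g γ) volume a b :=
    ((h.isChartLipschitzOn hg).mono (Icc_subset_Icc ha hb)).intervalIntegrable_form_velocity hab
      (β := metricForm g) hg
  have h1 : ∫ τ in a..b, speedSq g γ τ ≤
      ∫ τ in a..b, (riemDist g (γ 0) (γ 1)).toReal ^ 2 := by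
    rw [intervalIntegral.integral_of_le hab, intervalIntegral.integral_of_le hab]
    refine setIntegral_mono_on_ae hq.1 (intervalIntegrable_const (μ := volume)).1
      measurableSet_Ioc ?_
    filter_upwards [h.speedSq_le hg, ae_Ioo_of_mem_uIoc hab] with τ h1 h2 h3
    have h4 := h2 (by rwa [uIoc_of_le hab])
    exact h1 ⟨ha.trans_lt h4.1, h4.2.trans_le hb⟩
  rwa [intervalIntegral.integral_const, smul_eq_mul] at h1

/-- A metric geodesic that stays in the source of a chart is Lipschitz in this chart. -/
theorem IsMetricGeodesic.exists_lipschitzOnWith_Icc (h : IsMetricGeodesic (riemDist g) γ)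
    (hg : ContinuousOn (metricInChart g x) (extChartAt 𝓘(ℝ, E) x).target) (ha : 0 ≤ a) (hb : b ≤ 1)
    (hm : MapsTo γ (Icc a b) (extChartAt 𝓘(ℝ, E) x).source) :
    ∃ K, LipschitzOnWith K (fun σ => extChartAt 𝓘(ℝ, E) x (γ σ)) (Icc a b) := by
  refine LocallyLipschitzOn.exists_lipschitzOnWith_of_compact isCompact_Icc fun τ hτ => ?_
  have hsub := Icc_subset_Icc ha hb
  obtain ⟨K, U, hU, -, h1⟩ := h.exists_lipschitzOnWith hg (hsub hτ) (hm hτ)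
  exact ⟨K, U, nhdsWithin_mono τ hsub hU, h1⟩

/-- Along a metric geodesic inside a chart, the second differences of a function are those of a
function whose second derivative is the Hessian on the velocity. -/
theorem IsMetricGeodesic.secondDifference_eq (h : IsMetricGeodesic (riemDist g) γ)
    (hg : ∀ x, ContDiffOn ℝ ∞ (metricInChart g x) (extChartAt 𝓘(ℝ, E) x).target)
    (hf : ContDiffOn ℝ ∞ (f ∘ (extChartAt 𝓘(ℝ, E) x).symm) (extChartAt 𝓘(ℝ, E) x).target)
    {m η : ℝ} (hη : 0 < η) (h0 : 0 ≤ m - η) (h1 : m + η ≤ 1)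
    (hm : MapsTo γ (Icc (m - η) (m + η)) (extChartAt 𝓘(ℝ, E) x).source) :
    f (γ (m + η)) + f (γ (m - η)) - 2 * f (γ m) = ∫ τ in (m - η)..(m + η), (η - |τ - m|) *
      hessianInChart g f x (extChartAt 𝓘(ℝ, E) x (γ τ))
        (deriv (fun σ => extChartAt 𝓘(ℝ, E) x (γ σ)) τ)
        (deriv (fun σ => extChartAt 𝓘(ℝ, E) x (γ σ)) τ) := by
  set φ := extChartAt 𝓘(ℝ, E) x with hφ
  have hgc : ∀ x, ContinuousOn (metricInChart g x) (extChartAt 𝓘(ℝ, E) x).target :=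
    fun x => (hg x).continuousOn
  have hlt : m - η < m + η := by linarith
  obtain ⟨K, hK⟩ := h.exists_lipschitzOnWith_Icc (hgc x) h0 h1 hm
  have hcm : MapsTo (fun σ => φ (γ σ)) (Icc (m - η) (m + η)) φ.target :=
    fun σ hσ => φ.map_source (hm hσ)
  have hla : m - η ∈ Icc (m - η) (m + η) := left_mem_Icc.2 hlt.le
  have hrb : m + η ∈ Icc (m - η) (m + η) := right_mem_Icc.2 hlt.le
  have hmm : m ∈ Icc (m - η) (m + η) := ⟨by linarith, by linarith⟩
  have key := secondDifference_eq_of_minimizing (isOpen_extChartAt_target x)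
    ((hg x).of_le (by norm_cast)) (fun u _ => metricInChart_symm g x u)
    ((contDiffOn_gradientInChart (hg x) hf).of_le (by norm_cast))
    (F := f ∘ φ.symm) (fun u hu z => by rw [metricInChart_gradientInChart hu])
    (hf.of_le (by norm_cast)) hη hK hcm ?_
  · simp only [Function.comp_apply, ← hφ, φ.left_inv (hm hla), φ.left_inv (hm hrb),
      φ.left_inv (hm hmm)] at key
    exact key
  · intro c K' hc hct e0 e1
    have hsub := Icc_subset_Icc h0 h1
    rw [← integral_speedSq_eq_of_chart hlt.le hm hK]
    have h2 := h.integral_speedSq_le hgc h0 hlt.le h1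
    have h3 := sq_riemDist_le_of_chart hlt hgc hc hct
    rw [e0, e1, φ.left_inv (hm hla), φ.left_inv (hm hrb),
      h.toReal_riemDist (hsub hla) (hsub hrb), abs_sub_comm, abs_of_pos (sub_pos.2 hlt), mul_pow] at h3
    refine h2.trans (le_of_mul_le_mul_left ?_ (sub_pos.2 hlt))
    linarith [h3]

end Manifold

section Manifold

set_option maxSynthPendingDepth 3

variable {E : Type*} [NormedAddCommGroup E] [NormedSpace ℝ E] [FiniteDimensional ℝ E]
  {M : Type*} [TopologicalSpace M] [T2Space M] [ChartedSpace E M] [IsManifold 𝓘(ℝ, E) ∞ M]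
  {g : Bundle.RiemannianMetric (fun x : M => TangentSpace 𝓘(ℝ, E) x)} {x : M}

/-! ### Existence of short geodesics -/

omit [FiniteDimensional ℝ E] [T2Space M] in
theorem tendsto_riemDist_zero {ι : Type*} {l : Filter ι} {p : ι → M} {q : M}
    (hg : ContinuousOn (metricInChart g q) (extChartAt 𝓘(ℝ, E) q).target)
    (hp : Tendsto p l (𝓝 q)) : Tendsto (fun i => riemDist g (p i) q) l (𝓝 0) := by
  set φ := extChartAt 𝓘(ℝ, E) q with hφ
  have hq : q ∈ φ.source := mem_extChartAt_source q
  obtain ⟨r, hr, C, hC, hd⟩ := exists_riemDist_le_norm (φ.map_source hq) hg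
  have h1 : Tendsto (fun i => φ (p i)) l (𝓝 (φ q)) := (continuousAt_extChartAt q).tendsto.comp hp
  have h2 : Tendsto (fun i => ENNReal.ofReal (C * ‖φ q - φ (p i)‖)) l (𝓝 0) := by
    have h3 : Tendsto (fun i => C * ‖φ q - φ (p i)‖) l (𝓝 (C * ‖φ q - φ q‖)) :=
      ((tendsto_const_nhds.sub h1).norm).const_mul C
    rw [sub_self, norm_zero, mul_zero] at h3
    simpa using ENNReal.tendsto_ofReal h3
  refine tendsto_of_tendsto_of_tendsto_of_le_of_le' tendsto_const_nhds h2
    (Eventually.of_forall fun _ => zero_le) ?_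
  filter_upwards [h1 (Metric.closedBall_mem_nhds _ hr),
    hp ((isOpen_extChartAt_source (I := 𝓘(ℝ, E)) q).mem_nhds hq)] with i h3 h4
  have := hd _ h3 _ (Metric.mem_closedBall_self hr.le)
  rwa [φ.left_inv h4, φ.left_inv hq] at this

omit [FiniteDimensional ℝ E] [T2Space M] in
theorem continuousOn_toReal_riemDist {γ : ℝ → M} (hγ : ContinuousOn γ (Icc 0 1))
    (hg : ∀ x, ContinuousOn (metricInChart g x) (extChartAt 𝓘(ℝ, E) x).target) (p : M)
    (hfin : ∀ τ ∈ Icc (0 : ℝ) 1, riemDist g p (γ τ) ≠ ⊤) :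
    ContinuousOn (fun τ => (riemDist g p (γ τ)).toReal) (Icc 0 1) := by
  intro τ hτ
  rw [ContinuousWithinAt, tendsto_iff_dist_tendsto_zero]
  have h1 := tendsto_riemDist_zero (hg (γ τ)) (hγ τ hτ).tendsto
  have h2 := (ENNReal.tendsto_toReal ENNReal.zero_ne_top).comp h1
  rw [ENNReal.toReal_zero] at h2
  refine tendsto_of_tendsto_of_tendsto_of_le_of_le' tendsto_const_nhds h2
    (Eventually.of_forall fun _ => dist_nonneg) ?_
  filter_upwards [self_mem_nhdsWithin, h1 (Iio_mem_nhds ENNReal.zero_lt_top)] with σ hσ hlt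
  have h3 := ofReal_abs_sub_riemDist_le p (hfin τ hτ) (hfin σ hσ)
  rw [riemDist_comm g (γ τ)] at h3
  have h4 := ENNReal.toReal_mono (ne_of_lt hlt) h3
  rwa [ENNReal.toReal_ofReal (abs_nonneg _)] at h4

omit [FiniteDimensional ℝ E] [T2Space M] in
/-- Approximate geodesics: points on a path of almost minimal length whose distances to the starting
point are prescribed. -/
theorem exists_approximate_geodesic
    (hg : ∀ x, ContinuousOn (metricInChart g x) (extChartAt 𝓘(ℝ, E) x).target) {p q : M} {D ε : ℝ}
    (hD : riemDist g p q = ENNReal.ofReal D) (hD0 : 0 ≤ D) {γ : ℝ → M}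
    (h0 : γ 0 = p) (h1 : γ 1 = q) (hγ : ContMDiff 𝓘(ℝ, ℝ) 𝓘(ℝ, E) 1 γ)
    (hlen : ∫⁻ τ in Ioo (0 : ℝ) 1, ENNReal.ofReal (√(speedSq g γ τ)) < ENNReal.ofReal (D + ε))
    (hε : 0 < ε) :
    ∃ θ : ℝ → ℝ, θ 0 = 0 ∧ θ 1 = 1 ∧ MapsTo θ (Icc 0 1) (Icc 0 1) ∧
      ∀ σ ∈ Icc (0 : ℝ) 1, ∀ τ ∈ Icc (0 : ℝ) 1,
        riemDist g (γ (θ σ)) (γ (θ τ)) ≤ ENNReal.ofReal (|σ - τ| * D + ε) := by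
  have hpath : ∀ a b : ℝ, a ≤ b →
      riemDist g (γ a) (γ b) ≤ ∫⁻ τ in Ioo a b, ENNReal.ofReal (√(speedSq g γ τ)) :=
    fun a b hab => riemDist_le_lintegral g hab hγ.contMDiffOn
  have hfin : ∀ τ ∈ Icc (0 : ℝ) 1, riemDist g p (γ τ) ≠ ⊤ := by
    intro τ hτ
    rw [← h0]
    exact ne_top_of_le_ne_top (ne_top_of_lt hlen)
      ((hpath 0 τ hτ.1).trans (lintegral_mono_set (Ioo_subset_Ioo_right hτ.2)))
  have hcont := continuousOn_toReal_riemDist hγ.continuous.continuousOn hg p hfin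
  have hex : ∀ σ ∈ Icc (0 : ℝ) 1, ∃ θ ∈ Icc (0 : ℝ) 1,
      (riemDist g p (γ θ)).toReal = σ * D ∧ (σ = 0 → θ = 0) ∧ (σ = 1 → θ = 1) := by
    intro σ hσ
    rcases eq_or_ne σ 0 with rfl | hne0
    · exact ⟨0, by simp, by simp [h0, riemDist_self], fun _ => rfl, by simp⟩
    rcases eq_or_ne σ 1 with rfl | hne1
    · exact ⟨1, by simp, by rw [h1, hD, ENNReal.toReal_ofReal hD0, one_mul], by simp, fun _ => rfl⟩
    have hivt := intermediate_value_Icc zero_le_one hcont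
    simp only [h0, h1, riemDist_self, hD, ENNReal.toReal_ofReal hD0, ENNReal.toReal_zero] at hivt
    obtain ⟨θ, hθ, he⟩ := hivt (show σ * D ∈ Icc 0 D from
      ⟨mul_nonneg hσ.1 hD0, mul_le_of_le_one_left hD0 hσ.2⟩)
    exact ⟨θ, hθ, he, fun h => absurd h hne0, fun h => absurd h hne1⟩
  choose! θ hθm hθd hθ0 hθ1 using hex
  have hle : ∀ σ ∈ Icc (0 : ℝ) 1, ∀ τ ∈ Icc (0 : ℝ) 1, θ σ ≤ θ τ →
      riemDist g (γ (θ σ)) (γ (θ τ)) ≤ ENNReal.ofReal (|σ - τ| * D + ε) := by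
    intro σ hσ τ hτ hst
    -- the two outer pieces of the path use up at least `σ D` and `(1 - τ) D` of its length
    have e1 : ENNReal.ofReal (σ * D) ≤ ∫⁻ τ in Ioo 0 (θ σ), ENNReal.ofReal (√(speedSq g γ τ)) := by
      rw [← hθd σ hσ, ENNReal.ofReal_toReal (hfin _ (hθm σ hσ)), ← h0]
      exact hpath _ _ (hθm σ hσ).1
    have e2 := hpath _ _ hst
    have e3 := hpath _ _ (hθm τ hτ).2
    have e4 : ENNReal.ofReal ((1 - τ) * D) ≤ riemDist g (γ (θ τ)) (γ 1) := by
      have := riemDist_triangle g p (γ (θ τ)) (γ 1)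
      rw [h1, hD, ← ENNReal.ofReal_toReal (hfin _ (hθm τ hτ)), hθd τ hτ] at this
      rw [h1, show (1 - τ) * D = D - τ * D by ring,
        ENNReal.ofReal_sub _ (mul_nonneg hτ.1 hD0)]
      exact tsub_le_iff_left.2 this
    have hsum : (∫⁻ τ in Ioo 0 (θ σ), ENNReal.ofReal (√(speedSq g γ τ))) +
        (∫⁻ τ in Ioo (θ σ) (θ τ), ENNReal.ofReal (√(speedSq g γ τ))) +
        (∫⁻ τ in Ioo (θ τ) 1, ENNReal.ofReal (√(speedSq g γ τ))) ≤
        ∫⁻ τ in Ioo (0 : ℝ) 1, ENNReal.ofReal (√(speedSq g γ τ)) := by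
      have d1 : Disjoint (Ioo 0 (θ σ)) (Ioo (θ σ) (θ τ)) :=
        Set.disjoint_left.2 fun y hy hy' => lt_asymm hy.2 hy'.1
      have d2 : Disjoint (Ioo 0 (θ σ) ∪ Ioo (θ σ) (θ τ)) (Ioo (θ τ) 1) := by
        refine Set.disjoint_left.2 fun y hy hy' => ?_
        rcases hy with hy | hy
        · exact lt_asymm (hy.2.trans_le hst) hy'.1
        · exact lt_asymm hy.2 hy'.1
      rw [← lintegral_union measurableSet_Ioo d1, ← lintegral_union measurableSet_Ioo d2]
      refine lintegral_mono_set ?_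
      refine union_subset (union_subset ?_ ?_) ?_
      · exact Ioo_subset_Ioo_right (hθm σ hσ).2
      · exact Ioo_subset_Ioo (hθm σ hσ).1 (hθm τ hτ).2
      · exact Ioo_subset_Ioo_left (hθm τ hτ).1
    have htot : ENNReal.ofReal (σ * D) + riemDist g (γ (θ σ)) (γ (θ τ)) +
        ENNReal.ofReal ((1 - τ) * D) ≤ ENNReal.ofReal (D + ε) :=
      (add_le_add (add_le_add e1 e2) (e4.trans e3)).trans (hsum.trans hlen.le)
    have hne : riemDist g (γ (θ σ)) (γ (θ τ)) ≠ ⊤ := by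
      intro h
      rw [h] at htot
      simp at htot
    rw [← ENNReal.ofReal_toReal hne, ← ENNReal.ofReal_add (mul_nonneg hσ.1 hD0)
      ENNReal.toReal_nonneg, ← ENNReal.ofReal_add (add_nonneg (mul_nonneg hσ.1 hD0)
      ENNReal.toReal_nonneg) (mul_nonneg (sub_nonneg.2 hτ.2) hD0),
      ENNReal.ofReal_le_ofReal_iff (by positivity)] at htot
    rw [← ENNReal.ofReal_toReal hne]
    refine ENNReal.ofReal_le_ofReal ?_
    have habs : (τ - σ) * D ≤ |σ - τ| * D := by
      rw [abs_sub_comm]; gcongr; exact le_abs_self _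
    linarith
  refine ⟨θ, hθ0 0 (by simp) rfl, hθ1 1 (by simp) rfl, hθm, fun σ hσ τ hτ => ?_⟩
  rcases le_total (θ σ) (θ τ) with h | h
  · exact hle σ hσ τ hτ h
  · rw [riemDist_comm, abs_sub_comm]
    exact hle τ hτ σ hσ h

/-- Two points close to each other, compared to the size of a chart ball around the first one, are
joined by a geodesic. It is obtained as a pointwise limit of approximate geodesics along an
ultrafilter. -/
theorem MetricNearOn.exists_isMetricGeodesic {u₀ : E} {r δ μ : ℝ} {B : E →L[ℝ] E →L[ℝ] ℝ}
    (h : MetricNearOn g x u₀ r B δ) (hμ : 0 < μ) (hB : ∀ v, μ * ‖v‖ ^ 2 ≤ B v v)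
    (hδ : δ ≤ μ / 2) (hr : 0 < r)
    (hg : ∀ x, ContinuousOn (metricInChart g x) (extChartAt 𝓘(ℝ, E) x).target) {q : M}
    (hq : riemDist g ((extChartAt 𝓘(ℝ, E) x).symm u₀) q < ENNReal.ofReal (√(μ / 2) * r)) :
    ∃ γ : ℝ → M, IsMetricGeodesic (riemDist g) γ ∧ γ 0 = (extChartAt 𝓘(ℝ, E) x).symm u₀ ∧
      γ 1 = q ∧ ∀ τ ∈ Icc (0 : ℝ) 1, γ τ ∈ (extChartAt 𝓘(ℝ, E) x).source ∧
        extChartAt 𝓘(ℝ, E) x (γ τ) ∈ Metric.closedBall u₀ r := by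
  have := FiniteDimensional.proper ℝ E
  set φ := extChartAt 𝓘(ℝ, E) x with hφ
  set p := φ.symm u₀ with hp
  set D := (riemDist g p q).toReal with hD
  have hD0 : 0 ≤ D := ENNReal.toReal_nonneg
  have hDe : riemDist g p q = ENNReal.ofReal D := (ENNReal.ofReal_toReal (ne_top_of_lt hq)).symm
  set l := √(μ / 2) with hl
  have hl0 : 0 < l := by positivity
  have hDl : D < l * r := by
    rw [hDe] at hq
    exact (ENNReal.ofReal_lt_ofReal_iff (by positivity)).1 hq
  have hcoer : ∀ u ∈ Metric.closedBall u₀ r, ∀ w, (l * ‖w‖) ^ 2 ≤ metricInChart g x u w w := by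
    intro u hu w
    have h1 := abs_apply_sub_apply_le (h.norm_le u hu) w
    have h2 : δ * ‖w‖ ^ 2 ≤ μ / 2 * ‖w‖ ^ 2 := by gcongr
    rw [mul_pow, Real.sq_sqrt (by positivity)]
    linarith [(abs_le.1 h1).1, hB w]
  set Kset := φ.symm '' Metric.closedBall u₀ r with hK
  have hKc : IsCompact Kset := (isCompact_closedBall u₀ r).image_of_continuousOn
    ((continuousOn_extChartAt_symm x).mono h.subset)
  -- approximate geodesics inside the compact set
  have happ : ∀ n : ℕ, ∃ c : ℝ → M, c 0 = p ∧ c 1 = q ∧ (∀ σ ∈ Icc (0 : ℝ) 1, c σ ∈ Kset) ∧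
      ∀ σ ∈ Icc (0 : ℝ) 1, ∀ τ ∈ Icc (0 : ℝ) 1,
        riemDist g (c σ) (c τ) ≤ ENNReal.ofReal (|σ - τ| * D + 1 / ((n : ℝ) + 1)) := by
    intro n
    have hn : (0 : ℝ) < 1 / ((n : ℝ) + 1) := by positivity
    have hlt : riemDist g p q < min (ENNReal.ofReal (D + 1 / ((n : ℝ) + 1))) (ENNReal.ofReal (l * r)) := by
      rw [hDe]
      exact lt_min ((ENNReal.ofReal_lt_ofReal_iff (by positivity)).2 (by linarith))
        ((ENNReal.ofReal_lt_ofReal_iff (by positivity)).2 hDl)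
    obtain ⟨γ, h0, h1, hs, hlen⟩ := exists_path_of_riemDist_lt g hlt
    have hball := path_mem_ball_of_length_lt hl0 h.subset hcoer (Metric.mem_ball_self hr) hs h0
      (by rw [sub_self, norm_zero, sub_zero]; exact hlen.trans_le (min_le_right _ _))
    obtain ⟨θ, hθ0, hθ1, hθm, hθ⟩ := exists_approximate_geodesic hg hDe hD0 h0 h1 hs
      (hlen.trans_le (min_le_left _ _)) hn
    refine ⟨γ ∘ θ, by simp [hθ0, h0], by simp [hθ1, h1], fun σ hσ => ?_, hθ⟩
    obtain ⟨h2, h3⟩ := hball _ (hθm hσ)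
    exact ⟨φ (γ (θ σ)), Metric.ball_subset_closedBall h3, φ.left_inv h2⟩
  choose c hc0 hc1 hcK hcd using happ
  set U : Ultrafilter ℕ := hyperfilter ℕ with hU
  have hUtop : (U : Filter ℕ) ≤ atTop := by
    rw [← Nat.cofinite_eq_atTop]; exact hyperfilter_le_cofinite
  have hlim : ∀ σ ∈ Icc (0 : ℝ) 1, ∃ y ∈ Kset, Tendsto (fun n => c n σ) U (𝓝 y) := by
    intro σ hσ
    obtain ⟨y, hy, hle⟩ := hKc.ultrafilter_le_nhds' (U.map fun n => c n σ)
      (Ultrafilter.mem_map.2 (univ_mem' fun n => hcK n σ hσ))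
    exact ⟨y, hy, hle⟩
  have : Nonempty M := ⟨p⟩
  choose! γ hγK hγ using hlim
  have h0 : γ 0 = p := by
    have := hγ 0 (by simp)
    simp only [hc0] at this
    exact (tendsto_nhds_unique this tendsto_const_nhds)
  have h1 : γ 1 = q := by
    have := hγ 1 (by simp)
    simp only [hc1] at this
    exact (tendsto_nhds_unique this tendsto_const_nhds)
  have hle : ∀ σ ∈ Icc (0 : ℝ) 1, ∀ τ ∈ Icc (0 : ℝ) 1,
      riemDist g (γ σ) (γ τ) ≤ ENNReal.ofReal (|σ - τ| * D) := by
    intro σ hσ τ hτ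
    have t1 := tendsto_riemDist_zero (hg (γ σ)) (hγ σ hσ)
    have t2 := tendsto_riemDist_zero (hg (γ τ)) (hγ τ hτ)
    have t3 : Tendsto (fun n : ℕ => ENNReal.ofReal (|σ - τ| * D + 1 / ((n : ℝ) + 1))) U
        (𝓝 (ENNReal.ofReal (|σ - τ| * D + 0))) :=
      ENNReal.tendsto_ofReal
        ((tendsto_const_nhds.add tendsto_one_div_add_atTop_nhds_zero_nat).mono_left hUtop)
    have t4 := (t1.add t3).add t2
    rw [zero_add, add_zero, add_zero] at t4
    refine ge_of_tendsto t4 (Eventually.of_forall fun n => ?_)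
    calc riemDist g (γ σ) (γ τ)
        ≤ riemDist g (γ σ) (c n τ) + riemDist g (c n τ) (γ τ) := riemDist_triangle g _ _ _
      _ ≤ riemDist g (γ σ) (c n σ) + riemDist g (c n σ) (c n τ) + riemDist g (c n τ) (γ τ) := by
        gcongr; exact riemDist_triangle g _ _ _
      _ ≤ _ := by
        rw [riemDist_comm g (γ σ)]
        gcongr
        exact hcd n σ hσ τ hτ
  have hge : ∀ σ ∈ Icc (0 : ℝ) 1, ∀ τ ∈ Icc (0 : ℝ) 1, σ ≤ τ →
      ENNReal.ofReal (|σ - τ| * D) ≤ riemDist g (γ σ) (γ τ) := by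
    intro σ hσ τ hτ hst
    have e1 := hle 0 (by simp) σ hσ
    have e2 := hle τ hτ 1 (by simp)
    have hne : riemDist g (γ σ) (γ τ) ≠ ⊤ :=
      ne_top_of_le_ne_top ENNReal.ofReal_ne_top (hle σ hσ τ hτ)
    rw [h0, zero_sub, abs_neg, abs_of_nonneg hσ.1] at e1
    rw [h1, abs_sub_comm, abs_of_nonneg (sub_nonneg.2 hτ.2)] at e2
    have e3 : riemDist g p q ≤ ENNReal.ofReal (σ * D) + riemDist g (γ σ) (γ τ) +
        ENNReal.ofReal ((1 - τ) * D) :=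
      (riemDist_triangle g p (γ τ) q).trans (add_le_add
        ((riemDist_triangle g p (γ σ) (γ τ)).trans (add_le_add e1 le_rfl)) e2)
    rw [hDe, ← ENNReal.ofReal_toReal hne, ← ENNReal.ofReal_add (mul_nonneg hσ.1 hD0)
      ENNReal.toReal_nonneg, ← ENNReal.ofReal_add (add_nonneg (mul_nonneg hσ.1 hD0)
      ENNReal.toReal_nonneg) (mul_nonneg (sub_nonneg.2 hτ.2) hD0),
      ENNReal.ofReal_le_ofReal_iff (add_nonneg (add_nonneg (mul_nonneg hσ.1 hD0)
      ENNReal.toReal_nonneg) (mul_nonneg (sub_nonneg.2 hτ.2) hD0))] at e3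
    rw [← ENNReal.ofReal_toReal hne, abs_sub_comm, abs_of_nonneg (sub_nonneg.2 hst)]
    refine ENNReal.ofReal_le_ofReal ?_
    linarith
  refine ⟨γ, ⟨?_, fun σ hσ τ hτ => ?_⟩, h0, h1, fun τ hτ => ?_⟩
  · rw [h0, h1, hDe]; exact ENNReal.ofReal_ne_top
  · rw [h0, h1, hDe, ← ENNReal.ofReal_mul (abs_nonneg _)]
    refine le_antisymm (hle σ hσ τ hτ) ?_
    rcases le_total σ τ with hst | hst
    · exact hge σ hσ τ hτ hst
    · rw [riemDist_comm, abs_sub_comm]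
      exact hge τ hτ σ hσ hst
  · obtain ⟨u, hu, hu'⟩ := hγK τ hτ
    rw [← hu']
    exact ⟨φ.map_target (h.subset hu), by rwa [φ.right_inv (h.subset hu)]⟩

end Manifold

section TimeDependent

set_option maxSynthPendingDepth 3

variable {E : Type*} [NormedAddCommGroup E] [NormedSpace ℝ E]
  {X : Type*} [NormedAddCommGroup X] [NormedSpace ℝ X] {J : Set ℝ} {Ω : Set E} {f : ℝ × E → X}

/-! ### Functions depending smoothly on time and space -/

theorem Set.OrdConnected.uniqueDiffOn (hJ : J.OrdConnected) (hJleft : ∀ t ∈ J, ∃ s ∈ J, s < t) :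
    UniqueDiffOn ℝ J := by
  rcases J.eq_empty_or_nonempty with rfl | ⟨t, ht⟩
  · exact uniqueDiffOn_empty
  obtain ⟨s, hs, hst⟩ := hJleft t ht
  refine uniqueDiffOn_convex hJ.convex ⟨(s + t) / 2, ?_⟩
  refine mem_interior.2 ⟨Ioo s t, Ioo_subset_Icc_self.trans (hJ.out hs ht), isOpen_Ioo, ?_⟩
  constructor <;> linarith

theorem hasFDerivAt_partial_right (hΩ : IsOpen Ω) (hf : ContDiffOn ℝ ∞ f (J ×ˢ Ω)) {p : ℝ × E}
    (hp : p ∈ J ×ˢ Ω) : HasFDerivAt (fun u => f (p.1, u))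
      ((fderivWithin ℝ f (J ×ˢ Ω) p).comp (ContinuousLinearMap.inr ℝ ℝ E)) p.2 := by
  have h1 : HasFDerivWithinAt f (fderivWithin ℝ f (J ×ˢ Ω) p) (J ×ˢ Ω) (p.1, p.2) :=
    ((hf p hp).differentiableWithinAt (by norm_num)).hasFDerivWithinAt
  have h2 : HasFDerivWithinAt (fun u : E => (p.1, u)) (ContinuousLinearMap.inr ℝ ℝ E) Ω p.2 :=
    (hasFDerivAt_prodMk_right p.1 p.2).hasFDerivWithinAt
  exact (h1.comp p.2 h2 fun u hu => ⟨hp.1, hu⟩).hasFDerivAt (hΩ.mem_nhds hp.2)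

theorem hasDerivWithinAt_partial_left (hf : ContDiffOn ℝ ∞ f (J ×ˢ Ω)) {p : ℝ × E}
    (hp : p ∈ J ×ˢ Ω) : HasDerivWithinAt (fun s => f (s, p.2))
      (fderivWithin ℝ f (J ×ˢ Ω) p (1, 0)) J p.1 := by
  have h1 : HasFDerivWithinAt f (fderivWithin ℝ f (J ×ˢ Ω) p) (J ×ˢ Ω) (p.1, p.2) :=
    ((hf p hp).differentiableWithinAt (by norm_num)).hasFDerivWithinAt
  have h2 : HasDerivWithinAt (fun s : ℝ => (s, p.2)) ((1 : ℝ), (0 : E)) J p.1 :=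
    ((hasDerivAt_id p.1).prodMk (hasDerivAt_const p.1 p.2)).hasDerivWithinAt
  have h3 : MapsTo (fun s : ℝ => (s, p.2)) J (J ×ˢ Ω) := fun s hs => ⟨hs, hp.2⟩
  exact h1.comp_hasDerivWithinAt p.1 h2 h3

theorem contDiffOn_partial_right (hJ : UniqueDiffOn ℝ J) (hΩ : IsOpen Ω)
    (hf : ContDiffOn ℝ ∞ f (J ×ˢ Ω)) :
    ContDiffOn ℝ ∞ (fun p : ℝ × E => fderiv ℝ (fun u => f (p.1, u)) p.2) (J ×ˢ Ω) := by
  have h1 : ContDiffOn ℝ ∞ (fderivWithin ℝ f (J ×ˢ Ω)) (J ×ˢ Ω) :=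
    hf.fderivWithin (hJ.prod hΩ.uniqueDiffOn) (by norm_num)
  exact (h1.clm_comp contDiffOn_const).congr fun p hp => (hasFDerivAt_partial_right hΩ hf hp).fderiv

theorem contDiffOn_partial_left (hJ : UniqueDiffOn ℝ J) (hΩ : IsOpen Ω)
    (hf : ContDiffOn ℝ ∞ f (J ×ˢ Ω)) :
    ContDiffOn ℝ ∞ (fun p : ℝ × E => derivWithin (fun s => f (s, p.2)) J p.1) (J ×ˢ Ω) := by
  have h1 : ContDiffOn ℝ ∞ (fderivWithin ℝ f (J ×ˢ Ω)) (J ×ˢ Ω) :=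
    hf.fderivWithin (hJ.prod hΩ.uniqueDiffOn) (by norm_num)
  exact (h1.clm_apply contDiffOn_const).congr fun p hp =>
    (hasDerivWithinAt_partial_left hf hp).derivWithin (hJ p.1 hp.1)

theorem hasDerivWithinAt_time (hf : ContDiffOn ℝ ∞ f (J ×ˢ Ω)) {t : ℝ} (ht : t ∈ J) {u : E}
    (hu : u ∈ Ω) : HasDerivWithinAt (fun s => f (s, u)) (derivWithin (fun s => f (s, u)) J t) J t :=
  (hasDerivWithinAt_partial_left (p := (t, u)) hf ⟨ht, hu⟩).differentiableWithinAt.hasDerivWithinAt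

theorem contDiffOn_slice (hf : ContDiffOn ℝ ∞ f (J ×ˢ Ω)) {t : ℝ} (ht : t ∈ J) :
    ContDiffOn ℝ ∞ (fun u => f (t, u)) Ω :=
  hf.comp (contDiffOn_const.prodMk contDiffOn_id) fun _ hu => ⟨ht, hu⟩

omit [NormedSpace ℝ E] [NormedSpace ℝ X] in
theorem continuousOn_time {f : ℝ × E → X} (hf : ContinuousOn f (J ×ˢ Ω)) {u : E} (hu : u ∈ Ω) :
    ContinuousOn (fun s => f (s, u)) J :=
  hf.comp (by fun_prop) fun _ hs => ⟨hs, hu⟩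

omit [NormedSpace ℝ E] [NormedSpace ℝ X] in
theorem exists_Icc_ball_norm_sub_le (hJ : J.OrdConnected) (hJleft : ∀ t ∈ J, ∃ s ∈ J, s < t)
    (hΩ : IsOpen Ω) (hf : ContinuousOn f (J ×ˢ Ω)) {t : ℝ} (ht : t ∈ J) {u₀ : E} (hu₀ : u₀ ∈ Ω)
    {ε : ℝ} (hε : 0 < ε) : ∃ s₀ < t, Icc s₀ t ⊆ J ∧ ∃ r > 0, Metric.closedBall u₀ r ⊆ Ω ∧
      ∀ s ∈ Icc s₀ t, ∀ u ∈ Metric.closedBall u₀ r, ‖f (s, u) - f (t, u₀)‖ ≤ ε := by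
  have h1 : ∀ᶠ p in 𝓝[J ×ˢ Ω] (t, u₀), dist (f p) (f (t, u₀)) < ε :=
    (hf (t, u₀) ⟨ht, hu₀⟩).eventually (Metric.ball_mem_nhds _ hε)
  rw [nhdsWithin_prod_eq, hΩ.nhdsWithin_eq hu₀, eventually_iff, mem_prod_iff] at h1
  obtain ⟨A, hA, B, hB, hAB⟩ := h1
  obtain ⟨r, hr, hrB⟩ := Metric.nhds_basis_closedBall.mem_iff.1 (inter_mem hB (hΩ.mem_nhds hu₀))
  obtain ⟨e, he, heA⟩ := Metric.mem_nhdsWithin_iff.1 hA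
  obtain ⟨s₁, hs₁, hst⟩ := hJleft t ht
  have hsub : Icc (max s₁ (t - e / 2)) t ⊆ J := (Icc_subset_Icc_left (le_max_left _ _)).trans
    (hJ.out hs₁ ht)
  refine ⟨max s₁ (t - e / 2), max_lt hst (by linarith), hsub, r, hr, fun u hu => (hrB hu).2,
    fun s hs u hu => ?_⟩
  have hsA : s ∈ A := by
    refine heA ⟨?_, hsub hs⟩
    rw [Metric.mem_ball, Real.dist_eq, abs_lt]
    constructor <;> linarith [(le_max_right s₁ (t - e / 2)).trans hs.1, hs.2]
  have : dist (f (s, u)) (f (t, u₀)) < ε := hAB (mk_mem_prod hsA (hrB hu).1)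
  rw [← dist_eq_norm]
  exact this.le

/-- The difference quotients in time converge locally uniformly in space. -/
theorem exists_Icc_ball_quotient_sub_le (hJ : J.OrdConnected) (hJleft : ∀ t ∈ J, ∃ s ∈ J, s < t)
    (hΩ : IsOpen Ω) (hf : ContDiffOn ℝ ∞ f (J ×ˢ Ω)) {t : ℝ} (ht : t ∈ J) {u₀ : E} (hu₀ : u₀ ∈ Ω)
    {ε : ℝ} (hε : 0 < ε) : ∃ s₀ < t, Icc s₀ t ⊆ J ∧ ∃ r > 0, Metric.closedBall u₀ r ⊆ Ω ∧
      ∀ s ∈ Icc s₀ t, ∀ u ∈ Metric.closedBall u₀ r,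
        ‖f (t, u) - f (s, u) - (t - s) • derivWithin (fun s => f (s, u₀)) J t‖ ≤ ε * (t - s) := by
  have hJu := hJ.uniqueDiffOn hJleft
  obtain ⟨s₀, hs₀, hsub, r, hr, hrΩ, h⟩ := exists_Icc_ball_norm_sub_le hJ hJleft hΩ
    (contDiffOn_partial_left hJu hΩ hf).continuousOn ht hu₀ hε
  refine ⟨s₀, hs₀, hsub, r, hr, hrΩ, fun s hs u hu => ?_⟩
  set d := derivWithin (fun s => f (s, u₀)) J t with hd
  have hder : ∀ y ∈ Icc s₀ t, HasDerivWithinAt (fun s => f (s, u) - s • d)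
      (derivWithin (fun s => f (s, u)) J y - d) (Icc s₀ t) y := by
    intro y hy
    have h1 := (hasDerivWithinAt_time hf (hsub hy) (hrΩ hu)).mono hsub
    have h2 : HasDerivWithinAt (fun s : ℝ => s • d) ((1 : ℝ) • d) (Icc s₀ t) y :=
      ((hasDerivAt_id y).smul_const d).hasDerivWithinAt
    rw [one_smul] at h2
    exact h1.sub h2
  have := (convex_Icc s₀ t).norm_image_sub_le_of_norm_hasDerivWithin_le hder
    (fun y hy => h y hy u hu) hs (right_mem_Icc.2 hs₀.le)
  rw [Real.norm_eq_abs, abs_of_nonneg (sub_nonneg.2 hs.2)] at this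
  refine le_trans (le_of_eq ?_) this
  congr 1
  rw [sub_smul]
  abel

end TimeDependent

section Manifold

set_option maxSynthPendingDepth 3

variable {E : Type*} [NormedAddCommGroup E] [NormedSpace ℝ E] [FiniteDimensional ℝ E]
  {M : Type*} [TopologicalSpace M] [ChartedSpace E M] [IsManifold 𝓘(ℝ, E) ∞ M]
  {J : Set ℝ} {g : ℝ → Bundle.RiemannianMetric (fun x : M => TangentSpace 𝓘(ℝ, E) x)}
  {V : ℝ → M → ℝ}

/-! ### Smooth families of metrics in charts -/

omit [FiniteDimensional ℝ E] in
theorem IsSmoothMetricFamily.contDiffOn (hg : IsSmoothMetricFamily J g) (x : M) :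
    ContDiffOn ℝ ∞ (fun p : ℝ × E => metricInChart (g p.1) x p.2)
      (J ×ˢ (extChartAt 𝓘(ℝ, E) x).target) := by
  rw [← contMDiffOn_iff_contDiffOn, modelWithCornersSelf_prod, ← chartedSpaceSelf_prod]
  set φ := extChartAt 𝓘(ℝ, E) x with hφ
  have h1 : ContMDiffOn (𝓘(ℝ, ℝ).prod 𝓘(ℝ, E)) (𝓘(ℝ, ℝ).prod 𝓘(ℝ, E)) ∞
      (fun p : ℝ × E => (p.1, φ.symm p.2)) (J ×ˢ φ.target) :=
    contMDiffOn_fst.prodMk ((contMDiffOn_extChartAt_symm x).comp contMDiffOn_snd fun p hp => hp.2)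
  have h2 := ContMDiffOn.comp hg h1 fun p hp => ⟨hp.1, mem_univ _⟩
  have hsrc : ∀ p ∈ J ×ˢ φ.target, φ.symm p.2 ∈ (chartAt E x).source := fun p hp => by
    have := φ.map_target hp.2
    rwa [hφ, extChartAt_source] at this
  have hbase : ∀ p ∈ J ×ˢ φ.target, φ.symm p.2 ∈
      (trivializationAt E (TangentSpace 𝓘(ℝ, E)) x).baseSet := fun p hp => by
    rw [TangentBundle.trivializationAt_baseSet]; exact hsrc p hp
  have h3 := ((trivializationAt (E →L[ℝ] E →L[ℝ] ℝ)
    (fun x : M => TangentSpace 𝓘(ℝ, E) x →L[ℝ] TangentSpace 𝓘(ℝ, E) x →L[ℝ] ℝ)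
    x).contMDiffOn_iff (fun p hp => by
      rw [Bundle.Trivialization.mem_source, hom_trivializationAt_baseSet,
        hom_trivializationAt_baseSet]
      exact ⟨hbase p hp, hbase p hp, mem_univ _⟩)).1 h2
  refine h3.2.congr fun p hp => ?_
  ext v w
  have hA : (trivializationAt E (TangentSpace 𝓘(ℝ, E)) x).symmL ℝ (φ.symm p.2) = chartFrame x p.2 := by
    rw [TangentBundle.symmL_trivializationAt (hsrc p hp), ModelWithCorners.range_eq_univ,
      mfderivWithin_univ, ← hφ, φ.right_inv hp.2]
    rfl
  have h4 := inCoordinates_apply_eq₂ (E₃ := fun _ : M => ℝ) (F₃ := ℝ)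
    (ϕ := (g p.1).inner (φ.symm p.2)) (v := v) (w := w) (x₀ := x) (hbase p hp) (hbase p hp)
    (mem_univ _)
  refine Eq.trans ?_ h4.symm
  have hv : ∀ v : E, (trivializationAt E (TangentSpace 𝓘(ℝ, E)) x).symm (φ.symm p.2) v =
      chartFrame x p.2 v := fun v =>
    (Bundle.Trivialization.symmL_apply _ (hbase p hp) v).symm.trans
      (congrArg (fun L : E →L[ℝ] E => L v) hA)
  rw [hv v, hv w, Bundle.Trivialization.linearMapAt_apply]
  exact (if_pos (mem_univ _)).symm

omit [FiniteDimensional ℝ E] in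
theorem contDiffOn_family_comp_chart (hV : ContMDiffOn (𝓘(ℝ, ℝ).prod 𝓘(ℝ, E)) 𝓘(ℝ, ℝ) ∞
    (fun p : ℝ × M => V p.1 p.2) (J ×ˢ univ)) (x : M) :
    ContDiffOn ℝ ∞ (fun p : ℝ × E => V p.1 ((extChartAt 𝓘(ℝ, E) x).symm p.2))
      (J ×ˢ (extChartAt 𝓘(ℝ, E) x).target) := by
  rw [← contMDiffOn_iff_contDiffOn, modelWithCornersSelf_prod, ← chartedSpaceSelf_prod]
  have h1 : ContMDiffOn (𝓘(ℝ, ℝ).prod 𝓘(ℝ, E)) (𝓘(ℝ, ℝ).prod 𝓘(ℝ, E)) ∞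
      (fun p : ℝ × E => (p.1, (extChartAt 𝓘(ℝ, E) x).symm p.2))
      (J ×ˢ (extChartAt 𝓘(ℝ, E) x).target) :=
    contMDiffOn_fst.prodMk ((contMDiffOn_extChartAt_symm x).comp contMDiffOn_snd fun p hp => hp.2)
  exact ContMDiffOn.comp hV h1 fun p hp => ⟨hp.1, mem_univ _⟩

/-- The time derivative `∂ₜ g` of a family of metrics at time `t`, as a field of bilinear forms. -/
def timeDerivForm (J : Set ℝ) (g : ℝ → Bundle.RiemannianMetric (fun x : M => TangentSpace 𝓘(ℝ, E) x))
    (t : ℝ) (y : M) : E →L[ℝ] E →L[ℝ] ℝ :=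
  derivWithin (fun s => metricForm (g s) y) J t

omit [FiniteDimensional ℝ E] in
theorem metricInChart_self_eq_metricForm (g : Bundle.RiemannianMetric
    (fun x : M => TangentSpace 𝓘(ℝ, E) x)) (x : M) :
    metricInChart g x (extChartAt 𝓘(ℝ, E) x x) = metricForm g x := by
  ext v w
  exact metricInChart_self g x v w

omit [FiniteDimensional ℝ E] in
theorem IsSmoothMetricFamily.hasDerivWithinAt_metricForm (hg : IsSmoothMetricFamily J g) {t : ℝ}
    (ht : t ∈ J) (y : M) :
    HasDerivWithinAt (fun s => metricForm (g s) y) (timeDerivForm J g t y) J t := by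
  have := hasDerivWithinAt_time (hg.contDiffOn y) ht (mem_extChartAt_target (I := 𝓘(ℝ, E)) y)
  simp only [metricInChart_self_eq_metricForm] at this
  exact this

omit [FiniteDimensional ℝ E] in
theorem IsSmoothMetricFamily.formInChart_timeDerivForm (hg : IsSmoothMetricFamily J g)
    (hJ : UniqueDiffOn ℝ J) {t : ℝ} (ht : t ∈ J) {x : M} {u : E}
    (hu : u ∈ (extChartAt 𝓘(ℝ, E) x).target) :
    formInChart (timeDerivForm J g t) x u = derivWithin (fun s => metricInChart (g s) x u) J t := by
  ext v w
  have h1 := ((hasDerivWithinAt_time (hg.contDiffOn x) ht hu).clm_apply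
    (hasDerivWithinAt_const t J v)).clm_apply (hasDerivWithinAt_const t J w)
  have h2 := ((hg.hasDerivWithinAt_metricForm ht ((extChartAt 𝓘(ℝ, E) x).symm u)).clm_apply
    (hasDerivWithinAt_const t J (chartFrame x u v))).clm_apply
    (hasDerivWithinAt_const t J (chartFrame x u w))
  have h3 := (hJ t ht).eq_deriv _ h1 h2
  simp only [map_zero, add_zero] at h3
  exact h3.symm

omit [FiniteDimensional ℝ E] in
theorem IsSmoothMetricFamily.continuousOn_formInChart_timeDerivForm (hg : IsSmoothMetricFamily J g)
    (hJ : UniqueDiffOn ℝ J) {t : ℝ} (ht : t ∈ J) (x : M) :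
    ContinuousOn (formInChart (timeDerivForm J g t) x) (extChartAt 𝓘(ℝ, E) x).target := by
  have h1 := contDiffOn_slice (contDiffOn_partial_left hJ
    (isOpen_extChartAt_target (I := 𝓘(ℝ, E)) x) (hg.contDiffOn x)) ht
  exact h1.continuousOn.congr fun u hu => hg.formInChart_timeDerivForm hJ ht hu

omit [FiniteDimensional ℝ E] in
theorem IsSmoothMetricFamily.derivWithin_inner (hg : IsSmoothMetricFamily J g)
    (hJ : UniqueDiffOn ℝ J) {t : ℝ} (ht : t ∈ J) (x : M) (v : TangentSpace 𝓘(ℝ, E) x) :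
    derivWithin (fun s => (g s).inner x v v) J t =
      derivWithin (fun s => metricInChart (g s) x (extChartAt 𝓘(ℝ, E) x x)) J t v v := by
  change E at v
  have h1 := ((hasDerivWithinAt_time (hg.contDiffOn x) ht
    (mem_extChartAt_target (I := 𝓘(ℝ, E)) x)).clm_apply
    (hasDerivWithinAt_const t J v)).clm_apply (hasDerivWithinAt_const t J v)
  have h2 := h1.derivWithin (hJ t ht)
  simp only [map_zero, add_zero] at h2
  refine Eq.trans ?_ h2
  congr 1
  ext s
  exact (metricInChart_self (g s) x v v).symm

omit [FiniteDimensional ℝ E] in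
theorem IsSmoothMetricFamily.continuousOn_derivWithin_inner (hg : IsSmoothMetricFamily J g)
    (hJ : UniqueDiffOn ℝ J) (x : M) (v : TangentSpace 𝓘(ℝ, E) x) :
    ContinuousOn (fun t => derivWithin (fun s => (g s).inner x v v) J t) J := by
  have h1 := continuousOn_time (contDiffOn_partial_left hJ
    (isOpen_extChartAt_target (I := 𝓘(ℝ, E)) x) (hg.contDiffOn x)).continuousOn
    (mem_extChartAt_target (I := 𝓘(ℝ, E)) x)
  change E at v
  have h2 := (h1.clm_apply (continuousOn_const (c := v))).clm_apply (continuousOn_const (c := v))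
  exact h2.congr fun t ht => hg.derivWithin_inner hJ ht x v

/-- The Hessian depends continuously on time. -/
theorem IsSmoothMetricFamily.continuousOn_riemHessian (hg : IsSmoothMetricFamily J g)
    (hJ : UniqueDiffOn ℝ J) (hV : ContMDiffOn (𝓘(ℝ, ℝ).prod 𝓘(ℝ, E)) 𝓘(ℝ, ℝ) ∞
      (fun p : ℝ × M => V p.1 p.2) (J ×ˢ univ)) (x : M) (v : TangentSpace 𝓘(ℝ, E) x) :
    ContinuousOn (fun t => riemHessian (g t) (V t) x v v) J := by
  have := FiniteDimensional.complete ℝ E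
  have ho := isOpen_extChartAt_target (I := 𝓘(ℝ, E)) x
  set φ := extChartAt 𝓘(ℝ, E) x with hφ
  set u := φ x with hu
  have hut : u ∈ φ.target := mem_extChartAt_target x
  have hG := hg.contDiffOn x
  have hF := contDiffOn_family_comp_chart hV x
  have hDF := contDiffOn_partial_right hJ ho hF
  have cG := continuousOn_time hG.continuousOn hut
  have cDG := continuousOn_time (contDiffOn_partial_right hJ ho hG).continuousOn hut
  have cDF := continuousOn_time hDF.continuousOn hut
  have cDDF := continuousOn_time (contDiffOn_partial_right hJ ho hDF).continuousOn hut
  have cW : ContinuousOn (fun t => gradientInChart (g t) (V t) x u) J := by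
    intro t ht
    obtain ⟨e, he⟩ := isInvertible_of_pos fun v hv => metricInChart_pos (g t) hut hv
    have h1 : ContinuousAt ContinuousLinearMap.inverse (metricInChart (g t) x u) := by
      rw [← he]; exact (contDiffAt_map_inverse (n := 0) e).continuousAt
    exact (ContinuousAt.comp_continuousWithinAt (f := fun t => metricInChart (g t) x u) h1
      (cG t ht)).clm_apply (cDF t ht)
  change E at v
  have c1 : ContinuousOn (fun t => fderiv ℝ (fderiv ℝ (V t ∘ φ.symm)) u v v) J :=
    (cDDF.clm_apply (continuousOn_const (c := v))).clm_apply (continuousOn_const (c := v))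
  have c2 : ContinuousOn (fun t => fderiv ℝ (metricInChart (g t) x) u v
      (gradientInChart (g t) (V t) x u) v) J :=
    ((cDG.clm_apply (continuousOn_const (c := v))).clm_apply cW).clm_apply
      (continuousOn_const (c := v))
  have c3 : ContinuousOn (fun t => fderiv ℝ (metricInChart (g t) x) u
      (gradientInChart (g t) (V t) x u) v v) J :=
    ((cDG.clm_apply cW).clm_apply (continuousOn_const (c := v))).clm_apply
      (continuousOn_const (c := v))
  have c4 := c1.sub (c2.sub (c3.const_mul (1 / 2 : ℝ)))
  refine c4.congr fun t ht => ?_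
  have hGt : ContDiffOn ℝ ∞ (metricInChart (g t) x) φ.target := contDiffOn_slice hG ht
  have e := riemHessian_eq_hessianInChart (f := V t) hGt v
  simp only [hessianInChart, chartHessian, _root_.sub_apply, _root_.smul_apply,
    ContinuousLinearMap.flip_apply, smul_eq_mul] at e
  exact e

end Manifold

section Extended

/-! ### Slopes and difference quotients as extended real numbers -/

theorem lowerSlopeAtZero_le {u a : ℝ → ℝ} {p : ℝ} (ha : Tendsto a (𝓝[>] 0) (𝓝 p))
    (h : ∀ τ ∈ Ioo (0 : ℝ) 1, (u τ - u 0) / τ ≤ a τ) : lowerSlopeAtZero u ≤ (p : EReal) := by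
  have h1 : Tendsto (fun τ => (a τ : EReal)) (𝓝[>] 0) (𝓝 (p : EReal)) :=
    (continuous_coe_real_ereal.tendsto p).comp ha
  rw [← h1.liminf_eq]
  refine liminf_le_liminf ?_
  filter_upwards [Ioo_mem_nhdsGT (zero_lt_one' ℝ)] with τ hτ
  exact EReal.coe_le_coe_iff.2 (h τ hτ)

theorem le_lowerSlopeAtZero {u a : ℝ → ℝ} {p : ℝ} (ha : Tendsto a (𝓝[>] 0) (𝓝 p))
    (h : ∀ τ ∈ Ioo (0 : ℝ) 1, a τ ≤ (u τ - u 0) / τ) : (p : EReal) ≤ lowerSlopeAtZero u := by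
  have h1 : Tendsto (fun τ => (a τ : EReal)) (𝓝[>] 0) (𝓝 (p : EReal)) :=
    (continuous_coe_real_ereal.tendsto p).comp ha
  rw [← h1.liminf_eq]
  refine liminf_le_liminf ?_
  filter_upwards [Ioo_mem_nhdsGT (zero_lt_one' ℝ)] with τ hτ
  exact EReal.coe_le_coe_iff.2 (h τ hτ)

theorem upperSlopeAtOne_le {u b : ℝ → ℝ} {q : ℝ} (hb : Tendsto b (𝓝[<] 1) (𝓝 q))
    (h : ∀ τ ∈ Ioo (0 : ℝ) 1, (u 1 - u τ) / (1 - τ) ≤ b τ) : upperSlopeAtOne u ≤ (q : EReal) := by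
  have h1 : Tendsto (fun τ => (b τ : EReal)) (𝓝[<] 1) (𝓝 (q : EReal)) :=
    (continuous_coe_real_ereal.tendsto q).comp hb
  rw [← h1.limsup_eq]
  refine limsup_le_limsup ?_
  filter_upwards [Ioo_mem_nhdsLT (zero_lt_one' ℝ)] with τ hτ
  exact EReal.coe_le_coe_iff.2 (h τ hτ)

theorem le_upperSlopeAtOne {u b : ℝ → ℝ} {q : ℝ} (hb : Tendsto b (𝓝[<] 1) (𝓝 q))
    (h : ∀ τ ∈ Ioo (0 : ℝ) 1, b τ ≤ (u 1 - u τ) / (1 - τ)) : (q : EReal) ≤ upperSlopeAtOne u := by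
  have h1 : Tendsto (fun τ => (b τ : EReal)) (𝓝[<] 1) (𝓝 (q : EReal)) :=
    (continuous_coe_real_ereal.tendsto q).comp hb
  rw [← h1.limsup_eq]
  refine limsup_le_limsup ?_
  filter_upwards [Ioo_mem_nhdsLT (zero_lt_one' ℝ)] with τ hτ
  exact EReal.coe_le_coe_iff.2 (h τ hτ)

theorem sq_sub_sq_div_eq_coe {a b : ℝ≥0∞} (ha : a ≠ ⊤) (hb : b ≠ ⊤) (c : ℝ) :
    (((a ^ 2 : ℝ≥0∞) : EReal) - ((b ^ 2 : ℝ≥0∞) : EReal)) / (c : EReal) =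
      (((a.toReal ^ 2 - b.toReal ^ 2) / c : ℝ) : EReal) := by
  have h : ∀ {a : ℝ≥0∞}, a ≠ ⊤ → ((a ^ 2 : ℝ≥0∞) : EReal) = ((a.toReal ^ 2 : ℝ) : EReal) := by
    intro a ha
    lift a to NNReal using ha
    rw [← ENNReal.coe_pow, EReal.coe_nnreal_eq_coe_real, ENNReal.coe_toReal, NNReal.coe_pow]
  rw [h ha, h hb, ← EReal.coe_sub, ← EReal.coe_div]

theorem neg_half_mul_le {L : EReal} {I : ℝ} (h : (I : EReal) ≤ L) :
    ((-(1 / 2) : ℝ) : EReal) * L ≤ ((-(1 / 2) * I : ℝ) : EReal) := by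
  rw [EReal.coe_neg, EReal.neg_mul, neg_mul, EReal.coe_neg, EReal.neg_le_neg_iff, EReal.coe_mul]
  gcongr

theorem le_neg_half_mul {L : EReal} {I : ℝ} (h : L ≤ (I : EReal)) :
    ((-(1 / 2) * I : ℝ) : EReal) ≤ ((-(1 / 2) : ℝ) : EReal) * L := by
  rw [EReal.coe_neg, EReal.neg_mul, neg_mul, EReal.coe_neg, EReal.neg_le_neg_iff, EReal.coe_mul]
  gcongr

end Extended

section Manifold

set_option maxSynthPendingDepth 3

variable {E : Type*} [NormedAddCommGroup E] [NormedSpace ℝ E] [FiniteDimensional ℝ E]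
  {M : Type*} [TopologicalSpace M] [T2Space M] [ChartedSpace E M] [IsManifold 𝓘(ℝ, E) ∞ M]

/-! ### From the Hessian bound to dynamic convexity -/

omit [FiniteDimensional ℝ E] [T2Space M] [IsManifold 𝓘(ℝ, E) ∞ M] in
theorem IsChartLipschitzOn.exists_lipschitzOnWith_comp {γ : ℝ → M} {a b : ℝ}
    (h : IsChartLipschitzOn (E := E) γ (Icc a b)) {f : M → ℝ}
    (hf : ∀ x, ContDiffOn ℝ ∞ (f ∘ (extChartAt 𝓘(ℝ, E) x).symm) (extChartAt 𝓘(ℝ, E) x).target) :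
    ∃ K, LipschitzOnWith K (fun τ => f (γ τ)) (Icc a b) := by
  refine LocallyLipschitzOn.exists_lipschitzOnWith_of_compact isCompact_Icc fun τ hτ => ?_
  obtain ⟨x, K, U, hU, hm, hc⟩ := h τ hτ
  have hτU := mem_of_mem_nhdsWithin hτ hU
  have h1 : LocallyLipschitzOn U ((f ∘ (extChartAt 𝓘(ℝ, E) x).symm) ∘
      fun σ => extChartAt 𝓘(ℝ, E) x (γ σ)) :=
    LocallyLipschitzOn.contDiffOn_comp (fun σ _ => ⟨K, U, self_mem_nhdsWithin, hc⟩)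
      (isOpen_extChartAt_target x) ((hf x).of_le (by norm_cast))
      fun σ hσ => (extChartAt 𝓘(ℝ, E) x).map_source (hm hσ)
  obtain ⟨K', U', hU', h2⟩ := h1 hτU
  refine ⟨K', U ∩ U', inter_mem hU ?_, fun σ hσ σ' hσ' => ?_⟩
  · exact nhdsWithin_le_of_mem hU hU'
  · have := h2 hσ.2 hσ'.2
    simpa only [Function.comp_apply, (extChartAt 𝓘(ℝ, E) x).left_inv (hm hσ.1),
      (extChartAt 𝓘(ℝ, E) x).left_inv (hm hσ'.1)] using this

omit [FiniteDimensional ℝ E] [T2Space M] in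
theorem formInChart_self (β : M → E →L[ℝ] E →L[ℝ] ℝ) (x : M) :
    formInChart β x (extChartAt 𝓘(ℝ, E) x x) = β x := by
  ext v w
  rw [formInChart, chartFrame_self, extChartAt_to_inv]
  rfl

/-- A lower bound of the Hessian of `f` by a field of forms bounds the second differences of `f`
along geodesics from below. -/
theorem IsMetricGeodesic.le_secondDifference
    {g : Bundle.RiemannianMetric (fun x : M => TangentSpace 𝓘(ℝ, E) x)} {γ : ℝ → M}
    (h : IsMetricGeodesic (riemDist g) γ)
    (hg : ∀ x, ContDiffOn ℝ ∞ (metricInChart g x) (extChartAt 𝓘(ℝ, E) x).target) {f : M → ℝ}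
    (hf : ∀ x, ContDiffOn ℝ ∞ (f ∘ (extChartAt 𝓘(ℝ, E) x).symm) (extChartAt 𝓘(ℝ, E) x).target)
    {β : M → E →L[ℝ] E →L[ℝ] ℝ}
    (hβ : ∀ x, ContinuousOn (formInChart β x) (extChartAt 𝓘(ℝ, E) x).target)
    (hle : ∀ (x : M) (v : E), β x v v ≤ hessianInChart g f x (extChartAt 𝓘(ℝ, E) x x) v v)
    {m : ℝ} (hm : m ∈ Ioo (0 : ℝ) 1) {ε : ℝ} (hε : 0 < ε) :
    ∀ᶠ η in 𝓝[>] (0 : ℝ), (∫ τ in (m - η)..(m + η), (η - |τ - m|) *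
      β (γ τ) (velocity γ τ) (velocity γ τ)) - ε * η ^ 2 ≤
        f (γ (m + η)) + f (γ (m - η)) - 2 * f (γ m) := by
  have hgc : ∀ x, ContinuousOn (metricInChart g x) (extChartAt 𝓘(ℝ, E) x).target :=
    fun x => (hg x).continuousOn
  set x := γ m with hx
  set φ := extChartAt 𝓘(ℝ, E) x with hφ
  have hxs : γ m ∈ φ.source := mem_extChartAt_source x
  have hut : φ x ∈ φ.target := φ.map_source hxs
  have hnt : φ.target ∈ 𝓝 (φ x) := (isOpen_extChartAt_target (I := 𝓘(ℝ, E)) x).mem_nhds hut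
  set H := hessianInChart g f x with hH
  have hHc : ContinuousOn H φ.target := continuousOn_hessianInChart (hg x) (hf x)
  have hI : Icc (0 : ℝ) 1 ∈ 𝓝 m := Icc_mem_nhds hm.1 hm.2
  obtain ⟨K, U, hU, hUm, hUc⟩ := h.exists_lipschitzOnWith (hgc x) (Ioo_subset_Icc_self hm) hxs
  rw [nhdsWithin_eq_nhds.2 hI] at hU
  have hγm : ContinuousAt (fun σ => φ (γ σ)) m :=
    (hUc.continuousOn m (mem_of_mem_nhds hU)).continuousAt hU
  set ε₁ := ε / (4 * ((K : ℝ) ^ 2 + 1)) with hε₁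
  have hε₁0 : 0 < ε₁ := by positivity
  have hn1 : ∀ᶠ u in 𝓝 (φ x), dist (H u) (H (φ x)) < ε₁ :=
    (hHc.continuousAt hnt).eventually (Metric.ball_mem_nhds _ hε₁0)
  have hn2 : ∀ᶠ u in 𝓝 (φ x), dist (formInChart β x u) (formInChart β x (φ x)) < ε₁ :=
    ((hβ x).continuousAt hnt).eventually (Metric.ball_mem_nhds _ hε₁0)
  have hS := inter_mem (inter_mem hU hI) (hγm.eventually (hn1.and hn2))
  obtain ⟨η₀, hη₀, hsub⟩ := Metric.nhds_basis_closedBall.mem_iff.1 hS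
  filter_upwards [Ioo_mem_nhdsGT hη₀] with η hη
  have hη0 : 0 < η := hη.1
  have hIcc : ∀ τ ∈ Icc (m - η) (m + η), (τ ∈ U ∧ τ ∈ Icc (0 : ℝ) 1) ∧
      dist (H (φ (γ τ))) (H (φ x)) < ε₁ ∧
      dist (formInChart β x (φ (γ τ))) (formInChart β x (φ x)) < ε₁ := by
    intro τ hτ
    refine hsub ?_
    rw [Metric.mem_closedBall, Real.dist_eq, abs_le]
    constructor <;> linarith [hτ.1, hτ.2, hη.2]
  have hlt : m - η < m + η := by linarith
  have hmap : MapsTo γ (Icc (m - η) (m + η)) φ.source := fun τ hτ => hUm (hIcc τ hτ).1.1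
  have hlip := hUc.mono fun τ hτ => (hIcc τ hτ).1.1
  rw [h.secondDifference_eq hg (hf x) hη0 (hIcc _ (left_mem_Icc.2 hlt.le)).1.2.1
    (hIcc _ (right_mem_Icc.2 hlt.le)).1.2.2 hmap]
  have hat : ContinuousOn (fun τ => η - |τ - m|) (uIcc (m - η) (m + η)) := by fun_prop
  have i1 := (intervalIntegrable_form_velocity_of_chart (hβ x) hlt.le hmap hlip).continuousOn_mul hat
  have i2 : IntervalIntegrable (fun τ => (η - |τ - m|) * H (φ (γ τ))
      (deriv (fun σ => φ (γ σ)) τ) (deriv (fun σ => φ (γ σ)) τ)) volume (m - η) (m + η) :=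
    (hlip.intervalIntegrable_quadratic hlt.le (hHc.comp hlip.continuousOn fun τ hτ =>
      φ.map_source (hmap hτ))).continuousOn_mul hat
  have hmono : ∫ τ in (m - η)..(m + η), (η - |τ - m|) * β (γ τ) (velocity γ τ) (velocity γ τ) ≤
      ∫ τ in (m - η)..(m + η), ((η - |τ - m|) * H (φ (γ τ))
        (deriv (fun σ => φ (γ σ)) τ) (deriv (fun σ => φ (γ σ)) τ) + η * (2 * ε₁ * (K : ℝ) ^ 2)) := by
    rw [intervalIntegral.integral_of_le hlt.le, intervalIntegral.integral_of_le hlt.le]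
    refine setIntegral_mono_on_ae i1.1 (i2.add intervalIntegrable_const).1 measurableSet_Ioc ?_
    filter_upwards [ae_hasDerivAt_chart hmap hlip, ae_Ioo_of_mem_uIoc hlt.le] with τ h1 h2 h3
    have hτ := h2 (by rwa [uIoc_of_le hlt.le])
    have hτI := Ioo_subset_Icc_self hτ
    rw [form_velocity_eq_of_hasDerivAt β (h1 hτ).1 (hmap hτI) (h1 hτ).2]
    set c' := deriv (fun σ => φ (γ σ)) τ with hc'
    have hK : ‖c'‖ ≤ K := norm_deriv_le_of_lipschitzOn (Icc_mem_nhds hτ.1 hτ.2) hlip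
    have d1 := abs_apply_sub_apply_le (by simpa [dist_eq_norm] using (hIcc τ hτI).2.1.le) c'
    have d2 := abs_apply_sub_apply_le (by simpa [dist_eq_norm] using (hIcc τ hτI).2.2.le) c'
    have d3 := hle x c'
    rw [← formInChart_self β x] at d3
    have hK2 : ‖c'‖ ^ 2 ≤ (K : ℝ) ^ 2 := by gcongr
    have d4 : formInChart β x (φ (γ τ)) c' c' ≤ H (φ (γ τ)) c' c' + 2 * ε₁ * (K : ℝ) ^ 2 := by
      have := mul_le_mul_of_nonneg_left hK2 hε₁0.le
      linarith [(abs_le.1 d1).1, (abs_le.1 d2).2]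
    have hw0 : 0 ≤ η - |τ - m| := by
      rw [sub_nonneg, abs_le]; constructor <;> linarith [hτ.1, hτ.2]
    have hw1 : η - |τ - m| ≤ η := by linarith [abs_nonneg (τ - m)]
    calc (η - |τ - m|) * formInChart β x (φ (γ τ)) c' c'
        ≤ (η - |τ - m|) * (H (φ (γ τ)) c' c' + 2 * ε₁ * (K : ℝ) ^ 2) := by gcongr
      _ ≤ _ := by
        rw [mul_add]
        gcongr
  rw [intervalIntegral.integral_add i2 intervalIntegrable_const, intervalIntegral.integral_const,
    smul_eq_mul] at hmono
  have hfin : (m + η - (m - η)) * (η * (2 * ε₁ * (K : ℝ) ^ 2)) ≤ ε * η ^ 2 := by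
    have : ε₁ * (4 * ((K : ℝ) ^ 2 + 1)) = ε := by rw [hε₁]; field_simp
    rw [← this]
    nlinarith [mul_pos hε₁0 (pow_pos hη0 2)]
  linarith

variable {J : Set ℝ} {g : ℝ → Bundle.RiemannianMetric (fun x : M => TangentSpace 𝓘(ℝ, E) x)}

omit [T2Space M] in
/-- Along a Lipschitz curve, the difference quotients in time of the squared speed converge
uniformly. -/
theorem IsSmoothMetricFamily.eventually_speedSq_quotient (hg : IsSmoothMetricFamily J g)
    (hJ : J.OrdConnected) (hJleft : ∀ t ∈ J, ∃ s ∈ J, s < t) {t : ℝ} (ht : t ∈ J) {γ : ℝ → M}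
    {a b : ℝ} (hγ : IsChartLipschitzOn (E := E) γ (Icc a b)) {ε : ℝ} (hε : 0 < ε) :
    ∀ᶠ s in 𝓝[<] t, ∀ᵐ τ, τ ∈ Icc a b → τ ∈ Ioo a b →
      |speedSq (g t) γ τ - speedSq (g s) γ τ -
        (t - s) * timeDerivForm J g t (γ τ) (velocity γ τ) (velocity γ τ)| ≤ ε * (t - s) := by
  have hJu := hJ.uniqueDiffOn hJleft
  refine (isCompact_Icc (a := a) (b := b)).induction_on
    (p := fun S => ∀ᶠ s in 𝓝[<] t, ∀ᵐ τ, τ ∈ S → τ ∈ Ioo a b →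
      |speedSq (g t) γ τ - speedSq (g s) γ τ -
        (t - s) * timeDerivForm J g t (γ τ) (velocity γ τ) (velocity γ τ)| ≤ ε * (t - s))
    (by simp) ?_ ?_ ?_
  · intro S S' hSS' h
    filter_upwards [h] with s hs
    filter_upwards [hs] with τ h1 h2 using h1 (hSS' h2)
  · intro S S' h h'
    filter_upwards [h, h'] with s hs hs'
    filter_upwards [hs, hs'] with τ h1 h2 h3 using h3.elim h1 h2
  intro τ hτ
  obtain ⟨x, K, a', b', hab', hnhds, hsub, hm, hc⟩ := hγ.exists_Icc hτ
  have hτ' : τ ∈ Icc a' b' := mem_of_mem_nhdsWithin hτ hnhds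
  set φ := extChartAt 𝓘(ℝ, E) x with hφ
  have ho := isOpen_extChartAt_target (I := 𝓘(ℝ, E)) x
  have hut := φ.map_source (hm hτ')
  set u₀ := φ (γ τ) with hu₀
  set ε₁ := ε / (2 * ((K : ℝ) ^ 2 + 1)) with hε₁
  have hε₁0 : 0 < ε₁ := by positivity
  obtain ⟨s₀, hs₀, hsJ, r, hr, hrt, hq⟩ :=
    exists_Icc_ball_quotient_sub_le hJ hJleft ho (hg.contDiffOn x) ht hut hε₁0
  have hB := hg.continuousOn_formInChart_timeDerivForm hJu ht x
  have hn : ∀ᶠ u in 𝓝 u₀, dist (formInChart (timeDerivForm J g t) x u)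
      (formInChart (timeDerivForm J g t) x u₀) < ε₁ :=
    (hB.continuousAt (ho.mem_nhds hut)).eventually (Metric.ball_mem_nhds _ hε₁0)
  have hcont : ContinuousWithinAt (fun σ => φ (γ σ)) (Icc a b) τ :=
    (hc.continuousOn τ hτ').mono_of_mem_nhdsWithin hnhds
  refine ⟨_, inter_mem hnhds (hcont.eventually (hn.and (Metric.closedBall_mem_nhds u₀ hr))), ?_⟩
  filter_upwards [Ioo_mem_nhdsLT hs₀] with s hs
  have hne : ∀ᵐ σ : ℝ, σ ≠ a' ∧ σ ≠ b' := by
    have h1 : ∀ᵐ σ : ℝ, σ ≠ a' := by simp [ae_iff, measure_singleton]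
    have h2 : ∀ᵐ σ : ℝ, σ ≠ b' := by simp [ae_iff, measure_singleton]
    exact h1.and h2
  filter_upwards [ae_hasDerivAt_chart hm hc, hne] with σ h1 h2 h3 _
  obtain ⟨h4, h5, h6⟩ := h3
  have hσ : σ ∈ Ioo a' b' := ⟨lt_of_le_of_ne h4.1 h2.1.symm, lt_of_le_of_ne h4.2 h2.2⟩
  obtain ⟨h7, h8⟩ := h1 hσ
  rw [speedSq_eq_of_hasDerivAt _ h7 (hm h4) h8, speedSq_eq_of_hasDerivAt _ h7 (hm h4) h8,
    form_velocity_eq_of_hasDerivAt _ h7 (hm h4) h8]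
  have hK : ‖deriv (fun σ => φ (γ σ)) σ‖ ≤ K :=
    norm_deriv_le_of_lipschitzOn (Icc_mem_nhds hσ.1 hσ.2) hc
  rw [← hφ]
  set c' := deriv (fun σ => φ (γ σ)) σ with hc'
  have e1 := hq s ⟨hs.1.le, hs.2.le⟩ _ h6
  rw [← hg.formInChart_timeDerivForm hJu ht hut] at e1
  have e2 := abs_apply_sub_apply_le (A := metricInChart (g t) x (φ (γ σ)) -
    metricInChart (g s) x (φ (γ σ))) (B := (t - s) • formInChart (timeDerivForm J g t) x u₀) e1 c'
  have e3 := abs_apply_sub_apply_le (by simpa [dist_eq_norm] using h5.le) c'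
  simp only [_root_.sub_apply, smul_apply, smul_eq_mul] at e2
  have hts : 0 < t - s := sub_pos.2 hs.2
  have hK2 : ‖c'‖ ^ 2 ≤ (K : ℝ) ^ 2 := by gcongr
  have e4 : |(t - s) * formInChart (timeDerivForm J g t) x u₀ c' c' -
      (t - s) * formInChart (timeDerivForm J g t) x (φ (γ σ)) c' c'| ≤
      (t - s) * (ε₁ * ‖c'‖ ^ 2) := by
    rw [← mul_sub, abs_mul, abs_of_pos hts, abs_sub_comm]
    gcongr
  have e5 : ε₁ * (2 * ((K : ℝ) ^ 2 + 1)) = ε := by rw [hε₁]; field_simp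
  calc _ ≤ _ := abs_sub_le _ ((t - s) * formInChart (timeDerivForm J g t) x u₀ c' c') _
    _ ≤ ε₁ * (t - s) * ‖c'‖ ^ 2 + (t - s) * (ε₁ * ‖c'‖ ^ 2) := add_le_add e2 e4
    _ = ε₁ * (2 * ‖c'‖ ^ 2) * (t - s) := by ring
    _ ≤ ε₁ * (2 * ((K : ℝ) ^ 2 + 1)) * (t - s) := by gcongr; linarith
    _ = ε * (t - s) := by rw [e5]

/-- The time derivative of the squared distance is at least the integral of the time derivative of
the metric along a geodesic. -/
theorem IsMetricGeodesic.le_lowerLeftDerivSqDist (hg : IsSmoothMetricFamily J g)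
    (hJ : J.OrdConnected) (hJleft : ∀ t ∈ J, ∃ s ∈ J, s < t) {t : ℝ} (ht : t ∈ J) {γ : ℝ → M}
    (h : IsMetricGeodesic (riemDist (g t)) γ) :
    ((∫ τ in (0 : ℝ)..1, timeDerivForm J g t (γ τ) (velocity γ τ) (velocity γ τ) : ℝ) : EReal) ≤
      lowerLeftDerivSqDist (fun t => riemDist (g t)) t (γ 0) (γ 1) := by
  have hJu := hJ.uniqueDiffOn hJleft
  have hgc : ∀ s ∈ J, ∀ x, ContinuousOn (metricInChart (g s) x) (extChartAt 𝓘(ℝ, E) x).target :=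
    fun s hs x => (contDiffOn_slice (hg.contDiffOn x) hs).continuousOn
  have hγ := h.isChartLipschitzOn (hgc t ht)
  have hq : ∀ s ∈ J, IntervalIntegrable (speedSq (g s) γ) volume 0 1 := fun s hs =>
    hγ.intervalIntegrable_form_velocity zero_le_one (β := metricForm (g s)) (hgc s hs)
  have hk := hγ.intervalIntegrable_form_velocity zero_le_one
    (hg.continuousOn_formInChart_timeDerivForm hJu ht)
  set I := ∫ τ in (0 : ℝ)..1, timeDerivForm J g t (γ τ) (velocity γ τ) (velocity γ τ) with hI
  refine EReal.ge_of_forall_gt_iff_ge.1 fun z hz => ?_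
  have hz' : 0 < I - z := sub_pos.2 (EReal.coe_lt_coe_iff.1 hz)
  refine le_liminf_of_le (by isBoundedDefault) ?_
  obtain ⟨s₁, hs₁, hst⟩ := hJleft t ht
  filter_upwards [hg.eventually_speedSq_quotient hJ hJleft ht hγ hz', Ioo_mem_nhdsLT hst]
    with s hs hss
  have hsJ : s ∈ J := hJ.out hs₁ ht ⟨hss.1.le, hss.2.le⟩
  have hts : 0 < t - s := sub_pos.2 hss.2
  rw [sq_sub_sq_div_eq_coe h.1 (hγ.riemDist_ne_top (hgc s hsJ) (by simp) (by simp)),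
    EReal.coe_le_coe_iff, le_div_iff₀ hts]
  have e1 := h.integral_speedSq_le (hgc t ht) le_rfl zero_le_one le_rfl
  have e2 := hγ.sq_riemDist_le zero_lt_one (hgc s hsJ)
  rw [sub_zero, one_mul] at e1 e2
  have e3 : ∫ τ in (0 : ℝ)..1, ((t - s) * timeDerivForm J g t (γ τ) (velocity γ τ) (velocity γ τ) -
      (I - z) * (t - s)) ≤ ∫ τ in (0 : ℝ)..1, (speedSq (g t) γ τ - speedSq (g s) γ τ) := by
    rw [intervalIntegral.integral_of_le zero_le_one, intervalIntegral.integral_of_le zero_le_one]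
    refine setIntegral_mono_on_ae ((hk.const_mul _).sub intervalIntegrable_const).1
      ((hq t ht).sub (hq s hsJ)).1 measurableSet_Ioc ?_
    filter_upwards [hs, ae_Ioo_of_mem_uIoc zero_le_one] with τ h1 h2 h3
    have hτ := h2 (by rwa [uIoc_of_le zero_le_one])
    have := h1 (Ioo_subset_Icc_self hτ) hτ
    linarith [(abs_le.1 this).1]
  rw [intervalIntegral.integral_sub (hk.const_mul _) intervalIntegrable_const,
    intervalIntegral.integral_const_mul, intervalIntegral.integral_const,
    intervalIntegral.integral_sub (hq t ht) (hq s hsJ), ← hI, sub_zero, one_smul] at e3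
  nlinarith

/-- If the Hessian dominates `-½ ∂ₜ g` at time `t`, then the inequality of dynamic convexity holds
along every geodesic of the metric at time `t`. -/
theorem IsMetricGeodesic.dynamicConvexity (hg : IsSmoothMetricFamily J g)
    (hJ : J.OrdConnected) (hJleft : ∀ t ∈ J, ∃ s ∈ J, s < t) {V : ℝ → M → ℝ}
    (hV : ContMDiffOn (𝓘(ℝ, ℝ).prod 𝓘(ℝ, E)) 𝓘(ℝ, ℝ) ∞ (fun p : ℝ × M => V p.1 p.2) (J ×ˢ univ))
    {t : ℝ} (ht : t ∈ J)
    (hHess : ∀ (x : M) (v : TangentSpace 𝓘(ℝ, E) x),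
      -(1 / 2) * derivWithin (fun s => (g s).inner x v v) J t ≤ riemHessian (g t) (V t) x v v)
    {γ : ℝ → M} (h : IsMetricGeodesic (riemDist (g t)) γ) :
    UpperSemicontinuousOn (fun τ => V t (γ τ)) (Icc 0 1) ∧
    (∀ a b : ℝ, 0 < a → a < b → b < 1 →
      AbsolutelyContinuousOnInterval (fun τ => V t (γ τ)) a b) ∧
    ((-(1 / 2) : ℝ) : EReal) *
        lowerLeftDerivSqDist (fun t => riemDist (g t)) t (γ 0) (γ 1) ≤
      -(lowerSlopeAtZero (fun τ => V t (γ τ)) - upperSlopeAtOne (fun τ => V t (γ τ))) := by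
  have hJu := hJ.uniqueDiffOn hJleft
  have hgt : ∀ x, ContDiffOn ℝ ∞ (metricInChart (g t) x) (extChartAt 𝓘(ℝ, E) x).target :=
    fun x => contDiffOn_slice (hg.contDiffOn x) ht
  have hft : ∀ x, ContDiffOn ℝ ∞ (V t ∘ (extChartAt 𝓘(ℝ, E) x).symm)
      (extChartAt 𝓘(ℝ, E) x).target :=
    fun x => contDiffOn_slice (contDiffOn_family_comp_chart hV x) ht
  have hγ := h.isChartLipschitzOn fun x => (hgt x).continuousOn
  obtain ⟨K, hK⟩ := hγ.exists_lipschitzOnWith_comp hft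
  refine ⟨hK.continuousOn.upperSemicontinuousOn, fun a b ha hab hb => ?_, ?_⟩
  · refine LipschitzOnWith.absolutelyContinuousOnInterval (K := K) ?_
    rw [uIcc_of_le hab.le]
    exact hK.mono (Icc_subset_Icc ha.le hb.le)
  set β : M → E →L[ℝ] E →L[ℝ] ℝ := fun y => (-(1 / 2) : ℝ) • timeDerivForm J g t y with hβ
  have hβc : ∀ x, ContinuousOn (formInChart β x) (extChartAt 𝓘(ℝ, E) x).target := fun x =>
    ((hg.continuousOn_formInChart_timeDerivForm hJu ht x).const_smul (-(1 / 2) : ℝ)).congr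
      fun u _ => by ext v w; rfl
  have hle : ∀ (x : M) (v : E),
      β x v v ≤ hessianInChart (g t) (V t) x (extChartAt 𝓘(ℝ, E) x x) v v := by
    intro x v
    have e1 := riemHessian_eq_hessianInChart (f := V t) (hgt x) v
    have e2 := hg.derivWithin_inner hJu ht x v
    rw [← hg.formInChart_timeDerivForm hJu ht (mem_extChartAt_target (I := 𝓘(ℝ, E)) x),
      formInChart_self] at e2
    exact (congrArg (fun y : ℝ => -(1 / 2) * y) e2).symm.trans_le ((hHess x v).trans_eq e1)
  obtain ⟨p, q, hpq, a, b, ha, hb, hab⟩ := exists_slope_bounds hK.continuousOn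
    (hγ.intervalIntegrable_form_velocity zero_le_one hβc)
    (fun m hm ε hε => h.le_secondDifference hgt hft hβc hle hm hε)
  have e1 := lowerSlopeAtZero_le (u := fun τ => V t (γ τ)) ha fun τ hτ => (hab τ hτ).1
  have e2 := le_upperSlopeAtOne (u := fun τ => V t (γ τ)) hb fun τ hτ => (hab τ hτ).2
  have e3 := EReal.neg_le_neg_iff.2 (EReal.sub_le_sub e1 e2)
  refine (neg_half_mul_le (h.le_lowerLeftDerivSqDist hg hJ hJleft ht)).trans
    (le_trans (le_of_eq ?_) e3)
  rw [← EReal.coe_sub, ← EReal.coe_neg, neg_sub, hpq, ← intervalIntegral.integral_const_mul]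
  rfl

end Manifold

section Manifold

set_option maxSynthPendingDepth 3

variable {E : Type*} [NormedAddCommGroup E] [NormedSpace ℝ E] [FiniteDimensional ℝ E]
  {M : Type*} [TopologicalSpace M] [T2Space M] [ChartedSpace E M] [IsManifold 𝓘(ℝ, E) ∞ M]

/-! ### From dynamic convexity to the Hessian bound -/

theorem LipschitzOnWith.integral_clm_deriv {c : ℝ → E} {K : NNReal} {a b : ℝ} (hab : a ≤ b)
    (hc : LipschitzOnWith K c (Icc a b)) (ℓ : E →L[ℝ] ℝ) :
    IntervalIntegrable (fun τ => ℓ (deriv c τ)) volume a b ∧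
      ∫ τ in a..b, ℓ (deriv c τ) = ℓ (c b) - ℓ (c a) := by
  have := hc.integral_fderiv_comp hab isOpen_univ (mapsTo_univ _ _) (F := ℓ)
    ℓ.contDiff.contDiffOn
  simpa only [ContinuousLinearMap.fderiv] using this

section Energy

variable {g : Bundle.RiemannianMetric (fun x : M => TangentSpace 𝓘(ℝ, E) x)} {x : M} {u₀ z : E}
  {r δ μ : ℝ} {B : E →L[ℝ] E →L[ℝ] ℝ}

/-- Short geodesics are close to segments: in a chart where the metric is nearly constant, the
velocity of a geodesic from `u₀` to `u₀ + z` is close to `z` in mean square, since its energy is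
nearly minimal for the constant metric. Hence the integral of a nearly constant quadratic form over
the velocity is close to the value at `z`. -/
theorem MetricNearOn.abs_integral_form_sub_le (hn : MetricNearOn g x u₀ r B δ) (hμ : 0 < μ)
    (hB : ∀ v, μ * ‖v‖ ^ 2 ≤ B v v) (hBs : ∀ v w, B v w = B w v) (hδ0 : 0 ≤ δ) (hδ : δ ≤ μ / 2)
    (hg : ∀ x, ContinuousOn (metricInChart g x) (extChartAt 𝓘(ℝ, E) x).target) {γ : ℝ → M}
    (h : IsMetricGeodesic (riemDist g) γ) (h0 : γ 0 = (extChartAt 𝓘(ℝ, E) x).symm u₀)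
    (h1 : γ 1 = (extChartAt 𝓘(ℝ, E) x).symm (u₀ + z)) (hz : u₀ + z ∈ Metric.closedBall u₀ r)
    (hin : ∀ τ ∈ Icc (0 : ℝ) 1, γ τ ∈ (extChartAt 𝓘(ℝ, E) x).source ∧
      extChartAt 𝓘(ℝ, E) x (γ τ) ∈ Metric.closedBall u₀ r)
    {Q : E → E →L[ℝ] E →L[ℝ] ℝ} {Q₀ : E →L[ℝ] E →L[ℝ] ℝ} {ε : ℝ}
    (hQc : ContinuousOn Q (Metric.closedBall u₀ r))
    (hQ : ∀ u ∈ Metric.closedBall u₀ r, ‖Q u - Q₀‖ ≤ ε) :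
    |(∫ τ in (0 : ℝ)..1, Q (extChartAt 𝓘(ℝ, E) x (γ τ))
        (deriv (fun σ => extChartAt 𝓘(ℝ, E) x (γ σ)) τ)
        (deriv (fun σ => extChartAt 𝓘(ℝ, E) x (γ σ)) τ)) - Q₀ z z| ≤
      (3 * ε / μ + 4 * δ * ‖Q₀‖ / μ ^ 2) * B z z := by
  set φ := extChartAt 𝓘(ℝ, E) x with hφ
  have hmap : MapsTo γ (Icc 0 1) φ.source := fun τ hτ => (hin τ hτ).1
  obtain ⟨K, hK⟩ := h.exists_lipschitzOnWith_Icc (hg x) le_rfl le_rfl hmap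
  rw [← hφ] at hK
  set c : ℝ → E := fun σ => φ (γ σ) with hc
  have hu0 : u₀ ∈ Metric.closedBall u₀ r := by
    refine Metric.mem_closedBall_self ?_
    exact dist_nonneg.trans (Metric.mem_closedBall.1 hz)
  have hc0 : c 0 = u₀ := by rw [hc]; simp only [h0]; exact φ.right_inv (hn.subset hu0)
  have hc1 : c 1 = u₀ + z := by rw [hc]; simp only [h1]; exact φ.right_inv (hn.subset hz)
  have hlin : ∀ ℓ : E →L[ℝ] ℝ, IntervalIntegrable (fun τ => ℓ (deriv c τ)) volume 0 1 ∧
      ∫ τ in (0 : ℝ)..1, ℓ (deriv c τ) = ℓ z := by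
    intro ℓ
    have := hK.integral_clm_deriv zero_le_one ℓ
    rw [hc0, hc1, map_add, add_sub_cancel_left] at this
    exact this
  have hBi : IntervalIntegrable (fun τ => B (deriv c τ) (deriv c τ)) volume 0 1 :=
    hK.intervalIntegrable_quadratic zero_le_one continuousOn_const
  have hQi : IntervalIntegrable (fun τ => Q (c τ) (deriv c τ) (deriv c τ)) volume 0 1 :=
    hK.intervalIntegrable_quadratic zero_le_one
      (hQc.comp hK.continuousOn fun τ hτ => (hin τ hτ).2)
  have hGi : IntervalIntegrable (fun τ => metricInChart g x (c τ) (deriv c τ) (deriv c τ))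
      volume 0 1 :=
    hK.intervalIntegrable_quadratic zero_le_one
      (((hg x).mono hn.subset).comp hK.continuousOn fun τ hτ => (hin τ hτ).2)
  have hB0 : ∀ v, 0 ≤ B v v := fun v => le_trans (by positivity) (hB v)
  have hκ : 0 ≤ 1 - δ / μ := by rw [sub_nonneg, div_le_one hμ]; linarith
  set S := ∫ τ in (0 : ℝ)..1, B (deriv c τ) (deriv c τ) with hS
  have hδB : ∀ w, δ * ‖w‖ ^ 2 ≤ δ / μ * B w w := by
    intro w
    rw [div_mul_eq_mul_div, le_div_iff₀ hμ]
    nlinarith [mul_le_mul_of_nonneg_left (hB w) hδ0]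
  -- the energy of the geodesic for the constant metric
  have e1 : (1 - δ / μ) * S ≤ (1 + δ / μ) * B z z := by
    have d1 : (1 - δ / μ) * S ≤ ∫ τ in (0 : ℝ)..1,
        metricInChart g x (c τ) (deriv c τ) (deriv c τ) := by
      rw [hS, ← intervalIntegral.integral_const_mul]
      refine intervalIntegral.integral_mono_on zero_le_one (hBi.const_mul _) hGi fun τ hτ => ?_
      have := abs_apply_sub_apply_le (hn.norm_le _ (hin τ hτ).2) (deriv c τ)
      linarith [(abs_le.1 this).1, hδB (deriv c τ)]
    have d2 := h.integral_speedSq_le hg le_rfl zero_le_one le_rfl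
    rw [integral_speedSq_eq_of_chart zero_le_one hmap hK] at d2
    have d3 := hn.riemDist_le hu0 hz (C := √(B z z + δ * ‖z‖ ^ 2)) (by positivity) (by
      rw [add_sub_cancel_left, Real.sq_sqrt (add_nonneg (hB0 z) (by positivity))])
    rw [← h0, ← h1] at d3
    have d4 := ENNReal.toReal_mono ENNReal.ofReal_ne_top d3
    rw [ENNReal.toReal_ofReal (by positivity)] at d4
    have d5 : (riemDist g (γ 0) (γ 1)).toReal ^ 2 ≤ B z z + δ * ‖z‖ ^ 2 := by
      rw [← Real.sq_sqrt (show 0 ≤ B z z + δ * ‖z‖ ^ 2 from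
        add_nonneg (hB0 z) (by positivity))]
      gcongr
    have d6 := d1.trans d2
    linarith [hδB z]
  have hδμ : δ / μ ≤ 1 / 2 := by rw [div_le_iff₀ hμ]; linarith
  have hδμ0 : 0 ≤ δ / μ := by positivity
  have e2 : S ≤ 3 * B z z := by nlinarith [hB0 z]
  have e3 : S - B z z ≤ 4 * (δ / μ) * B z z := by nlinarith [hB0 z]
  have hε0 : 0 ≤ ε := (norm_nonneg _).trans (hQ u₀ hu0)
  -- expand the form around `z`; the linear terms have the right mean
  set ℓ := Q₀ z + Q₀.flip z with hℓ
  have hpt : ∀ τ ∈ Icc (0 : ℝ) 1, |Q (c τ) (deriv c τ) (deriv c τ) - ℓ (deriv c τ) + Q₀ z z| ≤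
      ε / μ * B (deriv c τ) (deriv c τ) + ‖Q₀‖ / μ *
        (B (deriv c τ) (deriv c τ) - 2 * B z (deriv c τ) + B z z) := by
    intro τ hτ
    set w := deriv c τ with hw
    have d1 := abs_apply_sub_apply_le (hQ _ (hin τ hτ).2) w
    have d2 : ε * ‖w‖ ^ 2 ≤ ε / μ * B w w := by
      rw [div_mul_eq_mul_div, le_div_iff₀ hμ]
      nlinarith [mul_le_mul_of_nonneg_left (hB w) hε0]
    have d3 : |Q₀ (w - z) (w - z)| ≤ ‖Q₀‖ / μ * B (w - z) (w - z) := by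
      have d4 := ContinuousLinearMap.le_opNorm₂ Q₀ (w - z) (w - z)
      rw [Real.norm_eq_abs] at d4
      refine d4.trans ?_
      rw [div_mul_eq_mul_div, le_div_iff₀ hμ]
      nlinarith [mul_le_mul_of_nonneg_left (hB (w - z)) (norm_nonneg Q₀)]
    have d5 : B (w - z) (w - z) = B w w - 2 * B z w + B z z := by
      simp only [map_sub, _root_.sub_apply]
      rw [hBs w z]
      ring
    have d6 : Q (c τ) w w - ℓ w + Q₀ z z = (Q (c τ) w w - Q₀ w w) + Q₀ (w - z) (w - z) := by
      simp only [hℓ, map_sub, _root_.sub_apply, _root_.add_apply, ContinuousLinearMap.flip_apply]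
      ring
    rw [d6, ← d5]
    exact (abs_add_le _ _).trans (add_le_add (d1.trans d2) d3)
  have hrhs : IntervalIntegrable (fun τ => ε / μ * B (deriv c τ) (deriv c τ) + ‖Q₀‖ / μ *
      (B (deriv c τ) (deriv c τ) - 2 * B z (deriv c τ) + B z z)) volume 0 1 :=
    (hBi.const_mul _).add (((hBi.sub ((hlin (B z)).1.const_mul 2)).add
      intervalIntegrable_const).const_mul _)
  have e4 := intervalIntegral.norm_integral_le_of_norm_le zero_le_one
    (f := fun τ => Q (c τ) (deriv c τ) (deriv c τ) - ℓ (deriv c τ) + Q₀ z z)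
    (Eventually.of_forall fun τ hτ => hpt τ (Ioc_subset_Icc_self hτ)) hrhs
  rw [intervalIntegral.integral_add (hQi.sub (hlin ℓ).1) intervalIntegrable_const,
    intervalIntegral.integral_sub hQi (hlin ℓ).1, (hlin ℓ).2,
    intervalIntegral.integral_add (hBi.const_mul _) (((hBi.sub ((hlin (B z)).1.const_mul 2)).add
      intervalIntegrable_const).const_mul _), intervalIntegral.integral_const_mul,
    intervalIntegral.integral_const_mul,
    intervalIntegral.integral_add (hBi.sub ((hlin (B z)).1.const_mul 2)) intervalIntegrable_const,
    intervalIntegral.integral_sub hBi ((hlin (B z)).1.const_mul 2),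
    intervalIntegral.integral_const_mul, (hlin (B z)).2, intervalIntegral.integral_const,
    intervalIntegral.integral_const, sub_zero, one_smul, one_smul, ← hS, Real.norm_eq_abs] at e4
  have hℓz : ℓ z = 2 * Q₀ z z := by
    simp only [hℓ, _root_.add_apply, ContinuousLinearMap.flip_apply]
    ring
  rw [hℓz] at e4
  have e5 : (∫ τ in (0 : ℝ)..1, Q (c τ) (deriv c τ) (deriv c τ)) - 2 * Q₀ z z + Q₀ z z =
      (∫ τ in (0 : ℝ)..1, Q (c τ) (deriv c τ) (deriv c τ)) - Q₀ z z := by ring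
  rw [e5] at e4
  refine e4.trans ?_
  calc ε / μ * S + ‖Q₀‖ / μ * (S - 2 * B z z + B z z)
      = ε / μ * S + ‖Q₀‖ / μ * (S - B z z) := by ring
    _ ≤ ε / μ * (3 * B z z) + ‖Q₀‖ / μ * (4 * (δ / μ) * B z z) := by gcongr
    _ = _ := by field_simp

end Energy

/-- Along a geodesic inside a chart, the slopes at the endpoints differ at most by the integral of
the Hessian. -/
theorem IsMetricGeodesic.neg_slope_sub_slope_le
    {g : Bundle.RiemannianMetric (fun x : M => TangentSpace 𝓘(ℝ, E) x)} {γ : ℝ → M}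
    (h : IsMetricGeodesic (riemDist g) γ)
    (hg : ∀ x, ContDiffOn ℝ ∞ (metricInChart g x) (extChartAt 𝓘(ℝ, E) x).target) {f : M → ℝ}
    (hf : ∀ x, ContDiffOn ℝ ∞ (f ∘ (extChartAt 𝓘(ℝ, E) x).symm) (extChartAt 𝓘(ℝ, E) x).target)
    {x : M} (hmap : MapsTo γ (Icc 0 1) (extChartAt 𝓘(ℝ, E) x).source) :
    -(lowerSlopeAtZero (fun τ => f (γ τ)) - upperSlopeAtOne (fun τ => f (γ τ))) ≤
      ((∫ τ in (0 : ℝ)..1, hessianInChart g f x (extChartAt 𝓘(ℝ, E) x (γ τ))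
        (deriv (fun σ => extChartAt 𝓘(ℝ, E) x (γ σ)) τ)
        (deriv (fun σ => extChartAt 𝓘(ℝ, E) x (γ σ)) τ) : ℝ) : EReal) := by
  obtain ⟨K, hK⟩ := h.exists_lipschitzOnWith_Icc (hg x).continuousOn le_rfl le_rfl hmap
  obtain ⟨K', hK'⟩ := (h.isChartLipschitzOn fun x =>
    (hg x).continuousOn).exists_lipschitzOnWith_comp hf
  have hki := hK.intervalIntegrable_quadratic zero_le_one
    ((continuousOn_hessianInChart (hg x) (hf x)).comp hK.continuousOn fun τ hτ =>
      (extChartAt 𝓘(ℝ, E) x).map_source (hmap hτ))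
  obtain ⟨p, q, hpq, a, b, ha, hb, hab⟩ := exists_slope_bounds (u := fun τ => -f (γ τ))
    hK'.continuousOn.neg hki.neg (fun m hm ε hε => by
      filter_upwards [Ioo_mem_nhdsGT (lt_min hm.1 (sub_pos.2 hm.2))] with η hη
      have h0 : 0 ≤ m - η := by linarith [hη.2.le.trans (min_le_left _ _)]
      have h1 : m + η ≤ 1 := by linarith [hη.2.le.trans (min_le_right _ _)]
      have := h.secondDifference_eq hg (hf x) hη.1 h0 h1
        (hmap.mono_left (Icc_subset_Icc h0 h1))
      simp only [Pi.neg_apply, mul_neg, intervalIntegral.integral_neg, Function.comp_apply]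
      rw [← this]
      nlinarith [sq_nonneg η])
  have e1 : ((-p : ℝ) : EReal) ≤ lowerSlopeAtZero (fun τ => f (γ τ)) :=
    le_lowerSlopeAtZero ha.neg fun τ hτ => by
      have := (hab τ hτ).1
      rw [show -f (γ τ) - -f (γ 0) = -(f (γ τ) - f (γ 0)) by ring, neg_div] at this
      linarith
  have e2 : upperSlopeAtOne (fun τ => f (γ τ)) ≤ ((-q : ℝ) : EReal) :=
    upperSlopeAtOne_le hb.neg fun τ hτ => by
      have := (hab τ hτ).2
      rw [show -f (γ 1) - -f (γ τ) = -(f (γ 1) - f (γ τ)) by ring, neg_div] at this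
      linarith
  have e3 := EReal.neg_le_neg_iff.2 (EReal.sub_le_sub e1 e2)
  refine e3.trans (le_of_eq ?_)
  rw [← EReal.coe_sub, ← EReal.coe_neg, show -(-p - -q) = -(q - p) by ring, hpq]
  simp only [Pi.neg_apply, intervalIntegral.integral_neg, neg_neg, Function.comp_apply]

end Manifold

section Manifold

set_option maxSynthPendingDepth 3

variable {E : Type*} [NormedAddCommGroup E] [NormedSpace ℝ E] [FiniteDimensional ℝ E]
  {M : Type*} [TopologicalSpace M] [T2Space M] [ChartedSpace E M] [IsManifold 𝓘(ℝ, E) ∞ M]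
  {J : Set ℝ} {g : ℝ → Bundle.RiemannianMetric (fun x : M => TangentSpace 𝓘(ℝ, E) x)}
  {V : ℝ → M → ℝ}

/-- The time derivative of the squared distance of nearby points is almost bounded above by the time
derivative of the metric. The competitors for the distance at time `t` are the geodesics at earlier
times. -/
theorem IsSmoothMetricFamily.lowerLeftDerivSqDist_le (hg : IsSmoothMetricFamily J g) {x : M}
    {u₀ z : E} {r δ μ ε t s₀ : ℝ} {B Q₀ : E →L[ℝ] E →L[ℝ] ℝ} (hs₀ : s₀ < t) (hsJ : Icc s₀ t ⊆ J)
    (hn : ∀ s ∈ Icc s₀ t, MetricNearOn (g s) x u₀ r B δ) (hμ : 0 < μ)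
    (hB : ∀ v, μ * ‖v‖ ^ 2 ≤ B v v) (hBs : ∀ v w, B v w = B w v) (hδ0 : 0 ≤ δ) (hδ : δ ≤ μ / 2)
    (hr : 0 < r) (hz : u₀ + z ∈ Metric.closedBall u₀ r)
    (hzr : √(B z z + δ * ‖z‖ ^ 2) < √(μ / 2) * r)
    (hQ : ∀ s ∈ Icc s₀ t, ∀ u ∈ Metric.closedBall u₀ r,
      ‖metricInChart (g t) x u - metricInChart (g s) x u - (t - s) • Q₀‖ ≤ ε * (t - s)) :
    lowerLeftDerivSqDist (fun t => riemDist (g t)) t ((extChartAt 𝓘(ℝ, E) x).symm u₀)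
        ((extChartAt 𝓘(ℝ, E) x).symm (u₀ + z)) ≤
      ((Q₀ z z + (3 * ε / μ + 4 * δ * ‖Q₀‖ / μ ^ 2) * B z z : ℝ) : EReal) := by
  set φ := extChartAt 𝓘(ℝ, E) x with hφ
  have hB0 : ∀ v, 0 ≤ B v v := fun v => le_trans (by positivity) (hB v)
  have hgc : ∀ s ∈ J, ∀ x, ContinuousOn (metricInChart (g s) x) (extChartAt 𝓘(ℝ, E) x).target :=
    fun s hs x => (contDiffOn_slice (hg.contDiffOn x) hs).continuousOn
  have hu0 : u₀ ∈ Metric.closedBall u₀ r := Metric.mem_closedBall_self hr.le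
  have hdist : ∀ s ∈ Icc s₀ t, riemDist (g s) (φ.symm u₀) (φ.symm (u₀ + z)) <
      ENNReal.ofReal (√(μ / 2) * r) := by
    intro s hs
    refine ((hn s hs).riemDist_le hu0 hz (C := √(B z z + δ * ‖z‖ ^ 2)) (by positivity) ?_).trans_lt
      ((ENNReal.ofReal_lt_ofReal_iff (by positivity)).2 hzr)
    rw [add_sub_cancel_left, Real.sq_sqrt (add_nonneg (hB0 z) (by positivity))]
  have htI : t ∈ Icc s₀ t := right_mem_Icc.2 hs₀.le
  refine liminf_le_of_frequently_le (Eventually.frequently ?_) (by isBoundedDefault)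
  filter_upwards [Ioo_mem_nhdsLT hs₀] with s hs
  have hsI : s ∈ Icc s₀ t := ⟨hs.1.le, hs.2.le⟩
  have hts : 0 < t - s := sub_pos.2 hs.2
  rw [sq_sub_sq_div_eq_coe (ne_top_of_lt (hdist t htI)) (ne_top_of_lt (hdist s hsI)),
    EReal.coe_le_coe_iff, div_le_iff₀ hts]
  obtain ⟨γ, hγ, h0, h1, hin⟩ := (hn s hsI).exists_isMetricGeodesic hμ hB hδ hr
    (hgc s (hsJ hsI)) (hdist s hsI)
  have hmap : MapsTo γ (Icc 0 1) φ.source := fun τ hτ => (hin τ hτ).1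
  obtain ⟨K, hK⟩ := hγ.exists_lipschitzOnWith_Icc (hgc s (hsJ hsI) x) le_rfl le_rfl hmap
  have hGi : ∀ s' ∈ Icc s₀ t, IntervalIntegrable (fun τ => metricInChart (g s') x (φ (γ τ))
      (deriv (fun σ => φ (γ σ)) τ) (deriv (fun σ => φ (γ σ)) τ)) volume 0 1 := fun s' hs' =>
    hK.intervalIntegrable_quadratic zero_le_one
      ((hgc s' (hsJ hs') x).comp hK.continuousOn fun τ hτ => φ.map_source (hmap hτ))
  have e1 := hγ.integral_speedSq_le (hgc s (hsJ hsI)) le_rfl zero_le_one le_rfl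
  have e2 := (hγ.isChartLipschitzOn (hgc s (hsJ hsI))).sq_riemDist_le zero_lt_one
    (hgc t (hsJ htI))
  rw [integral_speedSq_eq_of_chart zero_le_one hmap hK, sub_zero, one_mul, h0, h1] at e1 e2
  have e3 := (hn s hsI).abs_integral_form_sub_le (Q := fun u => (t - s)⁻¹ •
    (metricInChart (g t) x u - metricInChart (g s) x u)) (Q₀ := Q₀) (ε := ε) hμ hB hBs hδ0 hδ
    (hgc s (hsJ hsI)) hγ h0 h1 hz hin
    (((((hgc t (hsJ htI) x).mono (hn t htI).subset).sub
      ((hgc s (hsJ hsI) x).mono (hn s hsI).subset))).const_smul (t - s)⁻¹) (fun u hu => by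
        have h2 : (t - s)⁻¹ • (metricInChart (g t) x u - metricInChart (g s) x u) - Q₀ =
            (t - s)⁻¹ • (metricInChart (g t) x u - metricInChart (g s) x u - (t - s) • Q₀) := by
          rw [smul_sub _ _ ((t - s) • Q₀), smul_smul, inv_mul_cancel₀ hts.ne', one_smul]
        rw [h2, norm_smul, norm_inv, Real.norm_eq_abs, abs_of_pos hts, inv_mul_le_iff₀ hts,
          mul_comm]
        exact hQ s hsI u hu)
  simp only [smul_apply, _root_.sub_apply, smul_eq_mul, ← hφ] at e3
  rw [intervalIntegral.integral_const_mul,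
    intervalIntegral.integral_sub (hGi t htI) (hGi s hsI)] at e3
  have e4 := (abs_le.1 e3).2
  rw [← hφ] at e1 e2
  set A := ∫ τ in (0 : ℝ)..1, metricInChart (g t) x (φ (γ τ))
      (deriv (fun σ => φ (γ σ)) τ) (deriv (fun σ => φ (γ σ)) τ) with hA
  set A' := ∫ τ in (0 : ℝ)..1, metricInChart (g s) x (φ (γ τ))
      (deriv (fun σ => φ (γ σ)) τ) (deriv (fun σ => φ (γ σ)) τ) with hA'
  have e5 : (t - s)⁻¹ * (A - A') ≤ Q₀ z z + (3 * ε / μ + 4 * δ * ‖Q₀‖ / μ ^ 2) * B z z := by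
    linarith
  rw [inv_mul_le_iff₀ hts] at e5
  linarith

/-- The inequality of dynamic convexity along short geodesics at time `t` implies the bound of the
Hessian at time `t`. -/
theorem IsSmoothMetricFamily.neg_half_mul_le_riemHessian (hg : IsSmoothMetricFamily J g)
    (hJ : J.OrdConnected) (hJleft : ∀ t ∈ J, ∃ s ∈ J, s < t)
    (hV : ContMDiffOn (𝓘(ℝ, ℝ).prod 𝓘(ℝ, E)) 𝓘(ℝ, ℝ) ∞ (fun p : ℝ × M => V p.1 p.2) (J ×ˢ univ))
    {t : ℝ} (ht : t ∈ J)
    (hconv : ∀ γ : ℝ → M, IsMetricGeodesic (riemDist (g t)) γ → ((-(1 / 2) : ℝ) : EReal) *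
        lowerLeftDerivSqDist (fun t => riemDist (g t)) t (γ 0) (γ 1) ≤
      -(lowerSlopeAtZero (fun τ => V t (γ τ)) - upperSlopeAtOne (fun τ => V t (γ τ))))
    (x : M) (v : TangentSpace 𝓘(ℝ, E) x) :
    -(1 / 2) * derivWithin (fun s => (g s).inner x v v) J t ≤ riemHessian (g t) (V t) x v v := by
  have hJu := hJ.uniqueDiffOn hJleft
  have hgt : ∀ x, ContDiffOn ℝ ∞ (metricInChart (g t) x) (extChartAt 𝓘(ℝ, E) x).target :=
    fun x => contDiffOn_slice (hg.contDiffOn x) ht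
  have hgc : ∀ x, ContinuousOn (metricInChart (g t) x) (extChartAt 𝓘(ℝ, E) x).target :=
    fun x => (hgt x).continuousOn
  have hft : ∀ x, ContDiffOn ℝ ∞ (V t ∘ (extChartAt 𝓘(ℝ, E) x).symm)
      (extChartAt 𝓘(ℝ, E) x).target :=
    fun x => contDiffOn_slice (contDiffOn_family_comp_chart hV x) ht
  have hhess := riemHessian_eq_hessianInChart (f := V t) (hgt x) v
  have hder := hg.derivWithin_inner hJu ht x v
  change E at v
  set φ := extChartAt 𝓘(ℝ, E) x with hφ
  set u₀ := φ x with hu₀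
  have hut : u₀ ∈ φ.target := mem_extChartAt_target x
  have ho : IsOpen φ.target := isOpen_extChartAt_target x
  set Q₀ := derivWithin (fun s => metricInChart (g s) x u₀) J t with hQ₀
  set H := hessianInChart (g t) (V t) x with hH
  have hHc : ContinuousOn H φ.target := continuousOn_hessianInChart (hgt x) (hft x)
  set B := metricInChart (g t) x u₀ with hBdef
  have hBs : ∀ v w, B v w = B w v := metricInChart_symm (g t) x u₀
  obtain ⟨μ, hμ, hB⟩ := exists_coercive B fun v hv => metricInChart_pos (g t) hut hv
  have hB0 : ∀ v, 0 ≤ B v v := fun v => le_trans (by positivity) (hB v)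
  set C := (3 / μ + 4 * ‖H u₀‖ / μ ^ 2 + (3 / μ + 4 * ‖Q₀‖ / μ ^ 2) / 2) * B v v with hC
  have hC0 : 0 ≤ C := mul_nonneg (by positivity) (hB0 v)
  have key : ∀ ε > 0, -(1 / 2) * Q₀ v v ≤ H u₀ v v + ε * C := by
    intro ε hε
    set δ := min ε (μ / 2) with hδdef
    have hδ0 : 0 < δ := lt_min hε (half_pos hμ)
    have hδ : δ ≤ μ / 2 := min_le_right _ _
    have hδε : δ ≤ ε := min_le_left _ _
    obtain ⟨s₁, hs₁, hsJ₁, r₁, hr₁, hrt₁, hn₁⟩ := exists_Icc_ball_norm_sub_le hJ hJleft ho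
      (hg.contDiffOn x).continuousOn ht hut hδ0
    obtain ⟨s₂, hs₂, -, r₂, hr₂, -, hq₂⟩ :=
      exists_Icc_ball_quotient_sub_le hJ hJleft ho (hg.contDiffOn x) ht hut hε
    obtain ⟨r₃, hr₃, hH₃⟩ := Metric.nhds_basis_closedBall.mem_iff.1
      ((hHc.continuousAt (ho.mem_nhds hut)).eventually (Metric.ball_mem_nhds _ hε))
    set s₀ := max s₁ s₂ with hs₀
    have hs₀t : s₀ < t := max_lt hs₁ hs₂
    set r := min r₁ (min r₂ r₃) with hrdef
    have hr : 0 < r := lt_min hr₁ (lt_min hr₂ hr₃)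
    have hb₁ : Metric.closedBall u₀ r ⊆ Metric.closedBall u₀ r₁ :=
      Metric.closedBall_subset_closedBall (min_le_left _ _)
    have hb₂ : Metric.closedBall u₀ r ⊆ Metric.closedBall u₀ r₂ :=
      Metric.closedBall_subset_closedBall ((min_le_right _ _).trans (min_le_left _ _))
    have hb₃ : Metric.closedBall u₀ r ⊆ Metric.closedBall u₀ r₃ :=
      Metric.closedBall_subset_closedBall ((min_le_right _ _).trans (min_le_right _ _))
    have hn : ∀ s ∈ Icc s₀ t, MetricNearOn (g s) x u₀ r B δ := fun s hs =>
      ⟨hb₁.trans hrt₁, fun u hu => hn₁ s ⟨(le_max_left _ _).trans hs.1, hs.2⟩ u (hb₁ hu)⟩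
    have htI : t ∈ Icc s₀ t := right_mem_Icc.2 hs₀t.le
    -- a short vector in the direction of `v`
    obtain ⟨η, hη, hzball, hzr⟩ : ∃ η : ℝ, 0 < η ∧ ‖η • v‖ ≤ r ∧
        √(B (η • v) (η • v) + δ * ‖η • v‖ ^ 2) < √(μ / 2) * r := by
      have c1 : Continuous (fun η : ℝ => ‖η • v‖) := by fun_prop
      have c2 : Continuous (fun η : ℝ => √(B (η • v) (η • v) + δ * ‖η • v‖ ^ 2)) := by fun_prop
      have t1 := c1.tendsto 0
      have t2 := c2.tendsto 0
      simp only [zero_smul, map_zero, norm_zero, ne_eq, OfNat.ofNat_ne_zero, not_false_eq_true,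
        zero_pow, mul_zero, add_zero, Real.sqrt_zero] at t1 t2
      have h1 := (t1.eventually (Iio_mem_nhds hr)).and
        (t2.eventually (Iio_mem_nhds (show 0 < √(μ / 2) * r by positivity)))
      obtain ⟨η, h2, h3⟩ := ((h1.filter_mono (nhdsWithin_le_nhds (s := Ioi 0))).and
        self_mem_nhdsWithin).exists
      exact ⟨η, h3, h2.1.le, h2.2⟩
    set z := η • v with hz
    have hzb : u₀ + z ∈ Metric.closedBall u₀ r := by
      rwa [Metric.mem_closedBall, dist_eq_norm, add_sub_cancel_left]
    have hu0 : u₀ ∈ Metric.closedBall u₀ r := Metric.mem_closedBall_self hr.le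
    have hdist : riemDist (g t) (φ.symm u₀) (φ.symm (u₀ + z)) < ENNReal.ofReal (√(μ / 2) * r) := by
      refine ((hn t htI).riemDist_le hu0 hzb (C := √(B z z + δ * ‖z‖ ^ 2)) (by positivity)
        ?_).trans_lt ((ENNReal.ofReal_lt_ofReal_iff (by positivity)).2 hzr)
      rw [add_sub_cancel_left, Real.sq_sqrt (add_nonneg (hB0 z) (by positivity))]
    obtain ⟨γ, hγ, h0, h1, hin⟩ := (hn t htI).exists_isMetricGeodesic hμ hB hδ hr hgc hdist
    have e1 := hγ.neg_slope_sub_slope_le hgt hft (x := x) fun τ hτ => (hin τ hτ).1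
    have e2 := (hn t htI).abs_integral_form_sub_le hμ hB hBs hδ0.le hδ hgc hγ h0 h1 hzb hin
      (hHc.mono (hn t htI).subset) (Q₀ := H u₀) (ε := ε) fun u hu => by
        rw [← dist_eq_norm]; exact (hH₃ (hb₃ hu)).le
    have e3 := hg.lowerLeftDerivSqDist_le (ε := ε) hs₀t
      ((Icc_subset_Icc_left (le_max_left _ _)).trans hsJ₁) hn hμ hB hBs hδ0.le hδ hr hzb hzr
      (Q₀ := Q₀) fun s hs u hu => hq₂ s ⟨(le_max_right _ _).trans hs.1, hs.2⟩ u (hb₂ hu)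
    rw [← hφ, ← h0, ← h1] at e3
    have e4 := EReal.coe_le_coe_iff.1 ((le_neg_half_mul e3).trans ((hconv γ hγ).trans e1))
    have e5 := (abs_le.1 e2).2
    have e6 : -(1 / 2) * (Q₀ z z + (3 * ε / μ + 4 * δ * ‖Q₀‖ / μ ^ 2) * B z z) ≤
        H u₀ z z + (3 * ε / μ + 4 * δ * ‖H u₀‖ / μ ^ 2) * B z z := by
      linarith
    have hsq : ∀ A : E →L[ℝ] E →L[ℝ] ℝ, A z z = η ^ 2 * A v v := fun A => by
      simp only [hz, map_smul, smul_apply, smul_eq_mul]; ring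
    rw [hsq Q₀, hsq (H u₀), hsq B] at e6
    have hη2 : 0 < η ^ 2 := by positivity
    have e7 : -(1 / 2) * (Q₀ v v + (3 * ε / μ + 4 * δ * ‖Q₀‖ / μ ^ 2) * B v v) ≤
        H u₀ v v + (3 * ε / μ + 4 * δ * ‖H u₀‖ / μ ^ 2) * B v v := by
      refine le_of_mul_le_mul_left ?_ hη2
      linarith
    have e8 : ∀ N : ℝ, 0 ≤ N → (3 * ε / μ + 4 * δ * N / μ ^ 2) * B v v ≤
        ε * ((3 / μ + 4 * N / μ ^ 2) * B v v) := by
      intro N hN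
      rw [← mul_assoc]
      refine mul_le_mul_of_nonneg_right ?_ (hB0 v)
      calc 3 * ε / μ + 4 * δ * N / μ ^ 2 ≤ 3 * ε / μ + 4 * ε * N / μ ^ 2 := by gcongr
        _ = _ := by ring
    have e9 := e8 _ (norm_nonneg Q₀)
    have e10 := e8 _ (norm_nonneg (H u₀))
    have e11 : ε * C = ε * ((3 / μ + 4 * ‖H u₀‖ / μ ^ 2) * B v v) +
        ε * ((3 / μ + 4 * ‖Q₀‖ / μ ^ 2) * B v v) / 2 := by rw [hC]; ring
    linarith
  have hfinal : -(1 / 2) * Q₀ v v ≤ H u₀ v v := by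
    refine le_of_forall_pos_le_add fun e he => ?_
    have := key (e / (C + 1)) (by positivity)
    refine this.trans ?_
    gcongr
    rw [div_mul_eq_mul_div, div_le_iff₀ (by positivity)]
    nlinarith
  exact (congrArg (fun y : ℝ => -(1 / 2) * y) hder).trans_le (hfinal.trans_eq hhess.symm)

end Manifold

end

theorem mainTheorem12 {E : Type*} [NormedAddCommGroup E] [NormedSpace ℝ E] [FiniteDimensional ℝ E]
    {M : Type*} [TopologicalSpace M] [T2Space M] [ChartedSpace E M] [IsManifold 𝓘(ℝ, E) ∞ M]
    (J : Set ℝ) (hJ : J.OrdConnected) (hJleft : ∀ t ∈ J, ∃ s ∈ J, s < t)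
    (g : ℝ → Bundle.RiemannianMetric (fun x : M => TangentSpace 𝓘(ℝ, E) x))
    (hg : IsSmoothMetricFamily J g)
    (V : ℝ → M → ℝ)
    (hV : ContMDiffOn (𝓘(ℝ, ℝ).prod 𝓘(ℝ, E)) 𝓘(ℝ, ℝ) ∞ (fun p : ℝ × M => V p.1 p.2)
      (J ×ˢ univ)) :
    IsStronglyDynamicallyConvex J (fun t => riemDist (g t)) V ↔
      ∀ t ∈ J, ∀ (x : M) (v : TangentSpace 𝓘(ℝ, E) x),
        -(1 / 2) * derivWithin (fun s => (g s).inner x v v) J t ≤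
          riemHessian (g t) (V t) x v v := by
  have hJu := hJ.uniqueDiffOn hJleft
  have hJm : MeasurableSet J := hJ.measurableSet
  constructor
  · intro h t ht x v
    by_contra! hlt
    rw [IsStronglyDynamicallyConvex, ae_restrict_iff' hJm] at h
    -- a strict violation at `t` persists on a left neighbourhood of `t`
    have hc : ContinuousOn (fun t => riemHessian (g t) (V t) x v v -
        -(1 / 2) * derivWithin (fun s => (g s).inner x v v) J t) J :=
      (hg.continuousOn_riemHessian hJu hV x v).sub
        ((hg.continuousOn_derivWithin_inner hJu x v).const_mul (-(1 / 2)))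
    have hev := (hc t ht).eventually (Iio_mem_nhds (sub_neg.2 hlt))
    obtain ⟨e, he, hsub⟩ := Metric.mem_nhdsWithin_iff.1 hev
    obtain ⟨s₁, hs₁, hst⟩ := hJleft t ht
    have hbad : Ioo (max s₁ (t - e)) t ⊆ {s | ¬ (s ∈ J → ∀ γ : ℝ → M,
        IsMetricGeodesic (riemDist (g s)) γ →
        UpperSemicontinuousOn (fun τ => V s (γ τ)) (Icc 0 1) ∧
        (∀ a b : ℝ, 0 < a → a < b → b < 1 →
          AbsolutelyContinuousOnInterval (fun τ => V s (γ τ)) a b) ∧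
        ((-(1 / 2) : ℝ) : EReal) *
            lowerLeftDerivSqDist (fun t => riemDist (g t)) s (γ 0) (γ 1) ≤
          -(lowerSlopeAtZero (fun τ => V s (γ τ)) - upperSlopeAtOne (fun τ => V s (γ τ))))} := by
      intro s hs hgood
      have h1 := (le_max_left s₁ (t - e)).trans_lt hs.1
      have h2 := (le_max_right s₁ (t - e)).trans_lt hs.1
      have hsJ : s ∈ J := hJ.out hs₁ ht ⟨h1.le, hs.2.le⟩
      have h3 := hg.neg_half_mul_le_riemHessian hJ hJleft hV hsJ
        (fun γ hγ => (hgood hsJ γ hγ).2.2) x v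
      have h4 := hsub ⟨by rw [Metric.mem_ball, Real.dist_eq, abs_lt]; constructor <;> linarith [hs.2],
        hsJ⟩
      exact absurd h3 (not_le.2 (sub_neg.1 h4))
    have h0 := measure_mono_null hbad (ae_iff.1 h)
    rw [Real.volume_Ioo, ENNReal.ofReal_eq_zero] at h0
    have : max s₁ (t - e) < t := max_lt hst (by linarith)
    linarith
  · intro h
    exact ae_restrict_of_forall_mem hJm fun t ht γ hγ =>
      hγ.dynamicConvexity hg hJ hJleft hV ht (h t ht)
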